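/- **Setting.** Let $\Sigma$ be the "brick wall" hexagonal lattice with vertex set $V=\mathbb Z^2\subset\mathbb R^2$, with all horizontal edges $(m,n)-(m+1,n)$ and the vertical edges $(m,n)-(m,n+1)$ for $m+n$ odd; the face with lower left corner $(m,n)$, $m+n$ odd, has the six vertices $(m+i,n+j)$, $0\le i\le 2$, $0\le j\le 1$. Put a qubit on each vertex. For $\Lambda\subset V$ let $\mathcal A(\Lambda)$ be the $C^*$-algebra of observables localized in $\Lambda$ (the norm closure of $\bigcup_{\Lambda'\subset\Lambda\text{ finite}}\bigotimes_{v\in\Lambda'}M_2(\mathbb C)$), and let $\mathcal A=\mathcal A(V)$ be the quasi-local algebra. For a face $f$ let $K_f=\prod_{v\in\partial f}\sigma^x_v$ and $J_f=\prod_{v\in\partial f}\sigma^z_v$. Let $\omega_0$ be the color code ground state, i.e. the (unique) state on $\mathcal A$ with $\omega_0(K_f)=\omega_0(J_f)=1$ for all faces $f$, and let $(\pi_0,\mathcal H,\Omega)$ be a GNS representation of $\omega_0$. A *cone* is a set $u+\{x\in\mathbb R^2: x\cdot a>\|x\|\cos\theta\}$ with $u\in\mathbb R^2$, $\|a\|=1$,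 $0<\theta<\pi$; we write $\mathcal A(\Lambda)=\mathcal A(\Lambda\cap V)$ and $\mathcal A(\Lambda^c)=\mathcal A(V\setminus\Lambda)$. A unital $*$-homomorphism $\pi:\mathcal A\to B(\mathcal H)$ is *localized* in $\Lambda$ if $\pi=\pi_0$ on $\mathcal A(\Lambda^c)$, and *transportable* if for every cone $\Lambda'$ it is unitarily equivalent to a $*$-homomorphism localized in $\Lambda'$. Fix a convex cone $\Lambda_0$ (i.e. $\theta_0\le\pi/2$) and let $\mathcal A^{au}$ be the norm closure of $\bigcup_{x\in\mathbb Z^2}\pi_0(\mathcal A(\Lambda_0+x))''$. For two cones contained in some $\Lambda_0+x$, $x\in\mathbb Z^2$, say that $\Lambda$ is *to the left of* $\Lambda'$ if $\Lambda$ can be rotated counterclockwise around its apex until it intersects $(\Lambda_0+x)^c$ without meeting $\Lambda'$ at any time (including the start). Call a $*$-homomorphism $\rho:\mathcal A\to\mathcal A^{au}$ (e.g. an endomorphism of $\mathcal A\cong\pi_0(\mathcal A)$) a *sector* if it is transportable and localized in some cone contained in a translate $\Lambda_0+x$; call it *braidable* if it is transportable and localized in some cone $\Lambda$ for which there exists a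 cone to the left of $\Lambda$. Intertwiners $\rho\to\rho'$ are the operators $T$ with $T\rho(A)=\rho'(A)T$ for all $A\in\mathcal A$. Let $\bar\rho:\mathcal A^{au}\to\mathcal A^{au}$ denote the $*$-homomorphism that extends $\rho$ (i.e. $\bar\rho\circ\pi_0=\rho$) and is continuous in the weak operator topology on each $\pi_0(\mathcal A(\Lambda_0+x))''$. Put $\rho\otimes\rho'=\bar\rho\circ\rho'$, and $S\otimes T=S\,\bar\rho_1(T)$ for intertwiners $S:\rho_1\to\rho_2$ and $T:\rho_1'\to\rho_2'$. Write $I_\rho=1$ for the identity intertwiner of $\rho$. For braidable $\rho$ and a sector $\rho'$, choose a cone $\Lambda$ in which $\rho$ is localized, a cone $\tilde\Lambda'$ to the left of $\Lambda$, and a unitary $U$ on $\mathcal H$ such that $U\rho'(\cdot)U^\dagger$ is localized in $\tilde\Lambda'$, and set $$\varepsilon_{\rho,\rho'}=U^\dagger\bar\rho(U).$$ **Proposition.** For every sector $\rho$ the extension $\bar\rho$ exists and is unique; intertwiners between sectors belong to $\mathcal A^{au}$; tensor products of sectors are sectors, and tensor products of braidable sectors are braidable. Moreover, $\varepsilon_{\rho,\rho'}$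 is well-defined: for all $\Lambda,\tilde\Lambda'$ as above a unitary $U$ as above exists, every such $U$ lies in $\mathcal A^{au}$, and $U^\dagger\bar\rho(U)$ does not depend on the choices of $\Lambda$, $\tilde\Lambda'$ and $U$. It satisfies: i) For $\rho$ braidable and $\rho'$ a sector, $\varepsilon_{\rho,\rho'}$ is an intertwiner from $\rho\otimes\rho'$ to $\rho'\otimes\rho$. ii) It is natural: if $\rho_1,\rho_2$ are braidable, $\rho'$ is a sector and $S:\rho_1\to\rho_2$ is an intertwiner, then $\varepsilon_{\rho_2,\rho'}(S\otimes I_{\rho'})=(I_{\rho'}\otimes S)\varepsilon_{\rho_1,\rho'}$; if $\rho$ is braidable, $\rho_1',\rho_2'$ are sectors and $T:\rho_1'\to\rho_2'$ is an intertwiner, then $\varepsilon_{\rho,\rho_2'}(I_\rho\otimes T)=(T\otimes I_\rho)\varepsilon_{\rho,\rho_1'}$. iii) It obeys the braiding identities $$\varepsilon_{\rho,\rho'\otimes\rho''}=(I_{\rho'}\otimes\varepsilon_{\rho,\rho''})(\varepsilon_{\rho,\rho'}\otimes I_{\rho''})\quad(\rho\text{ braidable},\ \rho',\rho''\text{ sectors}),$$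 $$\varepsilon_{\rho\otimes\rho',\rho''}=(\varepsilon_{\rho,\rho''}\otimes I_{\rho'})(I_\rho\otimes\varepsilon_{\rho',\rho''})\quad(\rho,\rho'\text{ braidable},\ \rho''\text{ a sector}).$$ -/

import Mathlib

open scoped ComplexOrder ComplexConjugate symmDiff
open Filter Topology

noncomputable section

namespace ColorCode

/-! ### The lattice

The trivalent lattice with rectangular ("brick wall") hexagons: the vertices are the integer points
of the plane, all horizontal edges `(m, n) - (m + 1, n)` are present, and the vertical edge
`(m, n) - (m, n + 1)` is present exactly when `m + n` is odd. -/

/-- The vertices of the lattice. -/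
abbrev Vertex : Type := ℤ × ℤ

/-- The position of a vertex in the plane `ℝ² = ℂ`. -/
def toPlane (v : Vertex) : ℂ := ⟨(v.1 : ℝ), (v.2 : ℝ)⟩

/-- The faces of the lattice; a face is labelled by its lower left corner. -/
def Face : Type := {f : ℤ × ℤ // Odd (f.1 + f.2)}

/-- The six vertices of a face. -/
def Face.boundary (f : Face) : List Vertex :=
  [(f.1.1, f.1.2), (f.1.1 + 1, f.1.2), (f.1.1 + 2, f.1.2),
   (f.1.1, f.1.2 + 1), (f.1.1 + 1, f.1.2 + 1), (f.1.1 + 2, f.1.2 + 1)]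

/-! ### The quasi-local algebra

There is one qubit at every vertex. The local algebras `⨂_{v ∈ Λ} M₂(ℂ)` are realized faithfully
on the Hilbert space with orthonormal basis the spin configurations that have finitely many spins
down (such a configuration is the finite set of its down spins). -/

/-- The Hilbert space `ℓ²` over the configurations with finitely many spins down. -/
abbrev Config : Type := lp (fun _ : Finset Vertex => ℂ) 2

theorem memlp_weighted (e : Finset Vertex ≃ Finset Vertex) (u : Finset Vertex → ℂ)
    (hu : ∀ S, ‖u S‖ = 1) (f : Config) :
    Memℓp (fun S => u S * f (e S)) 2 := by
  have h2 : (0 : ℝ) < (2 : ENNReal).toReal := by norm_num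
  have hf := (memℓp_gen_iff h2).1 (lp.memℓp f)
  refine (memℓp_gen_iff h2).2 ?_
  have := (e.summable_iff (f := fun S => ‖f S‖ ^ (2 : ENNReal).toReal)).2 hf
  refine this.congr (fun S => ?_)
  simp [hu]

/-- The isometric operator `(W f)(S) = u(S) f(e(S))`, for a permutation `e` of the configurations
and phases `u`. -/
def weighted (e : Finset Vertex ≃ Finset Vertex) (u : Finset Vertex → ℂ)
    (hu : ∀ S, ‖u S‖ = 1) : Config →L[ℂ] Config :=
  LinearIsometry.toContinuousLinearMap
    { toFun := fun f => ⟨fun S => u S * f (e S), memlp_weighted e u hu f⟩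
      map_add' := fun f g => by
        ext S
        exact mul_add _ _ _
      map_smul' := fun c f => by
        ext S
        exact mul_left_comm _ _ _
      norm_map' := fun f => by
        have h2 : (0 : ℝ) < (2 : ENNReal).toReal := by norm_num
        rw [lp.norm_eq_tsum_rpow h2, lp.norm_eq_tsum_rpow h2]
        congr 1
        rw [← e.tsum_eq (fun S => ‖f S‖ ^ (2 : ENNReal).toReal)]
        simp [hu] }

/-- The Pauli matrix `σˣ` at the site `v`: it flips the spin at `v`. -/
def sigmaX (v : Vertex) : Config →L[ℂ] Config :=
  weighted (symmDiff_right_involutive ({v} : Finset Vertex)).toPerm (fun _ => 1) (by simp)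

/-- The Pauli matrix `σᶻ` at the site `v`: it is `-1` on spin down at `v` and `1` on spin up. -/
def sigmaZ (v : Vertex) : Config →L[ℂ] Config :=
  weighted (Equiv.refl _) (fun S => if v ∈ S then -1 else 1) (by intro S; split_ifs <;> simp)

/-- The algebra `𝒜(Λ)` of observables localized in a set `Λ` of vertices: the norm closure of the
`*`-algebra generated by the matrix algebras `M₂(ℂ)` at the sites of `Λ` (each of which is generated
by its Pauli matrices). -/
def localAlgebra (Λ : Set Vertex) : StarSubalgebra ℂ (Config →L[ℂ] Config) :=
  (StarAlgebra.adjoin ℂ (sigmaX '' Λ ∪ sigmaZ '' Λ)).topologicalClosure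

/-- The quasi-local algebra `𝒜`. -/
abbrev QuasiLocal : Type := localAlgebra Set.univ

theorem sigmaX_mem {Λ : Set Vertex} {v : Vertex} (hv : v ∈ Λ) : sigmaX v ∈ localAlgebra Λ :=
  StarSubalgebra.le_topologicalClosure _
    (StarAlgebra.subset_adjoin ℂ _ (Or.inl (Set.mem_image_of_mem _ hv)))

theorem sigmaZ_mem {Λ : Set Vertex} {v : Vertex} (hv : v ∈ Λ) : sigmaZ v ∈ localAlgebra Λ :=
  StarSubalgebra.le_topologicalClosure _
    (StarAlgebra.subset_adjoin ℂ _ (Or.inr (Set.mem_image_of_mem _ hv)))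

/-- `σˣ` at `v` as an element of the quasi-local algebra. -/
def pauliX (v : Vertex) : QuasiLocal := ⟨sigmaX v, sigmaX_mem (Set.mem_univ v)⟩

/-- `σᶻ` at `v` as an element of the quasi-local algebra. -/
def pauliZ (v : Vertex) : QuasiLocal := ⟨sigmaZ v, sigmaZ_mem (Set.mem_univ v)⟩

/-- The stabilizer `K_f`, the product of `σˣ` over the vertices of the face `f`. -/
def stabK (f : Face) : QuasiLocal := (f.boundary.map pauliX).prod

/-- The stabilizer `J_f`, the product of `σᶻ` over the vertices of the face `f`. -/
def stabJ (f : Face) : QuasiLocal := (f.boundary.map pauliZ).prod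

/-! ### The ground state and its GNS representation -/

/-- `ω` is the color code ground state `ω₀`: the (unique) state on the quasi-local algebra in which
all stabilizers have expectation one. -/
structure IsGroundState (ω : QuasiLocal →ₗ[ℂ] ℂ) : Prop where
  nonneg : ∀ a : QuasiLocal, 0 ≤ ω (star a * a)
  map_one : ω 1 = 1
  map_stabK : ∀ f : Face, ω (stabK f) = 1
  map_stabJ : ∀ f : Face, ω (stabJ f) = 1

/-- A GNS representation `(π₀, H, Ω)` of the functional `ω`. -/
structure GNS (ω : QuasiLocal →ₗ[ℂ] ℂ) (H : Type*) [NormedAddCommGroup H] [InnerProductSpace ℂ H]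
    [CompleteSpace H] where
  rep : QuasiLocal →⋆ₐ[ℂ] (H →L[ℂ] H)
  vec : H
  cyclic : Dense (Set.range fun a : QuasiLocal => rep a vec)
  expect : ∀ a : QuasiLocal, inner ℂ vec (rep a vec) = ω a

/-! ### Cones -/

/-- A cone in the plane: apex, unit vector along the axis, and half-opening angle in `(0, π)`. -/
structure Cone where
  apex : ℂ
  axis : ℂ
  angle : ℝ
  norm_axis : ‖axis‖ = 1
  angle_pos : 0 < angle
  angle_lt : angle < Real.pi

namespace Cone

/-- The points `z` with `(z - apex) · axis > ‖z - apex‖ cos angle`. -/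
def region (Λ : Cone) : Set ℂ :=
  {z | ‖z - Λ.apex‖ * Real.cos Λ.angle < (conj Λ.axis * (z - Λ.apex)).re}

/-- The vertices of the lattice in the cone. -/
def vertices (Λ : Cone) : Set Vertex := {v | toPlane v ∈ Λ.region}

/-- The translated cone `Λ + x`. -/
def translate (Λ : Cone) (x : ℤ × ℤ) : Cone := { Λ with apex := Λ.apex + toPlane x }

/-- The cone, rotated counterclockwise around its apex by the angle `t`. -/
def rotate (Λ : Cone) (t : ℝ) : Cone :=
  { Λ with
    axis := Complex.exp (t * Complex.I) * Λ.axis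
    norm_axis := by simp [Complex.norm_exp_ofReal_mul_I, Λ.norm_axis] }

/-- The cone lies in some translate of `Λ₀`. -/
def FitsIn (Λ Λ₀ : Cone) : Prop := ∃ x : ℤ × ℤ, Λ.region ⊆ (Λ₀.translate x).region

/-- `Λ` is to the left of `Λ'`: both are contained in some `Λ₀ + x`, and `Λ` can be rotated
counterclockwise around its apex until it intersects the complement of `Λ₀ + x`, without meeting
`Λ'` during this process (in particular not at the beginning). -/
def IsLeftOf (Λ₀ Λ Λ' : Cone) : Prop :=
  ∃ x : ℤ × ℤ, Λ.region ⊆ (Λ₀.translate x).region ∧ Λ'.region ⊆ (Λ₀.translate x).region ∧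
    ∃ t : ℝ, 0 ≤ t ∧ ((Λ.rotate t).region ∩ (Λ₀.translate x).regionᶜ).Nonempty ∧
      ∀ s ∈ Set.Icc 0 t, Disjoint (Λ.rotate s).region Λ'.region

theorem exists_translate (Λ : Cone) (v : Vertex) : ∃ x : ℤ × ℤ, v ∈ (Λ.translate x).vertices := by
  have hc : Real.cos Λ.angle < 1 := by
    have := Real.cos_lt_cos_of_nonneg_of_le_pi le_rfl Λ.angle_lt.le Λ.angle_pos
    simpa using this
  obtain ⟨n, hn⟩ := exists_nat_gt (4 / (1 - Real.cos Λ.angle))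
  rw [div_lt_iff₀ (by linarith)] at hn
  set z : ℂ := Λ.apex + n * Λ.axis with hz
  set p : ℤ × ℤ := (round z.re, round z.im) with hp
  refine ⟨v - p, ?_⟩
  set δ : ℂ := toPlane p - z with hδ
  have hδn : ‖δ‖ ≤ 2 := by
    refine (Complex.norm_le_abs_re_add_abs_im δ).trans ?_
    have h1 : |δ.re| ≤ 1 / 2 := by
      have := abs_sub_round z.re
      rw [abs_sub_comm] at this
      simpa [hδ, toPlane, hp] using this
    have h2 : |δ.im| ≤ 1 / 2 := by
      have := abs_sub_round z.im
      rw [abs_sub_comm] at this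
      simpa [hδ, toPlane, hp] using this
    linarith
  have hw : toPlane v - (Λ.translate (v - p)).apex = n * Λ.axis + δ := by
    have : toPlane (v - p) = toPlane v - toPlane p := by
      apply Complex.ext <;> simp [toPlane]
    simp only [translate, this, hδ, hz]
    ring
  have haxis : conj Λ.axis * Λ.axis = 1 := by
    rw [← Complex.normSq_eq_conj_mul_self, Complex.normSq_eq_norm_sq, Λ.norm_axis]
    simp
  have hre : (conj Λ.axis * (n * Λ.axis + δ)).re = n + (conj Λ.axis * δ).re := by
    have : conj Λ.axis * (n * Λ.axis + δ) = n + conj Λ.axis * δ := by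
      linear_combination (n : ℂ) * haxis
    rw [this]
    simp
  have hbd : |(conj Λ.axis * δ).re| ≤ 2 := by
    refine (Complex.abs_re_le_norm _).trans ?_
    rw [norm_mul, Complex.norm_conj, Λ.norm_axis, one_mul]
    exact hδn
  have hnorm : |‖(n : ℂ) * Λ.axis + δ‖ - n| ≤ 2 := by
    have h := abs_norm_sub_norm_le ((n : ℂ) * Λ.axis + δ) ((n : ℂ) * Λ.axis)
    have h' : ‖(n : ℂ) * Λ.axis‖ = n := by simp [Λ.norm_axis]
    rw [h', add_sub_cancel_left] at h
    exact h.trans hδn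
  have hcos : (‖(n : ℂ) * Λ.axis + δ‖ - n) * Real.cos Λ.angle ≤ 2 := by
    refine (le_abs_self _).trans ?_
    rw [abs_mul]
    have := Real.abs_cos_le_one Λ.angle
    nlinarith [abs_nonneg (‖(n : ℂ) * Λ.axis + δ‖ - n), abs_nonneg (Real.cos Λ.angle)]
  change ‖toPlane v - (Λ.translate (v - p)).apex‖ * Real.cos Λ.angle <
    (conj Λ.axis * (toPlane v - (Λ.translate (v - p)).apex)).re
  rw [hw, hre]
  have := (abs_le.1 hbd).1
  nlinarith

end Cone

/-! ### Cone von Neumann algebras and the auxiliary algebra -/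

variable {H : Type*} [NormedAddCommGroup H] [InnerProductSpace ℂ H] [CompleteSpace H]
variable {ω : QuasiLocal →ₗ[ℂ] ℂ}

namespace GNS

/-- The bicommutant `π₀(𝒜(Λ))''`. -/
def vonNeumann (G : GNS ω H) (Λ : Set Vertex) : StarSubalgebra ℂ (H →L[ℂ] H) :=
  StarSubalgebra.centralizer ℂ (StarSubalgebra.centralizer ℂ
    (G.rep '' {a : QuasiLocal | (a : Config →L[ℂ] Config) ∈ localAlgebra Λ}) :
      Set (H →L[ℂ] H))

/-- The auxiliary algebra `𝒜ᵃᵘ`: the norm closure of the (directed) union of the algebras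
`π₀(𝒜(Λ₀ + x))''`, where `x` runs over `ℤ²`. -/
def aux (G : GNS ω H) (Λ₀ : Cone) : StarSubalgebra ℂ (H →L[ℂ] H) :=
  (⨆ x : ℤ × ℤ, G.vonNeumann (Λ₀.translate x).vertices).topologicalClosure

theorem rep_mem_vonNeumann (G : GNS ω H) {Λ : Set Vertex} {a : QuasiLocal}
    (ha : (a : Config →L[ℂ] Config) ∈ localAlgebra Λ) : G.rep a ∈ G.vonNeumann Λ := by
  rw [vonNeumann, StarSubalgebra.mem_centralizer_iff]
  intro g hg
  have hg' := (StarSubalgebra.mem_centralizer_iff ℂ).1 hg _ (Set.mem_image_of_mem _ ha)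
  have hs : star g ∈ StarSubalgebra.centralizer ℂ
      (G.rep '' {a : QuasiLocal | (a : Config →L[ℂ] Config) ∈ localAlgebra Λ}) := star_mem hg
  have hs' := (StarSubalgebra.mem_centralizer_iff ℂ).1 hs _ (Set.mem_image_of_mem _ ha)
  exact ⟨hg'.1.symm, hs'.1.symm⟩

theorem rep_mem_aux (G : GNS ω H) (Λ₀ : Cone) (a : QuasiLocal) : G.rep a ∈ G.aux Λ₀ := by
  have hgen : ∀ b : QuasiLocal, ∀ v : Vertex,
      (b : Config →L[ℂ] Config) ∈ localAlgebra {v} → G.rep b ∈ G.aux Λ₀ := by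
    intro b v hb
    obtain ⟨x, hx⟩ := Λ₀.exists_translate v
    refine StarSubalgebra.le_topologicalClosure _
      ((le_iSup (fun x => G.vonNeumann (Λ₀.translate x).vertices) x) (G.rep_mem_vonNeumann ?_))
    refine (StarSubalgebra.topologicalClosure_mono (StarAlgebra.adjoin_mono ?_)) hb
    exact Set.union_subset_union (Set.image_mono (by simpa using hx))
      (Set.image_mono (by simpa using hx))
  have hclosed : IsClosed (localAlgebra Set.univ : Set (Config →L[ℂ] Config)) :=
    StarSubalgebra.isClosed_topologicalClosure _
  have hcont : Continuous G.rep :=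
    AddMonoidHomClass.continuous_of_bound G.rep 1
      (fun b => by simpa using NonUnitalStarAlgHom.norm_apply_le G.rep b)
  have hT : localAlgebra Set.univ ≤
      ((G.aux Λ₀).comap G.rep).map (localAlgebra Set.univ).subtype := by
    refine StarSubalgebra.topologicalClosure_minimal ?_ ?_
    · refine StarAlgebra.adjoin_le ?_
      rintro _ (⟨v, -, rfl⟩ | ⟨v, -, rfl⟩)
      · exact ⟨pauliX v, hgen _ v (sigmaX_mem (Set.mem_singleton v)), rfl⟩
      · exact ⟨pauliZ v, hgen _ v (sigmaZ_mem (Set.mem_singleton v)), rfl⟩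
    · refine hclosed.isClosedEmbedding_subtypeVal.isClosedMap _ ?_
      exact (StarSubalgebra.isClosed_topologicalClosure _).preimage hcont
  obtain ⟨b, hb, hba⟩ := hT a.2
  have : b = a := Subtype.ext hba
  exact this ▸ hb

/-- The representation `π₀`, with values in the auxiliary algebra. -/
def incl (G : GNS ω H) (Λ₀ : Cone) : QuasiLocal →⋆ₐ[ℂ] G.aux Λ₀ :=
  G.rep.codRestrict (G.aux Λ₀) (G.rep_mem_aux Λ₀)

/-! ### Localized and transportable endomorphisms -/

/-- `π` is localized in the cone `Λ`: it agrees with `π₀` on `𝒜(Λᶜ)`. -/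
def LocalizedIn (G : GNS ω H) (π : QuasiLocal →⋆ₐ[ℂ] (H →L[ℂ] H)) (Λ : Cone) : Prop :=
  ∀ a : QuasiLocal, (a : Config →L[ℂ] Config) ∈ localAlgebra Λ.verticesᶜ → π a = G.rep a

/-- `π` is transportable: for every cone it is unitarily equivalent to a homomorphism that is
localized in that cone. -/
def Transportable (G : GNS ω H) (π : QuasiLocal →⋆ₐ[ℂ] (H →L[ℂ] H)) : Prop :=
  ∀ Λ : Cone, ∃ π' : QuasiLocal →⋆ₐ[ℂ] (H →L[ℂ] H), G.LocalizedIn π' Λ ∧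
    ∃ U ∈ unitary (H →L[ℂ] H), ∀ a, π' a = star U * π a * U

/-- The homomorphisms `𝒜 → 𝒜ᵃᵘ`. They comprise the endomorphisms of `𝒜` (compose with `π₀`) and the
restrictions to `𝒜` of the endomorphisms of `𝒜ᵃᵘ`. -/
abbrev Endo (G : GNS ω H) (Λ₀ : Cone) : Type _ := QuasiLocal →⋆ₐ[ℂ] G.aux Λ₀

variable {G : GNS ω H} {Λ₀ : Cone}

/-- `ρ` as a representation on `H`. -/
def Endo.toRep (ρ : G.Endo Λ₀) : QuasiLocal →⋆ₐ[ℂ] (H →L[ℂ] H) := (G.aux Λ₀).subtype.comp ρ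

/-- `ρ` is transportable, and localized in a cone that lies in a translate of `Λ₀`. -/
structure IsSector (ρ : G.Endo Λ₀) : Prop where
  localized : ∃ Λ : Cone, Λ.FitsIn Λ₀ ∧ G.LocalizedIn (Endo.toRep ρ) Λ
  transportable : G.Transportable (Endo.toRep ρ)

/-- `ρ` is transportable, and localized in a cone for which there is a cone to the left. -/
structure IsBraidable (ρ : G.Endo Λ₀) : Prop where
  localized : ∃ Λ Λ' : Cone, Cone.IsLeftOf Λ₀ Λ' Λ ∧ G.LocalizedIn (Endo.toRep ρ) Λ
  transportable : G.Transportable (Endo.toRep ρ)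

/-! ### The extension to the auxiliary algebra -/

/-- `e` is an extension of `ρ` from `𝒜 = π₀(𝒜)` to `𝒜ᵃᵘ` that is continuous for the weak operator
topology on each of the algebras `π₀(𝒜(Λ₀ + x))''`. -/
structure IsExtension (ρ : G.Endo Λ₀) (e : G.aux Λ₀ →⋆ₐ[ℂ] G.aux Λ₀) : Prop where
  extends_rep : ∀ a, e (G.incl Λ₀ a) = ρ a
  weakly_continuous : ∀ (x : ℤ × ℤ) (l : Filter (G.aux Λ₀)) (b : G.aux Λ₀),
    (∀ᶠ c : G.aux Λ₀ in l, (c : H →L[ℂ] H) ∈ G.vonNeumann (Λ₀.translate x).vertices) →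
    (b : H →L[ℂ] H) ∈ G.vonNeumann (Λ₀.translate x).vertices →
    (∀ ξ η : H, Tendsto (fun c : G.aux Λ₀ => inner ℂ ξ ((c : H →L[ℂ] H) η)) l
      (𝓝 (inner ℂ ξ ((b : H →L[ℂ] H) η)))) →
    ∀ ξ η : H, Tendsto (fun c : G.aux Λ₀ => inner ℂ ξ ((e c : H →L[ℂ] H) η)) l
      (𝓝 (inner ℂ ξ ((e b : H →L[ℂ] H) η)))

open Classical in
/-- The extension `ρ̄` of `ρ` to `𝒜ᵃᵘ` (the identity if there is none). -/
def ext (ρ : G.Endo Λ₀) : G.aux Λ₀ →⋆ₐ[ℂ] G.aux Λ₀ :=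
  if h : ∃ e, IsExtension ρ e then h.choose else StarAlgHom.id ℂ _

/-! ### Intertwiners, tensor products and the braiding -/

/-- `T` is an intertwiner from `ρ` to `ρ'`. -/
def IsIntertwiner (ρ ρ' : G.Endo Λ₀) (T : H →L[ℂ] H) : Prop :=
  ∀ a, T * (ρ a : H →L[ℂ] H) = (ρ' a : H →L[ℂ] H) * T

/-- The tensor product `ρ ⊗ ρ' = ρ̄ ∘ ρ'`. -/
def tensor (ρ ρ' : G.Endo Λ₀) : G.Endo Λ₀ := (ext ρ).comp ρ'

/-- The tensor product `S ⊗ T = S ρ̄(T)` of an intertwiner `S` from `ρ` with an intertwiner `T`. -/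
def tensorHom (ρ : G.Endo Λ₀) (S T : G.aux Λ₀) : G.aux Λ₀ := S * ext ρ T

/-- The data chosen to define the braiding of `ρ` and `ρ'`: a cone `Λ` in which `ρ` is localized, a
cone `Λ'` to the left of `Λ`, and a unitary `U` such that `U ρ'(·) U†` is localized in `Λ'`. -/
structure IsChoice (ρ ρ' : G.Endo Λ₀) (Λ Λ' : Cone) (U : H →L[ℂ] H) : Prop where
  localized : G.LocalizedIn (Endo.toRep ρ) Λ
  left : Cone.IsLeftOf Λ₀ Λ' Λ
  mem_unitary : U ∈ unitary (H →L[ℂ] H)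
  transport : ∀ a : QuasiLocal, (a : Config →L[ℂ] Config) ∈ localAlgebra Λ'.verticesᶜ →
    U * (ρ' a : H →L[ℂ] H) * star U = G.rep a

/-- `ε = U† ρ̄(U)` for some choice of the data. -/
def IsBraiding (ρ ρ' : G.Endo Λ₀) (ε : G.aux Λ₀) : Prop :=
  ∃ (Λ Λ' : Cone) (U : G.aux Λ₀), IsChoice ρ ρ' Λ Λ' U ∧ ε = star U * ext ρ U

open Classical in
/-- The braiding `ε_{ρ,ρ'}` (zero if no choice of the data is possible). -/
def braiding (ρ ρ' : G.Endo Λ₀) : G.aux Λ₀ :=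
  if h : ∃ ε, IsBraiding ρ ρ' ε then h.choose else 0

end GNS

end ColorCode

end

/-! Everything rests on Haag duality for convex cones: an operator that commutes with the
observables outside `Λ` lies in `π₀(𝒜(Λ))''`.

Pauli operators applied to `Ω` give an orthonormal basis labelled by syndromes, that is, by the sets
of violated stabilizers. Different syndromes give different stabilizer eigenvalues. Equal syndromes
give the same vector up to a sign, because a finite set that meets every face evenly is a sum of
faces (`even_induction`). Let `T` commute with the observables outside `Λ` and `B` with those
inside. Expanded in this basis, `⟨Ω, TBΩ⟩` and `⟨Ω, BTΩ⟩` agree term by term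
(`inner_mul_inner_pauli`). Terms with an excited face entirely inside or entirely outside `Λ`
vanish. The other syndromes live on boundary faces, and if `Λ` and its complement are connected they
can be created from either side (`exists_syndrome_eq`). Sandwiching with Pauli operators turns this
vacuum identity into `TB = BT`. The lattice points of a cone satisfy the connectedness conditions
after removal of finitely many sites, and sites can be put back one by one
(`mem_vonNeumann_insert`).

A sector can be transported to a cone disjoint from a given convex cone, so on the latter it is
implemented by a unitary. Any weakly continuous extension must be conjugation with that unitary on
the cone algebra (`IsExtension.apply_eq`). These conjugations are mutually consistent and converge
on `𝒜ᵃᵘ` (`exists_isExtension`). Haag duality keeps the values in `𝒜ᵃᵘ` and places intertwiners and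
charge transporters in cone algebras. For tensor products, transportability to cones outside all
translates of `Λ₀` requires a passage to the auxiliary algebra of another half-plane
(`IsSector.tensor`).

For the braiding, a cone to the left of `Λ` sweeps out, while rotating, a sector that is disjoint
from `Λ` and reaches the left boundary direction of `Λ₀` (`IsLeftOf.exists_isLeftSector`). Any two
such sectors contain a common cone. Since `ρ̄` fixes the algebras of cones disjoint from the
localization of `ρ`, the element `U† ρ̄(U)` is independent of the choices (`star_mul_ext_eq`).
Sectors localized in disjoint cones commute (`tensor_comm_of_disjoint`); the intertwining property,
naturality and the braiding identities then follow by algebra. -/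

noncomputable section

namespace ColorCode

/-! ### Pauli operators with finite support -/

/-- The commutation sign `(-1) ^ |D ∩ E|`. -/
def sgn (D E : Finset Vertex) : ℂ := (-1) ^ (D ∩ E).card

theorem neg_one_pow_card_symmDiff (D E : Finset Vertex) :
    (-1 : ℂ) ^ (D ∆ E).card = (-1) ^ D.card * (-1) ^ E.card := by
  have h : (D ∆ E).card + 2 * (D ∩ E).card = D.card + E.card := by
    have h1 : (D ∆ E).card = (D \ E).card + (E \ D).card := by
      rw [symmDiff_def]
      exact Finset.card_union_of_disjoint disjoint_sdiff_sdiff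
    have h2 := Finset.card_sdiff_add_card_inter D E
    have h3 := Finset.card_sdiff_add_card_inter E D
    rw [Finset.inter_comm] at h3
    omega
  rw [← pow_add, ← h, pow_add, pow_mul]
  simp

theorem sgn_symmDiff_left (D E F : Finset Vertex) : sgn (D ∆ E) F = sgn D F * sgn E F := by
  have : (D ∆ E) ∩ F = (D ∩ F) ∆ (E ∩ F) := by
    ext v; simp only [Finset.mem_inter, Finset.mem_symmDiff]; tauto
  rw [sgn, this, neg_one_pow_card_symmDiff]; rfl

theorem sgn_comm (D E : Finset Vertex) : sgn D E = sgn E D := by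
  rw [sgn, sgn, Finset.inter_comm]

theorem sgn_symmDiff_right (D E F : Finset Vertex) : sgn D (E ∆ F) = sgn D E * sgn D F := by
  rw [sgn_comm, sgn_symmDiff_left, sgn_comm E, sgn_comm F]

theorem sgn_mul_self (D E : Finset Vertex) : sgn D E * sgn D E = 1 := by
  rw [sgn, ← mul_pow]; simp

theorem norm_sgn (D E : Finset Vertex) : ‖sgn D E‖ = 1 := by simp [sgn]

theorem conj_sgn (D E : Finset Vertex) : conj (sgn D E) = sgn D E := by simp [sgn]

theorem sgn_eq_one_or (D E : Finset Vertex) : sgn D E = 1 ∨ sgn D E = -1 := neg_one_pow_eq_or ℂ _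

theorem sgn_of_disjoint {D E : Finset Vertex} (h : Disjoint D E) : sgn D E = 1 := by
  rw [sgn, Finset.disjoint_iff_inter_eq_empty.1 h]; simp

theorem sgn_singleton (S : Finset Vertex) (v : Vertex) :
    sgn S {v} = if v ∈ S then -1 else 1 := by
  split_ifs with h
  · rw [sgn, Finset.inter_singleton_of_mem h]; simp
  · rw [sgn, Finset.inter_singleton_of_notMem h]; simp

/-- An isometry preserves inner products, so ⟨Tf, T(Tg)⟩ = ⟨f, Tg⟩, and the left side is ⟨Tf, g⟩. -/
theorem star_eq_self_of_isometry {E : Type*} [NormedAddCommGroup E] [InnerProductSpace ℂ E]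
    [CompleteSpace E] (T : E →L[ℂ] E) (hT : ∀ f, ‖T f‖ = ‖f‖) (h : T * T = 1) : star T = T := by
  let L : E →ₗᵢ[ℂ] E := ⟨T.toLinearMap, hT⟩
  rw [ContinuousLinearMap.star_eq_adjoint]
  symm
  rw [ContinuousLinearMap.eq_adjoint_iff]
  intro f g
  have h1 : T (T g) = g := by simpa using congrArg (fun A : E →L[ℂ] E => A g) h
  have h2 : inner ℂ (L f) (L (T g)) = inner ℂ f (T g) := L.inner_map_map f (T g)
  have h3 : inner ℂ (T f) (T (T g)) = inner ℂ f (T g) := h2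
  rwa [h1] at h3

theorem norm_weighted (e : Finset Vertex ≃ Finset Vertex) (u : Finset Vertex → ℂ)
    (hu : ∀ S, ‖u S‖ = 1) (f : Config) : ‖weighted e u hu f‖ = ‖f‖ := by
  have h (L : Config →ₗᵢ[ℂ] Config) : ‖L.toContinuousLinearMap f‖ = ‖f‖ := L.norm_map f
  exact h _

theorem weighted_apply (e : Finset Vertex ≃ Finset Vertex) (u : Finset Vertex → ℂ)
    (hu : ∀ S, ‖u S‖ = 1) (f : Config) (S : Finset Vertex) :
    weighted e u hu f S = u S * f (e S) := rfl

/-- The product of `σˣ` over `D`. -/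
def flipX (D : Finset Vertex) : Config →L[ℂ] Config :=
  weighted (symmDiff_right_involutive D).toPerm (fun _ => 1) (by simp)

/-- The product of `σᶻ` over `D`. -/
def signZ (D : Finset Vertex) : Config →L[ℂ] Config :=
  weighted (Equiv.refl _) (fun S => sgn S D) (fun S => norm_sgn S D)

theorem flipX_apply (D : Finset Vertex) (f : Config) (S : Finset Vertex) :
    flipX D f S = f (D ∆ S) := by
  rw [flipX, weighted_apply, one_mul]; rfl

theorem signZ_apply (D : Finset Vertex) (f : Config) (S : Finset Vertex) :
    signZ D f S = sgn S D * f S := rfl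

theorem signZ_singleton (v : Vertex) : signZ {v} = sigmaZ v := by
  ext f S
  rw [signZ_apply, sgn_singleton]; rfl

theorem flipX_mul (D E : Finset Vertex) : flipX D * flipX E = flipX (D ∆ E) := by
  ext f S
  simp only [mul_apply_eq_comp, flipX_apply, symmDiff_left_comm E D, symmDiff_assoc]

theorem signZ_mul (D E : Finset Vertex) : signZ D * signZ E = signZ (D ∆ E) := by
  ext f S
  simp only [mul_apply_eq_comp, signZ_apply, sgn_symmDiff_right, mul_assoc]

theorem flipX_mul_signZ (D E : Finset Vertex) :
    flipX D * signZ E = sgn D E • (signZ E * flipX D) := by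
  ext f S
  simp only [mul_apply_eq_comp, _root_.smul_apply, lp.coeFn_smul,
    Pi.smul_apply, signZ_apply, flipX_apply, sgn_symmDiff_left, smul_eq_mul]
  ring

theorem flipX_empty : flipX ∅ = 1 := by
  ext f S
  rw [flipX_apply, ← Finset.bot_eq_empty, bot_symmDiff]
  rfl

theorem signZ_empty : signZ ∅ = 1 := by
  ext f S
  rw [signZ_apply]
  simp [sgn]

theorem star_flipX (D : Finset Vertex) : star (flipX D) = flipX D :=
  star_eq_self_of_isometry _ (norm_weighted _ _ _) (by rw [flipX_mul, symmDiff_self]; exact flipX_empty)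

theorem star_signZ (D : Finset Vertex) : star (signZ D) = signZ D :=
  star_eq_self_of_isometry _ (norm_weighted _ _ _) (by rw [signZ_mul, symmDiff_self]; exact signZ_empty)

theorem insert_eq_symmDiff {D : Finset Vertex} {v : Vertex} (hv : v ∉ D) :
    insert v D = {v} ∆ D := by
  ext w
  simp only [Finset.mem_insert, Finset.mem_symmDiff, Finset.mem_singleton]
  by_cases h : w = v
  · subst h; tauto
  · tauto

theorem flipX_mem {D : Finset Vertex} {Λ : Set Vertex} (h : ↑D ⊆ Λ) : flipX D ∈ localAlgebra Λ := by
  induction D using Finset.induction_on with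
  | empty => rw [flipX_empty]; exact one_mem _
  | insert v D hv ih =>
    rw [Finset.coe_insert, Set.insert_subset_iff] at h
    rw [insert_eq_symmDiff hv, ← flipX_mul]
    exact mul_mem (sigmaX_mem h.1) (ih h.2)

theorem signZ_mem {D : Finset Vertex} {Λ : Set Vertex} (h : ↑D ⊆ Λ) : signZ D ∈ localAlgebra Λ := by
  induction D using Finset.induction_on with
  | empty => rw [signZ_empty]; exact one_mem _
  | insert v D hv ih =>
    rw [Finset.coe_insert, Set.insert_subset_iff] at h
    rw [insert_eq_symmDiff hv, ← signZ_mul]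
    exact mul_mem (by rw [signZ_singleton]; exact sigmaZ_mem h.1) (ih h.2)

/-- The product of `σˣ` over `D` as an element of the quasi-local algebra. -/
def opX (D : Finset Vertex) : QuasiLocal := ⟨flipX D, flipX_mem (Set.subset_univ _)⟩

/-- The product of `σᶻ` over `D` as an element of the quasi-local algebra. -/
def opZ (D : Finset Vertex) : QuasiLocal := ⟨signZ D, signZ_mem (Set.subset_univ _)⟩

theorem opX_mul (D E : Finset Vertex) : opX D * opX E = opX (D ∆ E) := Subtype.ext (flipX_mul D E)

theorem opZ_mul (D E : Finset Vertex) : opZ D * opZ E = opZ (D ∆ E) := Subtype.ext (signZ_mul D E)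

theorem opX_empty : opX ∅ = 1 := Subtype.ext flipX_empty

theorem opZ_empty : opZ ∅ = 1 := Subtype.ext signZ_empty

theorem opX_mul_opZ (D E : Finset Vertex) : opX D * opZ E = sgn D E • (opZ E * opX D) :=
  Subtype.ext (flipX_mul_signZ D E)

theorem star_opX (D : Finset Vertex) : star (opX D) = opX D := Subtype.ext (star_flipX D)

theorem star_opZ (D : Finset Vertex) : star (opZ D) = opZ D := Subtype.ext (star_signZ D)

theorem opX_singleton (v : Vertex) : opX {v} = pauliX v := rfl

theorem opZ_singleton (v : Vertex) : opZ {v} = pauliZ v := Subtype.ext (signZ_singleton v)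

/-! ### Faces and stabilizers -/

/-- The face with lower left corner `(a, b)`. -/
def Face.corner (a b : ℤ) (h : Odd (a + b)) : Face := ⟨(a, b), h⟩

/-- The abscissa of the lower left corner. -/
def Face.col (f : Face) : ℤ := f.1.1

/-- The ordinate of the lower left corner. -/
def Face.row (f : Face) : ℤ := f.1.2

@[simp] theorem Face.col_corner (a b : ℤ) (h : Odd (a + b)) : (corner a b h).col = a := rfl

@[simp] theorem Face.row_corner (a b : ℤ) (h : Odd (a + b)) : (corner a b h).row = b := rfl

theorem Face.odd_col_add_row (f : Face) : Odd (f.col + f.row) := f.2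

theorem Face.eq_of_col_row {f g : Face} (h1 : f.col = g.col) (h2 : f.row = g.row) : f = g :=
  Subtype.ext (Prod.ext h1 h2)

/-- The set of vertices of a face. -/
def Face.support (f : Face) : Finset Vertex := f.boundary.toFinset

theorem Face.mem_support {f : Face} {v : Vertex} : v ∈ f.support ↔
    f.col ≤ v.1 ∧ v.1 ≤ f.col + 2 ∧ f.row ≤ v.2 ∧ v.2 ≤ f.row + 1 := by
  obtain ⟨a, b⟩ := v
  simp only [Face.col, Face.row, Face.support, Face.boundary, List.mem_toFinset, List.mem_cons, Prod.mk.injEq,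
    List.not_mem_nil, or_false]
  omega

theorem prod_opX_of_nodup {l : List Vertex} (h : l.Nodup) :
    (l.map pauliX).prod = opX l.toFinset := by
  induction l with
  | nil => exact opX_empty.symm
  | cons v l ih =>
    rw [List.nodup_cons] at h
    rw [List.map_cons, List.prod_cons, ih h.2, List.toFinset_cons,
      insert_eq_symmDiff (by simpa using h.1), ← opX_mul, opX_singleton]

theorem prod_opZ_of_nodup {l : List Vertex} (h : l.Nodup) :
    (l.map pauliZ).prod = opZ l.toFinset := by
  induction l with
  | nil => exact opZ_empty.symm
  | cons v l ih =>
    rw [List.nodup_cons] at h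
    rw [List.map_cons, List.prod_cons, ih h.2, List.toFinset_cons,
      insert_eq_symmDiff (by simpa using h.1), ← opZ_mul, opZ_singleton]

theorem Face.nodup_boundary (f : Face) : f.boundary.Nodup := by
  obtain ⟨⟨a, b⟩, hf⟩ := f
  simp [Face.boundary]

theorem stabK_eq (f : Face) : stabK f = opX f.support := prod_opX_of_nodup f.nodup_boundary

theorem stabJ_eq (f : Face) : stabJ f = opZ f.support := prod_opZ_of_nodup f.nodup_boundary

/-! ### Generators of the local algebras -/

theorem localAlgebra_mono {Λ M : Set Vertex} (h : Λ ⊆ M) : localAlgebra Λ ≤ localAlgebra M :=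
  StarSubalgebra.topologicalClosure_mono (StarAlgebra.adjoin_mono
    (Set.union_subset_union (Set.image_mono h) (Set.image_mono h)))

theorem isSelfAdjoint_sigmaX (v : Vertex) : star (sigmaX v) = sigmaX v := star_flipX {v}

theorem isSelfAdjoint_sigmaZ (v : Vertex) : star (sigmaZ v) = sigmaZ v := by
  rw [← signZ_singleton]; exact star_signZ {v}

/-- The generators are self-adjoint, so adjoining stars adds nothing. Inductions over local algebras
then need no case for the star. -/
theorem mem_adjoin_iff {Λ : Set Vertex} {y : Config →L[ℂ] Config} :
    y ∈ StarAlgebra.adjoin ℂ (sigmaX '' Λ ∪ sigmaZ '' Λ) ↔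
      y ∈ Algebra.adjoin ℂ (sigmaX '' Λ ∪ sigmaZ '' Λ) := by
  rw [← StarSubalgebra.mem_toSubalgebra, StarAlgebra.adjoin_toSubalgebra]
  have : star (sigmaX '' Λ ∪ sigmaZ '' Λ) = sigmaX '' Λ ∪ sigmaZ '' Λ := by
    ext y
    constructor
    · rintro (⟨v, hv, h⟩ | ⟨v, hv, h⟩)
      · exact Or.inl ⟨v, hv, by rw [← star_star y, ← h, isSelfAdjoint_sigmaX]⟩
      · exact Or.inr ⟨v, hv, by rw [← star_star y, ← h, isSelfAdjoint_sigmaZ]⟩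
    · rintro (⟨v, hv, rfl⟩ | ⟨v, hv, rfl⟩)
      · exact Or.inl ⟨v, hv, (isSelfAdjoint_sigmaX v).symm⟩
      · exact Or.inr ⟨v, hv, (isSelfAdjoint_sigmaZ v).symm⟩
  rw [this, Set.union_self]

/-- A norm-closed subspace of the quasi-local algebra that is a subalgebra and contains the Pauli
matrices at the sites of `Λ` contains `𝒜(Λ)`. -/
theorem localAlgebra_induction {Λ : Set Vertex} {P : QuasiLocal → Prop}
    (hclosed : IsClosed {a | P a}) (hX : ∀ v ∈ Λ, P (pauliX v)) (hZ : ∀ v ∈ Λ, P (pauliZ v))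
    (hscalar : ∀ c : ℂ, P (algebraMap ℂ _ c)) (hadd : ∀ a b, P a → P b → P (a + b))
    (hmul : ∀ a b, P a → P b → P (a * b)) (a : QuasiLocal)
    (ha : (a : Config →L[ℂ] Config) ∈ localAlgebra Λ) : P a := by
  have hle : ∀ y ∈ StarAlgebra.adjoin ℂ (sigmaX '' Λ ∪ sigmaZ '' Λ),
      ∃ h : y ∈ localAlgebra Set.univ, P ⟨y, h⟩ := by
    intro y hy
    rw [mem_adjoin_iff] at hy
    induction hy using Algebra.adjoin_induction with
    | mem x hx =>
      rcases hx with ⟨v, hv, rfl⟩ | ⟨v, hv, rfl⟩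
      · exact ⟨sigmaX_mem (Set.mem_univ v), hX v hv⟩
      · exact ⟨sigmaZ_mem (Set.mem_univ v), hZ v hv⟩
    | algebraMap c => exact ⟨algebraMap_mem (localAlgebra Set.univ) c, hscalar c⟩
    | add x y _ _ hx hy =>
      obtain ⟨h1, h1'⟩ := hx
      obtain ⟨h2, h2'⟩ := hy
      exact ⟨add_mem h1 h2, hadd _ _ h1' h2'⟩
    | mul x y _ _ hx hy =>
      obtain ⟨h1, h1'⟩ := hx
      obtain ⟨h2, h2'⟩ := hy
      exact ⟨mul_mem h1 h2, hmul _ _ h1' h2'⟩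
  have ha' : (a : Config →L[ℂ] Config) ∈
      closure (StarAlgebra.adjoin ℂ (sigmaX '' Λ ∪ sigmaZ '' Λ) : Set (Config →L[ℂ] Config)) := ha
  obtain ⟨u, hu, hlim⟩ := mem_closure_iff_seq_limit.1 ha'
  have : a ∈ closure {a | P a} := by
    refine mem_closure_of_tendsto (f := fun n => (⟨u n, (hle _ (hu n)).choose⟩ : QuasiLocal))
      (b := atTop) ?_ (Eventually.of_forall fun n => (hle _ (hu n)).choose_spec)
    exact tendsto_subtype_rng.2 hlim
  rwa [hclosed.closure_eq] at this

theorem isClosed_localAlgebra (Λ : Set Vertex) :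
    IsClosed (localAlgebra Λ : Set (Config →L[ℂ] Config)) :=
  StarSubalgebra.isClosed_topologicalClosure _

theorem continuous_starAlgHom {H : Type*} [NormedAddCommGroup H] [InnerProductSpace ℂ H]
    [CompleteSpace H] (φ : QuasiLocal →⋆ₐ[ℂ] (H →L[ℂ] H)) : Continuous φ :=
  haveI := isClosed_localAlgebra Set.univ
  AddMonoidHomClass.continuous_of_bound φ 1
    (fun b => by simpa using NonUnitalStarAlgHom.norm_apply_le φ b)

/-- An operator that intertwines two representations on the Pauli matrices at the sites of `Λ`
intertwines them on `𝒜(Λ)`. -/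
theorem intertwine_of_pauli {H : Type*} [NormedAddCommGroup H] [InnerProductSpace ℂ H]
    [CompleteSpace H] {φ ψ : QuasiLocal →⋆ₐ[ℂ] (H →L[ℂ] H)} {T : H →L[ℂ] H} {Λ : Set Vertex}
    (hX : ∀ v ∈ Λ, T * φ (pauliX v) = ψ (pauliX v) * T)
    (hZ : ∀ v ∈ Λ, T * φ (pauliZ v) = ψ (pauliZ v) * T) (a : QuasiLocal)
    (ha : (a : Config →L[ℂ] Config) ∈ localAlgebra Λ) : T * φ a = ψ a * T := by
  refine localAlgebra_induction (P := fun a => T * φ a = ψ a * T) ?_ hX hZ ?_ ?_ ?_ a ha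
  · exact isClosed_eq (continuous_const.mul (continuous_starAlgHom φ))
      ((continuous_starAlgHom ψ).mul continuous_const)
  · intro c
    rw [AlgHomClass.commutes, AlgHomClass.commutes, Algebra.commutes]
  · intro a b ha hb
    rw [map_add, map_add, mul_add, add_mul, ha, hb]
  · intro a b ha hb
    rw [map_mul, map_mul, ← mul_assoc, ha, mul_assoc, hb, mul_assoc]

/-- The Pauli operators span a dense subspace. -/
theorem mem_closure_span_pauli (a : QuasiLocal) :
    a ∈ (Submodule.span ℂ (Set.range fun p : Finset Vertex × Finset Vertex =>
      opX p.1 * opZ p.2)).topologicalClosure := by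
  set S := Submodule.span ℂ (Set.range fun p : Finset Vertex × Finset Vertex =>
      opX p.1 * opZ p.2) with hS
  have hmul : ∀ a b, a ∈ S → b ∈ S → a * b ∈ S := by
    intro a b ha hb
    induction ha, hb using Submodule.span_induction₂ with
    | mem_mem x y hx hy =>
      obtain ⟨⟨D, E⟩, rfl⟩ := hx
      obtain ⟨⟨D', E'⟩, rfl⟩ := hy
      have : opX D * opZ E * (opX D' * opZ E') = sgn D' E • (opX (D ∆ D') * opZ (E ∆ E')) := by
        have h := opX_mul_opZ D' E
        have h' : opZ E * opX D' = sgn D' E • (opX D' * opZ E) := by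
          rw [h, smul_smul, sgn_mul_self, one_smul]
        calc opX D * opZ E * (opX D' * opZ E') = opX D * (opZ E * opX D') * opZ E' := by
              simp only [mul_assoc]
          _ = sgn D' E • ((opX D * opX D') * (opZ E * opZ E')) := by
              rw [h', mul_smul_comm, smul_mul_assoc]; simp only [mul_assoc]
          _ = _ := by rw [opX_mul, opZ_mul]
      simp only [this]
      exact S.smul_mem _ (Submodule.subset_span ⟨(_, _), rfl⟩)
    | zero_left y hy => rw [zero_mul]; exact S.zero_mem
    | zero_right x hx => rw [mul_zero]; exact S.zero_mem
    | add_left x y z _ _ _ hx hy => rw [add_mul]; exact S.add_mem hx hy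
    | add_right x y z _ _ _ hx hy => rw [mul_add]; exact S.add_mem hx hy
    | smul_left r x y _ _ h => rw [smul_mul_assoc]; exact S.smul_mem _ h
    | smul_right r x y _ _ h => rw [mul_smul_comm]; exact S.smul_mem _ h
  have hone : (1 : QuasiLocal) ∈ S := Submodule.subset_span ⟨(∅, ∅), by simp [opX_empty, opZ_empty]⟩
  refine localAlgebra_induction (Λ := Set.univ) (P := fun a => a ∈ S.topologicalClosure)
    S.isClosed_topologicalClosure ?_ ?_ ?_ (fun a b ha hb => add_mem ha hb) ?_ a a.2
  · exact fun v _ => S.le_topologicalClosure (Submodule.subset_span ⟨({v}, ∅), by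
      simp [opZ_empty, opX_singleton]⟩)
  · exact fun v _ => S.le_topologicalClosure (Submodule.subset_span ⟨(∅, {v}), by
      simp [opX_empty, opZ_singleton]⟩)
  · intro c
    rw [Algebra.algebraMap_eq_smul_one]
    exact S.le_topologicalClosure (S.smul_mem _ hone)
  · intro a b ha hb
    exact map_mem_closure₂ continuous_mul ha hb (fun a ha b hb => hmul a b ha hb)

/-! ### Syndromes -/

/-- The parity of the intersection. -/
def par (D E : Finset Vertex) : ZMod 2 := (D ∩ E).card

theorem sgn_eq_one_iff {D E : Finset Vertex} : sgn D E = 1 ↔ par D E = 0 := by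
  rw [sgn, par, ZMod.natCast_eq_zero_iff_even, neg_one_pow_eq_one_iff_even (by norm_num)]

theorem par_eq_sum (D E : Finset Vertex) : par D E = ∑ v ∈ D, if v ∈ E then 1 else 0 := by
  rw [par, Finset.sum_ite_mem]; simp

theorem par_symmDiff (D E F : Finset Vertex) : par (D ∆ E) F = par D F + par E F := by
  have h := sgn_symmDiff_left D E F
  -- An element of ℤ/2 is determined by whether it vanishes, so additivity can be read off from the
  -- multiplicativity of the signs.
  have key : ∀ x y z : ZMod 2, (x = 0 ↔ (y = 0 ↔ z = 0)) → x = y + z := by decide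
  apply key
  rw [← sgn_eq_one_iff, ← sgn_eq_one_iff, ← sgn_eq_one_iff, h]
  rcases sgn_eq_one_or D F with h1 | h1 <;> rcases sgn_eq_one_or E F with h2 | h2 <;>
    norm_num [h1, h2]

/-- The face with the vertex `v` whose left vertices have abscissa `k`. -/
def faceAt (v : Vertex) (k : ℤ) : Face :=
  if h : Odd (k + v.2) then Face.corner k v.2 h else Face.corner k (v.2 - 1) (by
    rw [Int.not_odd_iff_even] at h
    have := h.sub_odd odd_one
    rwa [add_sub_assoc] at this)

theorem col_faceAt (v : Vertex) (k : ℤ) : (faceAt v k).col = k := by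
  unfold faceAt; split_ifs <;> rfl

theorem row_faceAt (v : Vertex) (k : ℤ) : (faceAt v k).row = v.2 ∨ (faceAt v k).row = v.2 - 1 := by
  unfold faceAt; split_ifs <;> simp

/-- The column of a face fixes the parity of its row, and of the two consecutive rows that would put
`v` on the face only one has it. -/
theorem eq_faceAt {f : Face} {v : Vertex} (hv : v ∈ f.support) : f = faceAt v f.col := by
  rw [Face.mem_support] at hv
  refine Face.eq_of_col_row (by rw [col_faceAt]) ?_
  have h1 := f.odd_col_add_row
  have h2 := (faceAt v f.col).odd_col_add_row
  rw [col_faceAt] at h2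
  have h3 := row_faceAt v f.col
  rw [Int.odd_iff] at h1 h2
  omega

theorem mem_support_faceAt {v : Vertex} {k : ℤ} :
    v ∈ (faceAt v k).support ↔ v.1 - 2 ≤ k ∧ k ≤ v.1 := by
  have h3 := row_faceAt v k
  rw [Face.mem_support, col_faceAt]
  omega

/-- The syndrome of a spin flip at a vertex: the three faces around it. -/
def vertexSyndrome (v : Vertex) : Face →₀ ZMod 2 :=
  Finsupp.single (faceAt v v.1) 1 + Finsupp.single (faceAt v (v.1 - 1)) 1 +
    Finsupp.single (faceAt v (v.1 - 2)) 1

theorem vertexSyndrome_apply (v : Vertex) (f : Face) :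
    vertexSyndrome v f = if v ∈ f.support then 1 else 0 := by
  classical
  simp only [vertexSyndrome, Finsupp.add_apply, Finsupp.single_apply]
  by_cases hv : v ∈ f.support
  · have h := eq_faceAt hv
    have hm : ∀ k, faceAt v k = f ↔ k = f.col := by
      intro k
      refine ⟨fun h => by rw [← h, col_faceAt], fun hk => by rw [hk]; exact h.symm⟩
    rw [if_pos hv, hm, hm, hm]
    rw [Face.mem_support] at hv
    obtain h | h | h : v.1 = f.col ∨ v.1 - 1 = f.col ∨ v.1 - 2 = f.col := by omega
    · rw [if_pos h, if_neg (by omega), if_neg (by omega)]; rfl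
    · rw [if_pos h, if_neg (by omega), if_neg (by omega)]; rfl
    · rw [if_pos h, if_neg (by omega), if_neg (by omega)]; rfl
  · have hm : ∀ k, v.1 - 2 ≤ k → k ≤ v.1 → faceAt v k ≠ f := by
      intro k h1 h2 h
      exact hv (h ▸ mem_support_faceAt.2 ⟨h1, h2⟩)
    rw [if_neg hv, if_neg (hm _ (by omega) (by omega)), if_neg (hm _ (by omega) (by omega)),
      if_neg (hm _ (by omega) (by omega))]
    rfl

/-- The syndrome of a product of spin flips. -/
def syndrome (D : Finset Vertex) : Face →₀ ZMod 2 := ∑ v ∈ D, vertexSyndrome v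

theorem syndrome_apply (D : Finset Vertex) (f : Face) : syndrome D f = par D f.support := by
  rw [syndrome, Finsupp.finsetSum_apply, par_eq_sum]
  exact Finset.sum_congr rfl fun v _ => vertexSyndrome_apply v f

theorem syndrome_symmDiff (D E : Finset Vertex) : syndrome (D ∆ E) = syndrome D + syndrome E := by
  ext f
  rw [Finsupp.add_apply, syndrome_apply, syndrome_apply, syndrome_apply, par_symmDiff]

theorem syndrome_singleton (v : Vertex) : syndrome {v} = vertexSyndrome v := by simp [syndrome]

/-! ### Even sets are sums of faces -/

theorem Face.support_eq (f : Face) :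
    f.support = Finset.Icc f.col (f.col + 2) ×ˢ Finset.Icc f.row (f.row + 1) := by
  ext v
  rw [Face.mem_support, Finset.mem_product, Finset.mem_Icc, Finset.mem_Icc, and_assoc]

/-- Two faces overlap in a rectangle. Odd width means that the columns differ by an even number, odd
height that the rows differ by one; both together contradict the parity of `col + row`. Hence adding
a face never changes a syndrome. -/
theorem par_support (f g : Face) : par f.support g.support = 0 := by
  have hI (a b c d : ℤ) : Finset.Icc a b ∩ Finset.Icc c d = Finset.Icc (max a c) (min b d) := by
    ext x
    simp only [Finset.mem_inter, Finset.mem_Icc]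
    omega
  rw [par, ZMod.natCast_eq_zero_iff_even, f.support_eq, g.support_eq, Finset.product_inter_product,
    Finset.card_product, hI, hI, Int.card_Icc, Int.card_Icc,
    Nat.even_mul]
  have h1 := f.odd_col_add_row
  have h2 := g.odd_col_add_row
  rw [Int.odd_iff] at h1 h2
  rw [Nat.even_iff, Nat.even_iff]
  omega

/-- A finite set of vertices that meets every face in an even number of vertices is a sum of faces:
this is stated as an induction principle. -/
theorem even_induction {P : Finset Vertex → Prop} (h0 : P ∅)
    (hface : ∀ D (f : Face), P D → P (D ∆ f.support)) (D : Finset Vertex)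
    (hD : ∀ f : Face, par D f.support = 0) : P D := by
  obtain ⟨a₀, a₁, b₀, b₁, hbox⟩ : ∃ a₀ a₁ b₀ b₁ : ℤ, ∀ v ∈ D, a₀ ≤ v.1 ∧ v.1 ≤ a₁ ∧ b₀ ≤ v.2 ∧
      v.2 ≤ b₁ := by
    obtain ⟨a₀, h1⟩ := (D.image Prod.fst).bddBelow
    obtain ⟨a₁, h2⟩ := (D.image Prod.fst).bddAbove
    obtain ⟨b₀, h3⟩ := (D.image Prod.snd).bddBelow
    obtain ⟨b₁, h4⟩ := (D.image Prod.snd).bddAbove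
    refine ⟨a₀, a₁, b₀, b₁, fun v hv => ⟨h1 ?_, h2 ?_, h3 ?_, h4 ?_⟩⟩ <;>
      exact Finset.mem_coe.2 (Finset.mem_image_of_mem _ hv)
  -- An even intersection is not a singleton. Applied to faces that stick out of the region occupied
  -- by `D`, this forces further vertices into `D` or gives a contradiction.
  have hface1 : ∀ (D : Finset Vertex) (f : Face) (v : Vertex), v ∈ D → v ∈ f.support →
      par D f.support = 0 → ∃ w ∈ D, w ∈ f.support ∧ w ≠ v := by
    intro D f v h1 h2 h3
    by_contra hcon
    push Not at hcon
    have : D ∩ f.support = {v} := by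
      ext w
      rw [Finset.mem_inter, Finset.mem_singleton]
      exact ⟨fun h => hcon w h.1 h.2, fun h => h ▸ ⟨h1, h2⟩⟩
    rw [par, this] at h3
    simp at h3
  -- induction on the number of rows, then on the width of the topmost row
  suffices key : ∀ n k : ℕ, ∀ D : Finset Vertex, (∀ f : Face, par D f.support = 0) →
      (∀ v ∈ D, a₀ ≤ v.1 ∧ v.1 ≤ a₁ ∧ b₀ ≤ v.2 ∧ v.2 ≤ b₀ + n - 1) →
      (∀ v ∈ D, v.2 = b₀ + n - 1 → v.1 < a₀ + k) → P D by
    refine key (b₁ - b₀ + 1).toNat (a₁ - a₀ + 1).toNat D hD ?_ ?_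
    · intro v hv
      have := hbox v hv
      omega
    · intro v hv _
      have := hbox v hv
      omega
  intro n
  induction n with
  | zero =>
    intro k D _ h _
    have : D = ∅ := Finset.eq_empty_of_forall_notMem fun v hv => by
      have := h v hv
      push_cast at this
      omega
    rwa [this]
  | succ n ihn =>
    intro k
    induction k using Nat.strong_induction_on with
    | _ k ihk =>
    intro D hD hb hk
    push_cast at hb hk
    set T := D.filter (fun v => v.2 = b₀ + n) with hT
    by_cases hne : T.Nonempty
    swap
    · refine ihn (a₁ - a₀ + 1).toNat D hD (fun v hv => ?_) (fun v hv _ => ?_)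
      · have h1 := hb v hv
        have : v.2 ≠ b₀ + n := fun h => hne ⟨v, Finset.mem_filter.2 ⟨hv, h⟩⟩
        omega
      · have h1 := hb v hv
        omega
    obtain ⟨⟨a, b⟩, hvT, hmax⟩ := T.exists_max_image Prod.fst hne
    obtain ⟨hvD, hvb⟩ := Finset.mem_filter.1 hvT
    simp only at hvb hmax
    have hmax' : ∀ w ∈ D, w.2 = b → w.1 ≤ a := fun w hw h =>
      hmax w (Finset.mem_filter.2 ⟨hw, h.trans hvb⟩)
    have hrow : ∀ w ∈ D, w.2 ≤ b := fun w hw => by have := hb w hw; omega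
    -- the last vertex of the row has even parity
    have hpar : Even (a + b) := by
      by_contra h
      rw [Int.not_even_iff_odd] at h
      obtain ⟨w, hw, hwf, hwne⟩ := hface1 D (Face.corner a b h) (a, b) hvD
        (Face.mem_support.2 (by simp only [Face.col_corner, Face.row_corner]; omega)) (hD _)
      rw [Face.mem_support, Face.col_corner, Face.row_corner] at hwf
      have h1 := hrow w hw
      have h2 := hmax' w hw (by omega)
      exact hwne (Prod.ext (by simp only; omega) (by simp only; omega))
    -- there is another row below
    have hn : 0 < n := by
      by_contra hn
      obtain ⟨w, hw, hwf, hwne⟩ := hface1 D (Face.corner a (b - 1) (by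
          have := hpar.sub_odd odd_one
          rwa [add_sub_assoc] at this)) (a, b) hvD (Face.mem_support.2 (by simp only [Face.col_corner, Face.row_corner]; omega)) (hD _)
      rw [Face.mem_support, Face.col_corner, Face.row_corner] at hwf
      have h1 := hb w hw
      have h2 := hmax' w hw (by omega)
      exact hwne (Prod.ext (by simp only; omega) (by simp only; omega))
    -- its left neighbour belongs to the set
    have hleft : (a - 1, b) ∈ D := by
      obtain ⟨w, hw, hwf, hwne⟩ := hface1 D (Face.corner (a - 1) b (by
          have := hpar.sub_odd odd_one
          rw [show a + b - 1 = a - 1 + b by ring] at this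
          exact this)) (a, b) hvD (Face.mem_support.2 (by simp only [Face.col_corner, Face.row_corner]; omega)) (hD _)
      rw [Face.mem_support, Face.col_corner, Face.row_corner] at hwf
      have h1 := hrow w hw
      have h2 := hmax' w hw (by omega)
      have : w.1 ≠ a := fun h => hwne (Prod.ext h (by simp only; omega))
      have : w = (a - 1, b) := Prod.ext (by simp only; omega) (by simp only; omega)
      exact this ▸ hw
    -- the row starts at a vertex of even parity
    have hmin : a₀ ≤ a - 2 := by
      by_contra hlt
      have hw1 := (hb _ hleft).1
      simp only at hw1
      have ha0 : a - 1 = a₀ := by omega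
      obtain ⟨w, hw, hwf, hwne⟩ := hface1 D (Face.corner (a - 3) b (by
          have := hpar.sub_odd (show Odd (3 : ℤ) from ⟨1, by norm_num⟩)
          rw [show a + b - 3 = a - 3 + b by ring] at this
          exact this)) (a - 1, b) hleft (Face.mem_support.2 (by simp only [Face.col_corner, Face.row_corner]; omega)) (hD _)
      rw [Face.mem_support, Face.col_corner, Face.row_corner] at hwf
      have h1 := hrow w hw
      have h2 := hb w hw
      exact hwne (Prod.ext (by simp only; omega) (by simp only; omega))
    -- The face with upper right vertex `(a, b)`. Adding it removes the last vertex of the top row;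
    -- by `hmin` and `hn` it stays inside the box.
    set f : Face := Face.corner (a - 2) (b - 1) (by
      have := hpar.sub_odd (show Odd (3 : ℤ) from ⟨1, by norm_num⟩)
      rw [show a + b - 3 = a - 2 + (b - 1) by ring] at this
      exact this) with hf
    have hmem : ∀ w, w ∈ f.support ↔ a - 2 ≤ w.1 ∧ w.1 ≤ a ∧ b - 1 ≤ w.2 ∧ w.2 ≤ b := by
      intro w
      rw [Face.mem_support, hf, Face.col_corner, Face.row_corner]
      omega
    have hka := hk _ hvD (by simp only; omega)
    simp only at hka
    have hva := (hb _ hvD).2.1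
    simp only at hva
    have hP : P (D ∆ f.support) := by
      refine ihk (a - a₀).toNat (by omega) (D ∆ f.support) ?_ ?_ ?_
      · intro g
        rw [par_symmDiff, hD g, zero_add, par_support]
      · intro w hw
        rcases Finset.mem_symmDiff.1 hw with ⟨h1, -⟩ | ⟨h1, -⟩
        · have := hb w h1
          push_cast
          omega
        · rw [hmem] at h1
          push_cast
          omega
      · intro w hw hwb
        push_cast at hwb
        rcases Finset.mem_symmDiff.1 hw with ⟨h1, h2⟩ | ⟨h1, h2⟩
        · have h3 := hmax' w h1 (by omega)
          have : w.1 ≠ a := fun h => h2 ((hmem w).2 (by omega))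
          omega
        · have h3 := (hmem w).1 h1
          have : w.1 ≠ a := fun h => h2 (by
            have : w = (a, b) := Prod.ext h (by simp only; omega)
            exact this ▸ hvD)
          omega
    have := hface _ f hP
    rwa [symmDiff_assoc, symmDiff_self, symmDiff_bot] at this

/-! ### Moving excitations inside a connected set -/

/-- `w` is the right or the upper neighbour of `v`, and both belong to `Λ`. -/
def Step (Λ : Set Vertex) (v w : Vertex) : Prop :=
  v ∈ Λ ∧ w ∈ Λ ∧ (w = (v.1 + 1, v.2) ∨ w = (v.1, v.2 + 1) ∧ Odd (v.1 + v.2))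

/-- The subgraph of the lattice that is induced on `Λ` is connected (or empty). -/
def LatticeConnected (Λ : Set Vertex) : Prop := ∀ v ∈ Λ, ∀ w ∈ Λ, Relation.EqvGen (Step Λ) v w

/-- The syndromes that can be created inside `Λ`. -/
def syndromes (Λ : Set Vertex) : AddSubgroup (Face →₀ ZMod 2) where
  carrier := {s | ∃ D : Finset Vertex, ↑D ⊆ Λ ∧ syndrome D = s}
  zero_mem' := ⟨∅, by simp, by simp [syndrome]⟩
  add_mem' := by
    rintro _ _ ⟨D, hD, rfl⟩ ⟨E, hE, rfl⟩
    refine ⟨D ∆ E, fun v hv => ?_, syndrome_symmDiff D E⟩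
    rcases Finset.mem_symmDiff.1 (Finset.mem_coe.1 hv) with ⟨h, -⟩ | ⟨h, -⟩
    · exact hD h
    · exact hE h
  neg_mem' := by
    rintro _ ⟨D, hD, rfl⟩
    refine ⟨D, hD, ?_⟩
    ext f
    rw [Finsupp.neg_apply]
    exact (ZMod.neg_eq_self_mod_two _).symm

theorem vertexSyndrome_mem {Λ : Set Vertex} {v : Vertex} (hv : v ∈ Λ) :
    vertexSyndrome v ∈ syndromes Λ := ⟨{v}, by simpa using hv, syndrome_singleton v⟩

/-- The face around `w` that has the same color as `f`. -/
def recenter (w : Vertex) (f : Face) : Face := faceAt w (w.1 - (w.1 - f.col) % 3)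

/-- The color of a face is its column modulo 3, and the faces around a vertex have three consecutive
columns. Every vertex thus sees each color exactly once, and `recenter w` only permutes the order of
the summands. -/
theorem mapDomain_vertexSyndrome (w v : Vertex) :
    (vertexSyndrome v).mapDomain (recenter w) = vertexSyndrome w := by
  simp only [vertexSyndrome, Finsupp.mapDomain_add, Finsupp.mapDomain_single, recenter, col_faceAt]
  obtain h | h | h : (w.1 - v.1) % 3 = 0 ∨ (w.1 - v.1) % 3 = 1 ∨ (w.1 - v.1) % 3 = 2 := by omega
  · rw [show (w.1 - v.1) % 3 = 0 by omega, show (w.1 - (v.1 - 1)) % 3 = 1 by omega,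
      show (w.1 - (v.1 - 2)) % 3 = 2 by omega, sub_zero]
  · rw [show (w.1 - v.1) % 3 = 1 by omega, show (w.1 - (v.1 - 1)) % 3 = 2 by omega,
      show (w.1 - (v.1 - 2)) % 3 = 0 by omega, sub_zero]
    abel
  · rw [show (w.1 - v.1) % 3 = 2 by omega, show (w.1 - (v.1 - 1)) % 3 = 0 by omega,
      show (w.1 - (v.1 - 2)) % 3 = 1 by omega, sub_zero]
    abel

/-- Color charge: each flip excites one face of every color, so collecting all excitations at `w`
leaves copies of one and the same triple. -/
theorem mapDomain_syndrome (w : Vertex) (D : Finset Vertex) :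
    (syndrome D).mapDomain (recenter w) = D.card • vertexSyndrome w := by
  have : (syndrome D).mapDomain (recenter w) =
      ∑ v ∈ D, (vertexSyndrome v).mapDomain (recenter w) :=
    map_sum (Finsupp.mapDomain.addMonoidHom (M := ZMod 2) (recenter w)) _ _
  rw [this, Finset.sum_congr rfl fun v _ => mapDomain_vertexSyndrome w v, Finset.sum_const]

/-- A single excitation can be moved, inside `Λ`, to the face of the same color around `w`. -/
def Movable (Λ : Set Vertex) (w : Vertex) (f : Face) : Prop :=
  Finsupp.single f 1 - Finsupp.single (recenter w f) 1 ∈ syndromes Λ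

/-- The difference of the syndromes of `v` and `w` is the sum of the three displacements to `w`. It
can be created in `Λ`, so two movable faces make the third movable. -/
theorem movable_iff_of_three {Λ : Set Vertex} {w v : Vertex} (hw : w ∈ Λ) (hv : v ∈ Λ)
    {f g h : Face} (hf : vertexSyndrome v =
      Finsupp.single f 1 + Finsupp.single g 1 + Finsupp.single h 1)
    (h1 : Movable Λ w f) (h2 : Movable Λ w g) : Movable Λ w h := by
  have h3 := mapDomain_vertexSyndrome w v
  rw [hf] at h3
  simp only [Finsupp.mapDomain_add, Finsupp.mapDomain_single] at h3
  have h4 : vertexSyndrome v - vertexSyndrome w ∈ syndromes Λ :=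
    sub_mem (vertexSyndrome_mem hv) (vertexSyndrome_mem hw)
  rw [hf, ← h3] at h4
  have h5 := sub_mem (sub_mem h4 h1) h2
  unfold Movable
  convert h5 using 1
  abel

/-- Adjacent vertices share two of their three faces; the remaining one follows by
`movable_iff_of_three`, in either direction. -/
theorem movable_step {Λ : Set Vertex} {w u v : Vertex} (hw : w ∈ Λ) (h : Step Λ u v) :
    (∀ f : Face, u ∈ f.support → Movable Λ w f) ↔ (∀ f : Face, v ∈ f.support → Movable Λ w f) := by
  obtain ⟨hu, hv, h⟩ := h
  have haround : ∀ v : Vertex, (∀ f : Face, v ∈ f.support → Movable Λ w f) ↔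
      Movable Λ w (faceAt v v.1) ∧ Movable Λ w (faceAt v (v.1 - 1)) ∧
        Movable Λ w (faceAt v (v.1 - 2)) := by
    intro v
    refine ⟨fun h => ⟨h _ (mem_support_faceAt.2 (by omega)), h _ (mem_support_faceAt.2 (by omega)),
      h _ (mem_support_faceAt.2 (by omega))⟩, fun h f hf => ?_⟩
    have h1 := eq_faceAt hf
    rw [h1, mem_support_faceAt] at hf
    obtain h2 | h2 | h2 : f.col = v.1 ∨ f.col = v.1 - 1 ∨ f.col = v.1 - 2 := by omega
    · rw [h1, h2]; exact h.1
    · rw [h1, h2]; exact h.2.1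
    · rw [h1, h2]; exact h.2.2
  rw [haround, haround]
  have e1 (v : Vertex) : vertexSyndrome v = Finsupp.single (faceAt v v.1) 1 +
    Finsupp.single (faceAt v (v.1 - 1)) 1 + Finsupp.single (faceAt v (v.1 - 2)) 1 := rfl
  have e2 (v : Vertex) : vertexSyndrome v = Finsupp.single (faceAt v (v.1 - 1)) 1 +
    Finsupp.single (faceAt v (v.1 - 2)) 1 + Finsupp.single (faceAt v v.1) 1 := by rw [e1]; abel
  have e3 (v : Vertex) : vertexSyndrome v = Finsupp.single (faceAt v v.1) 1 +
    Finsupp.single (faceAt v (v.1 - 2)) 1 + Finsupp.single (faceAt v (v.1 - 1)) 1 := by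
    rw [e1]; abel
  obtain ⟨a, b⟩ := u
  rcases h with rfl | ⟨rfl, hodd⟩
  · have h1 : faceAt (a + 1, b) (a + 1 - 1) = faceAt (a, b) a := by
      rw [add_sub_cancel_right]; rfl
    have h2 : faceAt (a + 1, b) (a + 1 - 2) = faceAt (a, b) (a - 1) := by
      rw [show a + 1 - 2 = a - 1 by ring]; rfl
    have h3 := e1 (a, b)
    have h4 := e2 (a + 1, b)
    simp only at h3 h4 ⊢
    rw [h1, h2] at h4 ⊢
    exact ⟨fun h => ⟨movable_iff_of_three hw hv h4 h.1 h.2.1, h.1, h.2.1⟩,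
      fun h => ⟨h.2.1, h.2.2, movable_iff_of_three hw hu h3 h.2.1 h.2.2⟩⟩
  · have h1 : faceAt (a, b + 1) a = faceAt (a, b) a := by
      apply Face.eq_of_col_row
      · rw [col_faceAt, col_faceAt]
      · simp only at hodd
        unfold faceAt
        rw [dif_pos hodd, dif_neg]
        · simp
        · rw [Int.odd_iff] at hodd ⊢
          simp only
          omega
    have h2 : faceAt (a, b + 1) (a - 2) = faceAt (a, b) (a - 2) := by
      apply Face.eq_of_col_row
      · rw [col_faceAt, col_faceAt]
      · simp only at hodd
        have hodd' : Odd (a - 2 + b) := by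
          rw [Int.odd_iff] at hodd ⊢
          omega
        unfold faceAt
        rw [dif_pos hodd', dif_neg]
        · simp
        · rw [Int.odd_iff] at hodd ⊢
          simp only
          omega
    have h3 := e3 (a, b)
    have h4 := e3 (a, b + 1)
    simp only at h3 h4 ⊢
    rw [h1, h2] at h4 ⊢
    exact ⟨fun h => ⟨h.1, movable_iff_of_three hw hv h4 h.1 h.2.2, h.2.2⟩,
      fun h => ⟨h.1, movable_iff_of_three hw hu h3 h.1 h.2.2, h.2.2⟩⟩

/-- At `w` itself nothing has to be moved, and the property spreads along the edges of `Λ`. -/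
theorem movable_of_connected {Λ : Set Vertex} (hΛ : LatticeConnected Λ) {w v : Vertex} (hw : w ∈ Λ)
    (hv : v ∈ Λ) {f : Face} (hf : v ∈ f.support) : Movable Λ w f := by
  have key : ∀ u v, Relation.EqvGen (Step Λ) u v →
      ((∀ f : Face, u ∈ f.support → Movable Λ w f) ↔
        (∀ f : Face, v ∈ f.support → Movable Λ w f)) := by
    intro u v h
    induction h with
    | rel _ _ h => exact movable_step hw h
    | refl _ => exact Iff.rfl
    | symm _ _ _ ih => exact ih.symm
    | trans _ _ _ _ _ ih1 ih2 => exact ih1.trans ih2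
  refine (key w v (hΛ w hw v hv)).1 (fun f hf => ?_) f hf
  have : recenter w f = f := by
    have h1 := eq_faceAt hf
    rw [h1, mem_support_faceAt] at hf
    rw [recenter, show w.1 - (w.1 - f.col) % 3 = f.col by omega]
    exact h1.symm
  rw [Movable, this, sub_self]
  exact zero_mem _

/-- A syndrome that vanishes on the faces outside a connected set `Λ` can be created inside `Λ`. -/
theorem exists_syndrome_eq {Λ : Set Vertex} (hΛ : LatticeConnected Λ) (D : Finset Vertex)
    (hD : ∀ f : Face, ↑f.support ⊆ Λᶜ → par D f.support = 0) :
    ∃ E : Finset Vertex, ↑E ⊆ Λ ∧ ∀ f : Face, par E f.support = par D f.support := by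
  suffices h : syndrome D ∈ syndromes Λ by
    obtain ⟨E, hE, h⟩ := h
    exact ⟨E, hE, fun f => by rw [← syndrome_apply, h, syndrome_apply]⟩
  rcases Λ.eq_empty_or_nonempty with rfl | ⟨w, hw⟩
  · have : syndrome D = 0 := by
      ext f
      rw [syndrome_apply, hD f (by simp)]
      rfl
    rw [this]
    exact zero_mem _
  -- Moving every excitation to `w` changes the syndrome by one that can be created in `Λ`. What
  -- remains is a multiple of the syndrome of the single flip at `w`.
  have h1 : ∀ s : Face →₀ ZMod 2, (∀ f ∈ s.support, Movable Λ w f) →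
      s - s.mapDomain (recenter w) ∈ syndromes Λ := by
    intro s hs
    have e : s - s.mapDomain (recenter w) = ∑ f ∈ s.support,
        (Finsupp.single f (s f) - Finsupp.single (recenter w f) (s f)) := by
      rw [Finset.sum_sub_distrib]
      congr 1
      exact (Finsupp.sum_single s).symm
    rw [e]
    refine sum_mem fun f hf => ?_
    have : s f = 1 := by
      have h2 := Finsupp.mem_support_iff.1 hf
      revert h2
      generalize s f = x
      revert x
      decide
    rw [this]
    exact hs f hf
  have h2 := h1 (syndrome D) (fun f hf => by
    rw [Finsupp.mem_support_iff, syndrome_apply] at hf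
    have : ¬ (↑f.support ⊆ Λᶜ) := fun h => hf (hD f h)
    obtain ⟨v, hv, hvΛ⟩ := Set.not_subset.1 this
    exact movable_of_connected hΛ hw (not_not.1 hvΛ) hv)
  have h3 : (syndrome D).mapDomain (recenter w) ∈ syndromes Λ := by
    rw [mapDomain_syndrome]
    exact nsmul_mem (vertexSyndrome_mem hw) _
  simpa using add_mem h2 h3

variable {H : Type*} [NormedAddCommGroup H] [InnerProductSpace ℂ H] [CompleteSpace H]
variable {ω : QuasiLocal →ₗ[ℂ] ℂ}

namespace GNS

/-! ### Pauli operators in the GNS representation -/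

/-- The product of `σˣ` over `D` in the GNS representation. -/
def repX (G : GNS ω H) (D : Finset Vertex) : H →L[ℂ] H := G.rep (opX D)

/-- The product of `σᶻ` over `D` in the GNS representation. -/
def repZ (G : GNS ω H) (D : Finset Vertex) : H →L[ℂ] H := G.rep (opZ D)

variable (G : GNS ω H)

theorem repX_mul (D E : Finset Vertex) : G.repX D * G.repX E = G.repX (D ∆ E) := by
  rw [repX, repX, ← map_mul, opX_mul]; rfl

theorem repZ_mul (D E : Finset Vertex) : G.repZ D * G.repZ E = G.repZ (D ∆ E) := by
  rw [repZ, repZ, ← map_mul, opZ_mul]; rfl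

theorem repX_empty : G.repX ∅ = 1 := by rw [repX, opX_empty, map_one]

theorem repZ_empty : G.repZ ∅ = 1 := by rw [repZ, opZ_empty, map_one]

theorem repX_mul_self (D : Finset Vertex) : G.repX D * G.repX D = 1 := by
  rw [repX_mul, symmDiff_self]; exact G.repX_empty

theorem repZ_mul_self (D : Finset Vertex) : G.repZ D * G.repZ D = 1 := by
  rw [repZ_mul, symmDiff_self]; exact G.repZ_empty

theorem star_repX (D : Finset Vertex) : star (G.repX D) = G.repX D := by
  rw [repX, ← map_star, star_opX]

theorem star_repZ (D : Finset Vertex) : star (G.repZ D) = G.repZ D := by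
  rw [repZ, ← map_star, star_opZ]

theorem repX_mul_repZ (D E : Finset Vertex) :
    G.repX D * G.repZ E = sgn D E • (G.repZ E * G.repX D) := by
  rw [repX, repZ, ← map_mul, opX_mul_opZ, map_smul, map_mul]

theorem repZ_mul_repX (D E : Finset Vertex) :
    G.repZ E * G.repX D = sgn D E • (G.repX D * G.repZ E) := by
  rw [repX_mul_repZ, smul_smul, sgn_mul_self, one_smul]

theorem repX_comm (D E : Finset Vertex) : Commute (G.repX D) (G.repX E) := by
  rw [commute_iff_eq, repX_mul, repX_mul, symmDiff_comm]

theorem repZ_comm (D E : Finset Vertex) : Commute (G.repZ D) (G.repZ E) := by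
  rw [commute_iff_eq, repZ_mul, repZ_mul, symmDiff_comm]

theorem repX_repZ_commute {D E : Finset Vertex} (h : Disjoint D E) :
    Commute (G.repX D) (G.repZ E) := by
  rw [commute_iff_eq, repX_mul_repZ, sgn_of_disjoint h, one_smul]

theorem inner_star_left (A : H →L[ℂ] H) (ξ η : H) : inner ℂ (star A ξ) η = inner ℂ ξ (A η) := by
  rw [ContinuousLinearMap.star_eq_adjoint]; exact ContinuousLinearMap.adjoint_inner_left A η ξ

theorem inner_apply_left (A : H →L[ℂ] H) (ξ η : H) : inner ℂ (A ξ) η = inner ℂ ξ (star A η) := by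
  rw [← inner_star_left, star_star]

/-! ### Operators that commute with the observables in a region -/

/-- `T` commutes with the observables at the sites of `Λ`. -/
def CommutesWith (Λ : Set Vertex) (T : H →L[ℂ] H) : Prop :=
  ∀ v ∈ Λ, Commute T (G.rep (pauliX v)) ∧ Commute T (G.rep (pauliZ v))

variable {G}

theorem commutesWith_iff {Λ : Set Vertex} {T : H →L[ℂ] H} : G.CommutesWith Λ T ↔
    ∀ a : QuasiLocal, (a : Config →L[ℂ] Config) ∈ localAlgebra Λ → Commute T (G.rep a) :=
  ⟨fun h => intertwine_of_pauli (fun v hv => (h v hv).1) (fun v hv => (h v hv).2),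
    fun h _ hv => ⟨h _ (sigmaX_mem hv), h _ (sigmaZ_mem hv)⟩⟩

theorem CommutesWith.mono {Λ M : Set Vertex} {T : H →L[ℂ] H} (h : G.CommutesWith M T)
    (hΛ : Λ ⊆ M) : G.CommutesWith Λ T := fun v hv => h v (hΛ hv)

theorem CommutesWith.star {Λ : Set Vertex} {T : H →L[ℂ] H} (h : G.CommutesWith Λ T) :
    G.CommutesWith Λ (star T) := by
  intro v hv
  have h1 := (h v hv).1.star_star
  have h2 := (h v hv).2.star_star
  rw [← map_star] at h1 h2
  rw [← opX_singleton, star_opX, opX_singleton] at h1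
  rw [← opZ_singleton, star_opZ, opZ_singleton] at h2
  exact ⟨h1, h2⟩

theorem CommutesWith.mul {Λ : Set Vertex} {S T : H →L[ℂ] H} (h : G.CommutesWith Λ S)
    (h' : G.CommutesWith Λ T) : G.CommutesWith Λ (S * T) :=
  fun v hv => ⟨(h v hv).1.mul_left (h' v hv).1, (h v hv).2.mul_left (h' v hv).2⟩

theorem CommutesWith.commute_repX {Λ : Set Vertex} {T : H →L[ℂ] H} (h : G.CommutesWith Λ T)
    {D : Finset Vertex} (hD : ↑D ⊆ Λ) : Commute T (G.repX D) :=
  commutesWith_iff.1 h _ (flipX_mem hD)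

theorem CommutesWith.commute_repZ {Λ : Set Vertex} {T : H →L[ℂ] H} (h : G.CommutesWith Λ T)
    {D : Finset Vertex} (hD : ↑D ⊆ Λ) : Commute T (G.repZ D) :=
  commutesWith_iff.1 h _ (signZ_mem hD)

/-- `StarSubalgebra.centralizer` asks for commutation with elements and with their adjoints. The
latter is automatic because the commutant is closed under adjoints. -/
theorem mem_vonNeumann_iff {Λ : Set Vertex} {b : H →L[ℂ] H} :
    b ∈ G.vonNeumann Λ ↔ ∀ T, G.CommutesWith Λ T → Commute T b := by
  have hcent : ∀ T : H →L[ℂ] H, T ∈ StarSubalgebra.centralizer ℂ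
      (G.rep '' {a : QuasiLocal | (a : Config →L[ℂ] Config) ∈ localAlgebra Λ}) ↔
      G.CommutesWith Λ T := by
    intro T
    rw [StarSubalgebra.mem_centralizer_iff, commutesWith_iff]
    constructor
    · exact fun h a ha => (h _ (Set.mem_image_of_mem _ ha)).1.symm
    · rintro h _ ⟨a, ha, rfl⟩
      refine ⟨(h a ha).symm, ?_⟩
      rw [← map_star]
      have ha' : star (a : Config →L[ℂ] Config) ∈ localAlgebra Λ := star_mem ha
      exact (h (star a) ha').symm
  rw [vonNeumann, StarSubalgebra.mem_centralizer_iff]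
  constructor
  · exact fun h T hT => (h T ((hcent T).2 hT)).1
  · intro h T hT
    exact ⟨h T ((hcent T).1 hT), h _ ((hcent T).1 hT).star⟩

theorem vonNeumann_mono {Λ M : Set Vertex} (h : Λ ⊆ M) : G.vonNeumann Λ ≤ G.vonNeumann M :=
  fun _ hb => mem_vonNeumann_iff.2 fun T hT => mem_vonNeumann_iff.1 hb T (hT.mono h)

theorem commutesWith_repX {Λ : Set Vertex} {D : Finset Vertex} (hD : ↑D ⊆ Λᶜ) :
    G.CommutesWith Λ (G.repX D) := by
  intro v hv
  rw [← opX_singleton, ← opZ_singleton]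
  exact ⟨G.repX_comm _ _, G.repX_repZ_commute
    (Finset.disjoint_singleton_right.2 fun h => hD h hv)⟩

theorem commutesWith_repZ {Λ : Set Vertex} {D : Finset Vertex} (hD : ↑D ⊆ Λᶜ) :
    G.CommutesWith Λ (G.repZ D) := by
  intro v hv
  rw [← opX_singleton, ← opZ_singleton]
  exact ⟨(G.repX_repZ_commute (Finset.disjoint_singleton_left.2 fun h => hD h hv)).symm,
    G.repZ_comm _ _⟩

/-! ### Stabilizers and the vacuum vector -/

theorem inner_vec_vec (G : GNS ω H) (hω : IsGroundState ω) : inner ℂ G.vec G.vec = (1 : ℂ) := by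
  have := G.expect 1
  rwa [map_one, hω.map_one] at this

/-- The equality case of Cauchy–Schwarz: `A` is unitary, so ‖AΩ − Ω‖² = 1 − 1 − 1 + 1 = 0. -/
theorem apply_vec_of_expect_one (hω : IsGroundState ω) {A : H →L[ℂ] H} (h1 : star A = A)
    (h2 : A * A = 1) (h3 : inner ℂ G.vec (A G.vec) = (1 : ℂ)) : A G.vec = G.vec := by
  have hA : inner ℂ (A G.vec) (A G.vec) = (1 : ℂ) := by
    rw [inner_apply_left, h1, ← mul_apply_eq_comp, h2]
    exact G.inner_vec_vec hω
  have h4 : inner ℂ (A G.vec) G.vec = (1 : ℂ) := by rw [inner_apply_left, h1, h3]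
  rw [← sub_eq_zero, ← inner_self_eq_zero (𝕜 := ℂ), inner_sub_left, inner_sub_right, inner_sub_right,
    hA, h3, h4, G.inner_vec_vec hω]
  norm_num

theorem repX_support_vec (hω : IsGroundState ω) (f : Face) : G.repX f.support G.vec = G.vec := by
  refine apply_vec_of_expect_one hω (G.star_repX _) (G.repX_mul_self _) ?_
  rw [repX, ← stabK_eq, G.expect, hω.map_stabK]

theorem repZ_support_vec (hω : IsGroundState ω) (f : Face) : G.repZ f.support G.vec = G.vec := by
  refine apply_vec_of_expect_one hω (G.star_repZ _) (G.repZ_mul_self _) ?_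
  rw [repZ, ← stabJ_eq, G.expect, hω.map_stabJ]

/-- The symmetric difference has trivial syndrome, so it is a sum of faces and its operator is a
product of stabilizers, which fix `Ω`. -/
theorem repX_vec_eq (hω : IsGroundState ω) {D E : Finset Vertex}
    (h : ∀ f : Face, par D f.support = par E f.support) : G.repX D G.vec = G.repX E G.vec := by
  have key : G.repX (E ∆ D) G.vec = G.vec := by
    refine even_induction (P := fun D => G.repX D G.vec = G.vec) ?_ ?_ _ ?_
    · rw [repX_empty]; rfl
    · intro D f hD
      rw [← repX_mul, mul_apply_eq_comp, repX_support_vec hω, hD]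
    · intro f
      rw [par_symmDiff, h, CharTwo.add_self_eq_zero]
  conv_rhs => rw [← key, ← mul_apply_eq_comp, repX_mul, symmDiff_symmDiff_cancel_left]

theorem repZ_vec_eq (hω : IsGroundState ω) {D E : Finset Vertex}
    (h : ∀ f : Face, par D f.support = par E f.support) : G.repZ D G.vec = G.repZ E G.vec := by
  have key : G.repZ (E ∆ D) G.vec = G.vec := by
    refine even_induction (P := fun D => G.repZ D G.vec = G.vec) ?_ ?_ _ ?_
    · rw [repZ_empty]; rfl
    · intro D f hD
      rw [← repZ_mul, mul_apply_eq_comp, repZ_support_vec hω, hD]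
    · intro f
      rw [par_symmDiff, h, CharTwo.add_self_eq_zero]
  conv_rhs => rw [← key, ← mul_apply_eq_comp, repZ_mul, symmDiff_symmDiff_cancel_left]

/-- A Pauli operator with finite support. -/
def pauli (G : GNS ω H) (p : Finset Vertex × Finset Vertex) : H →L[ℂ] H :=
  G.repX p.1 * G.repZ p.2

theorem star_pauli (p : Finset Vertex × Finset Vertex) :
    star (G.pauli p) = sgn p.1 p.2 • G.pauli p := by
  rw [pauli, star_mul, star_repX, star_repZ, repZ_mul_repX]

theorem star_pauli_mul (p : Finset Vertex × Finset Vertex) : star (G.pauli p) * G.pauli p = 1 := by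
  rw [pauli, star_mul, star_repX, star_repZ, mul_assoc, ← mul_assoc (G.repX _), repX_mul_self,
    one_mul, repZ_mul_self]

theorem repZ_pauli_vec (hω : IsGroundState ω) (f : Face) (p : Finset Vertex × Finset Vertex) :
    G.repZ f.support (G.pauli p G.vec) = sgn p.1 f.support • G.pauli p G.vec := by
  rw [← mul_apply_eq_comp, pauli, ← mul_assoc, repZ_mul_repX, smul_mul_assoc, mul_assoc,
    (G.repZ_comm _ _).eq, ← mul_assoc, _root_.smul_apply, mul_apply_eq_comp, repZ_support_vec hω]

theorem repX_pauli_vec (hω : IsGroundState ω) (f : Face) (p : Finset Vertex × Finset Vertex) :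
    G.repX f.support (G.pauli p G.vec) = sgn p.2 f.support • G.pauli p G.vec := by
  rw [← mul_apply_eq_comp, pauli, ← mul_assoc, (G.repX_comm _ _).eq, mul_assoc, repX_mul_repZ,
    mul_smul_comm, ← mul_assoc, _root_.smul_apply, mul_apply_eq_comp, repX_support_vec hω, sgn_comm]

theorem inner_pauli_self (hω : IsGroundState ω) (p : Finset Vertex × Finset Vertex) :
    inner ℂ (G.pauli p G.vec) (G.pauli p G.vec) = (1 : ℂ) := by
  rw [inner_apply_left, ← mul_apply_eq_comp, star_pauli_mul]
  exact G.inner_vec_vec hω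

theorem inner_eq_zero_of_eigen {A : H →L[ℂ] H} (hA : star A = A) {ξ η : H} {s t : ℂ}
    (hs : conj s = s) (hξ : A ξ = s • ξ) (hη : A η = t • η) (hst : s ≠ t) : inner ℂ ξ η = (0 : ℂ) := by
  have h1 : inner ℂ (A ξ) η = inner ℂ ξ (A η) := by rw [inner_apply_left, hA]
  rw [hξ, hη, inner_smul_left, inner_smul_right, hs] at h1
  have : (s - t) * inner ℂ ξ η = (0 : ℂ) := by rw [sub_mul, h1, sub_self]
  exact (mul_eq_zero.1 this).resolve_left (sub_ne_zero.2 hst)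

theorem sgn_eq_iff {D D' E : Finset Vertex} : sgn D E = sgn D' E ↔ par D E = par D' E := by
  have h1 := sgn_eq_one_iff (D := D) (E := E)
  have h2 := sgn_eq_one_iff (D := D') (E := E)
  have key : ∀ x y : ZMod 2, x = y ↔ (x = 0 ↔ y = 0) := by decide
  rw [key, ← h1, ← h2]
  rcases sgn_eq_one_or D E with h3 | h3 <;> rcases sgn_eq_one_or D' E with h4 | h4 <;>
    norm_num [h3, h4]

/-- The syndrome of a Pauli operator. -/
def pauliSyndrome (p : Finset Vertex × Finset Vertex) : (Face → ZMod 2) × (Face → ZMod 2) :=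
  (fun f => par p.1 f.support, fun f => par p.2 f.support)

/-- Pauli vectors are common eigenvectors of the self-adjoint stabilizers; a face on which the
syndromes differ gives distinct eigenvalues. -/
theorem inner_pauli_of_ne (hω : IsGroundState ω) {p q : Finset Vertex × Finset Vertex}
    (h : pauliSyndrome p ≠ pauliSyndrome q) :
    inner ℂ (G.pauli p G.vec) (G.pauli q G.vec) = (0 : ℂ) := by
  rw [Ne, Prod.ext_iff, not_and_or] at h
  rcases h with h | h
  · obtain ⟨f, hf⟩ := Function.ne_iff.1 h
    exact inner_eq_zero_of_eigen (G.star_repZ f.support) (conj_sgn _ _) (repZ_pauli_vec hω f p)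
      (repZ_pauli_vec hω f q) (fun h => hf (sgn_eq_iff.1 h))
  · obtain ⟨f, hf⟩ := Function.ne_iff.1 h
    exact inner_eq_zero_of_eigen (G.star_repX f.support) (conj_sgn _ _) (repX_pauli_vec hω f p)
      (repX_pauli_vec hω f q) (fun h => hf (sgn_eq_iff.1 h))

theorem pauli_vec_of_eq (hω : IsGroundState ω) {p q : Finset Vertex × Finset Vertex}
    (h : pauliSyndrome p = pauliSyndrome q) :
    G.pauli p G.vec = (sgn p.1 q.2 * sgn q.1 q.2) • G.pauli q G.vec := by
  have h1 : ∀ f : Face, par p.1 f.support = par q.1 f.support := congrFun (congrArg Prod.fst h)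
  have h2 : ∀ f : Face, par p.2 f.support = par q.2 f.support := congrFun (congrArg Prod.snd h)
  rw [pauli, mul_apply_eq_comp, repZ_vec_eq hω h2, ← mul_apply_eq_comp, repX_mul_repZ,
    _root_.smul_apply, mul_apply_eq_comp, repX_vec_eq hω h1, ← mul_apply_eq_comp, repZ_mul_repX,
    _root_.smul_apply, smul_smul]
  rfl

theorem mem_closure_span_pauli_vec (G : GNS ω H) (ξ : H) :
    ξ ∈ (Submodule.span ℂ (Set.range fun p => G.pauli p G.vec)).topologicalClosure := by
  have h1 : ∀ a, G.rep a G.vec ∈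
      (Submodule.span ℂ (Set.range fun p => G.pauli p G.vec)).topologicalClosure := by
    intro a
    have hcont : Continuous fun a : QuasiLocal => G.rep a G.vec :=
      (continuous_starAlgHom G.rep).clm_apply continuous_const
    refine map_mem_closure (f := fun a : QuasiLocal => G.rep a G.vec) hcont (mem_closure_span_pauli a) fun b hb => ?_
    change G.rep b G.vec ∈ Submodule.span ℂ (Set.range fun p => G.pauli p G.vec)
    induction hb using Submodule.span_induction with
    | mem x hx =>
      obtain ⟨p, rfl⟩ := hx
      refine Submodule.subset_span ⟨p, ?_⟩
      simp only [map_mul]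
      rfl
    | zero => rw [map_zero]; exact zero_mem _
    | add x y _ _ hx hy => rw [map_add, _root_.add_apply]; exact add_mem hx hy
    | smul c x _ hx => rw [map_smul, _root_.smul_apply]; exact Submodule.smul_mem _ _ hx
  have h2 := G.cyclic ξ
  refine (Submodule.isClosed_topologicalClosure _).closure_subset_iff.2 ?_ h2
  rintro _ ⟨a, rfl⟩
  exact h1 a

/-- There is an orthonormal basis that consists of vectors of the form `p Ω`, for Pauli operators
`p`. -/
theorem exists_pauli_basis (hω : IsGroundState ω) : ∃ (ι : Type)
    (r : ι → Finset Vertex × Finset Vertex) (b : HilbertBasis ι ℂ H),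
    ∀ i, b i = G.pauli (r i) G.vec := by
  -- One representative per syndrome suffices, since any other Pauli vector with that syndrome is
  -- proportional to it.
  let ι := Set.range pauliSyndrome
  let r : ι → Finset Vertex × Finset Vertex := fun i => i.2.choose
  have hr : ∀ i, pauliSyndrome (r i) = i.1 := fun i => i.2.choose_spec
  have hon : Orthonormal ℂ fun i : ι => G.pauli (r i) G.vec := by
    classical
    rw [orthonormal_iff_ite]
    intro i j
    split_ifs with h
    · rw [h]; exact inner_pauli_self hω _
    · exact inner_pauli_of_ne hω fun h' => h (Subtype.ext (by rw [← hr i, ← hr j, h']))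
  refine ⟨ι, r, HilbertBasis.mk hon ?_, fun i => by rw [HilbertBasis.coe_mk]⟩
  intro ξ _
  refine Submodule.topologicalClosure_mono ?_ (G.mem_closure_span_pauli_vec ξ)
  rw [Submodule.span_le]
  rintro _ ⟨p, rfl⟩
  simp only
  rw [pauli_vec_of_eq hω (hr ⟨pauliSyndrome p, p, rfl⟩).symm]
  exact Submodule.smul_mem _ _ (Submodule.subset_span ⟨_, rfl⟩)

/-! ### Haag duality -/

/-- Commute `p` past `T` and move it to the left entry of the inner product; the sign comes from `p*
= ± p`. -/
theorem inner_apply_vec_of_commute {T : H →L[ℂ] H} {p : Finset Vertex × Finset Vertex}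
    (hp : Commute T (G.pauli p)) :
    inner ℂ (star T G.vec) (G.pauli p G.vec) =
      sgn p.1 p.2 * inner ℂ (G.pauli p G.vec) (T G.vec) := by
  rw [inner_star_left, ← mul_apply_eq_comp, hp.eq, mul_apply_eq_comp, ← inner_star_left, star_pauli,
    _root_.smul_apply, inner_smul_left, conj_sgn]

theorem inner_eq_zero_of_flip {T S : H →L[ℂ] H} (hS : star S = S) (hvec : S G.vec = G.vec)
    (hT : Commute T S) {ξ : H} (hξ : S ξ = -ξ) : inner ℂ ξ (T G.vec) = (0 : ℂ) := by
  have h1 : inner ℂ ξ (T G.vec) = -inner ℂ ξ (T G.vec) := by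
    conv_lhs => rw [← hvec, ← mul_apply_eq_comp, hT.eq, mul_apply_eq_comp, ← inner_star_left, hS, hξ,
      inner_neg_left]
  exact self_eq_neg.1 h1

/-- The vector `TΩ` is fixed by every stabilizer that commutes with `T`, hence orthogonal to vectors
that violate one of them. -/
theorem inner_pauli_eq_zero (hω : IsGroundState ω) {Λ : Set Vertex} {T : H →L[ℂ] H}
    (hT : G.CommutesWith Λ T) {p : Finset Vertex × Finset Vertex} {f : Face}
    (hf : ↑f.support ⊆ Λ) (hp : par p.1 f.support ≠ 0 ∨ par p.2 f.support ≠ 0) :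
    inner ℂ (G.pauli p G.vec) (T G.vec) = (0 : ℂ) := by
  have hsgn : ∀ D, par D f.support ≠ 0 → sgn D f.support = -1 := fun D h =>
    (sgn_eq_one_or _ _).resolve_left fun h' => h (sgn_eq_one_iff.1 h')
  rcases hp with h | h
  · exact inner_eq_zero_of_flip (G.star_repZ _) (repZ_support_vec hω f) (hT.commute_repZ hf)
      (by rw [repZ_pauli_vec hω, hsgn _ h, neg_one_smul])
  · exact inner_eq_zero_of_flip (G.star_repX _) (repX_support_vec hω f) (hT.commute_repX hf)
      (by rw [repX_pauli_vec hω, hsgn _ h, neg_one_smul])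

theorem CommutesWith.commute_pauli {Λ : Set Vertex} {T : H →L[ℂ] H} (h : G.CommutesWith Λ T)
    {p : Finset Vertex × Finset Vertex} (h1 : ↑p.1 ⊆ Λ) (h2 : ↑p.2 ⊆ Λ) : Commute T (G.pauli p) :=
  (h.commute_repX h1).mul_right (h.commute_repZ h2)

theorem commutesWith_pauli {Λ : Set Vertex} {p : Finset Vertex × Finset Vertex}
    (h1 : ↑p.1 ⊆ Λᶜ) (h2 : ↑p.2 ⊆ Λᶜ) : G.CommutesWith Λ (G.pauli p) :=
  (commutesWith_repX h1).mul (commutesWith_repZ h2)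

/-- The core of Haag duality. If `p` excites a face inside `Λ`, the factors with `B` vanish;
outside, those with `T`. Otherwise the syndrome sits on faces across the boundary, and `pΩ` equals,
up to signs, both `lΩ` with `l` supported in `Λ` and `cΩ` with `c` supported in `Λᶜ`. Commuting `T`
with `c` and `B` with `l` identifies both sides up to the signs by which `c` and `l` differ from
their adjoints. -/
theorem inner_mul_inner_pauli (hω : IsGroundState ω) {Λ : Set Vertex} (hΛ : LatticeConnected Λ)
    (hΛc : LatticeConnected Λᶜ) {T B : H →L[ℂ] H} (hT : G.CommutesWith Λᶜ T)
    (hB : G.CommutesWith Λ B) (p : Finset Vertex × Finset Vertex) :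
    inner ℂ (star T G.vec) (G.pauli p G.vec) * inner ℂ (G.pauli p G.vec) (B G.vec) =
      inner ℂ (star B G.vec) (G.pauli p G.vec) * inner ℂ (G.pauli p G.vec) (T G.vec) := by
  by_cases h : ∃ f : Face, (par p.1 f.support ≠ 0 ∨ par p.2 f.support ≠ 0) ∧
      (↑f.support ⊆ Λ ∨ ↑f.support ⊆ Λᶜ)
  · obtain ⟨f, hp, hf | hf⟩ := h
    · have h1 := inner_pauli_eq_zero hω hB hf hp
      have h2 := inner_pauli_eq_zero hω hB.star hf hp
      rw [h1, inner_eq_zero_symm.1 h2, mul_zero, zero_mul]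
    · have h1 := inner_pauli_eq_zero hω hT hf hp
      have h2 := inner_pauli_eq_zero hω hT.star hf hp
      rw [h1, inner_eq_zero_symm.1 h2, mul_zero, zero_mul]
  · push Not at h
    have hc : ∀ f : Face, (↑f.support ⊆ Λ ∨ ↑f.support ⊆ Λᶜ) →
        par p.1 f.support = 0 ∧ par p.2 f.support = 0 := by
      intro f hf
      by_contra hcon
      have := h f (by tauto)
      tauto
    obtain ⟨l1, hl1, el1⟩ := exists_syndrome_eq hΛ p.1 fun f hf => (hc f (Or.inr hf)).1
    obtain ⟨l2, hl2, el2⟩ := exists_syndrome_eq hΛ p.2 fun f hf => (hc f (Or.inr hf)).2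
    obtain ⟨c1, hc1, ec1⟩ := exists_syndrome_eq hΛc p.1 fun f hf => (hc f (Or.inl (by simpa using hf))).1
    obtain ⟨c2, hc2, ec2⟩ := exists_syndrome_eq hΛc p.2 fun f hf => (hc f (Or.inl (by simpa using hf))).2
    have el : pauliSyndrome p = pauliSyndrome (l1, l2) := Prod.ext (funext fun f => (el1 f).symm) (funext fun f => (el2 f).symm)
    have ec : pauliSyndrome p = pauliSyndrome (c1, c2) := Prod.ext (funext fun f => (ec1 f).symm) (funext fun f => (ec2 f).symm)
    have hsign : ∀ q : Finset Vertex × Finset Vertex, pauliSyndrome p = pauliSyndrome q →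
        ∃ s : ℂ, s * s = 1 ∧ conj s = s ∧ G.pauli p G.vec = s • G.pauli q G.vec := by
      intro q hq
      refine ⟨_, ?_, ?_, pauli_vec_of_eq hω hq⟩
      · rw [mul_mul_mul_comm, sgn_mul_self, sgn_mul_self, one_mul]
      · rw [map_mul, conj_sgn, conj_sgn]
    obtain ⟨s, hs, hs', hps⟩ := hsign _ ec
    obtain ⟨t, ht, ht', hpt⟩ := hsign _ el
    have hTc : inner ℂ (star T G.vec) (G.pauli p G.vec) =
        sgn c1 c2 * inner ℂ (G.pauli p G.vec) (T G.vec) := by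
      rw [hps, inner_smul_right, inner_smul_left, hs',
        inner_apply_vec_of_commute (hT.commute_pauli hc1 hc2)]
      ring
    have hBl : inner ℂ (star B G.vec) (G.pauli p G.vec) =
        sgn l1 l2 * inner ℂ (G.pauli p G.vec) (B G.vec) := by
      rw [hpt, inner_smul_right, inner_smul_left, ht',
        inner_apply_vec_of_commute (hB.commute_pauli hl1 hl2)]
      ring
    have hcomm : Commute (G.pauli (l1, l2)) (G.pauli (c1, c2)) := by
      have hl : G.CommutesWith Λᶜ (G.pauli (l1, l2)) :=
        commutesWith_pauli (by simpa using hl1) (by simpa using hl2)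
      exact hl.commute_pauli hc1 hc2
    -- the two signs agree
    have hss : sgn c1 c2 = sgn l1 l2 := by
      have hcl : G.pauli (c1, c2) G.vec = (s * t) • G.pauli (l1, l2) G.vec := by
        rw [mul_smul, ← hpt, hps, smul_smul, hs, one_smul]
      have hsq (q : Finset Vertex × Finset Vertex) :
          sgn q.1 q.2 • (G.pauli q * G.pauli q) G.vec = G.vec := by
        rw [← _root_.smul_apply, ← smul_mul_assoc, ← star_pauli, star_pauli_mul]
        rfl
      -- As `c` and `l` commute and `cΩ = ± lΩ`, also `c²Ω = l²Ω`. The square of a Pauli operator is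
      -- the scalar sign in question.
      have e1 : (G.pauli (c1, c2) * G.pauli (c1, c2)) G.vec =
          (G.pauli (l1, l2) * G.pauli (l1, l2)) G.vec := by
        rw [mul_apply_eq_comp, hcl, map_smul, ← mul_apply_eq_comp, ← hcomm.eq, mul_apply_eq_comp, hcl,
          map_smul, smul_smul, mul_mul_mul_comm, hs, ht, one_mul, one_smul, mul_apply_eq_comp]
      have e2 := hsq (c1, c2)
      rw [e1] at e2
      refine smul_left_injective ℂ (m := (G.pauli (l1, l2) * G.pauli (l1, l2)) G.vec) (fun h0 => ?_) ?_
      · have := hsq (l1, l2)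
        rw [h0, smul_zero] at this
        have h1 := G.inner_vec_vec hω
        rw [← this, inner_zero_left] at h1
        exact zero_ne_one h1
      · exact e2.trans (hsq (l1, l2)).symm
    rw [hTc, hBl, hss]
    ring

/-- Parseval's identity in the Pauli basis reduces the claim to the termwise identity
`inner_mul_inner_pauli`. -/
theorem inner_commute_vec (hω : IsGroundState ω) {Λ : Set Vertex} (hΛ : LatticeConnected Λ)
    (hΛc : LatticeConnected Λᶜ) {T B : H →L[ℂ] H} (hT : G.CommutesWith Λᶜ T)
    (hB : G.CommutesWith Λ B) : inner ℂ G.vec ((T * B) G.vec) = inner ℂ G.vec ((B * T) G.vec) := by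
  obtain ⟨ι, r, b, hb⟩ := exists_pauli_basis (G := G) hω
  rw [mul_apply_eq_comp, mul_apply_eq_comp, ← inner_star_left T G.vec (B G.vec),
    ← inner_star_left B G.vec (T G.vec), ← b.tsum_inner_mul_inner, ← b.tsum_inner_mul_inner]
  refine tsum_congr fun i => ?_
  rw [hb]
  exact inner_mul_inner_pauli hω hΛ hΛc hT hB (r i)

theorem pauli_split (Λ : Set Vertex) (p : Finset Vertex × Finset Vertex) :
    ∃ (l c : Finset Vertex × Finset Vertex) (s : ℂ), ↑l.1 ⊆ Λ ∧ ↑l.2 ⊆ Λ ∧ ↑c.1 ⊆ Λᶜ ∧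
      ↑c.2 ⊆ Λᶜ ∧ G.pauli p = s • (G.pauli l * G.pauli c) := by
  classical
  have hsplit (D : Finset Vertex) : D.filter (· ∈ Λ) ∆ D.filter (· ∉ Λ) = D := by
    ext v
    simp only [Finset.mem_symmDiff, Finset.mem_filter]
    tauto
  have hin (D : Finset Vertex) : ↑(D.filter (· ∈ Λ)) ⊆ Λ := fun v hv => (Finset.mem_filter.1 hv).2
  have hout (D : Finset Vertex) : ↑(D.filter (· ∉ Λ)) ⊆ Λᶜ := fun v hv => (Finset.mem_filter.1 hv).2
  refine ⟨(p.1.filter (· ∈ Λ), p.2.filter (· ∈ Λ)), (p.1.filter (· ∉ Λ), p.2.filter (· ∉ Λ)),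
    sgn (p.1.filter (· ∉ Λ)) (p.2.filter (· ∈ Λ)), hin _, hin _, hout _, hout _, ?_⟩
  simp only [pauli]
  rw [mul_assoc, ← mul_assoc (G.repZ _), repZ_mul_repX, smul_mul_assoc, mul_smul_comm, smul_smul,
    sgn_mul_self, one_smul, mul_assoc, repZ_mul, ← mul_assoc, repX_mul, hsplit, hsplit]

theorem ext_inner_pauli {S T : H →L[ℂ] H} (h : ∀ p q, inner ℂ (G.pauli p G.vec)
    (S (G.pauli q G.vec)) = (inner ℂ (G.pauli p G.vec) (T (G.pauli q G.vec)) : ℂ)) : S = T := by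
  have hd : Dense (Submodule.span ℂ (Set.range fun p => G.pauli p G.vec) : Set H) := fun ξ =>
    G.mem_closure_span_pauli_vec ξ
  have h1 : ∀ q, S (G.pauli q G.vec) = T (G.pauli q G.vec) := by
    intro q
    refine hd.eq_of_inner_left (𝕜 := ℂ) fun ξ hξ => ?_
    rw [← inner_conj_symm, ← inner_conj_symm (T _)]
    congr 1
    induction hξ using Submodule.span_induction with
    | mem x hx => obtain ⟨p, rfl⟩ := hx; exact h p q
    | zero => rw [inner_zero_left, inner_zero_left]
    | add x y _ _ hx hy => rw [inner_add_left, inner_add_left, hx, hy]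
    | smul c x _ hx => rw [inner_smul_left, inner_smul_left, hx]
  refine ContinuousLinearMap.ext_on hd ?_
  rintro _ ⟨q, rfl⟩
  exact h1 q

/-- Sandwiched between products of an inner and an outer factor, `TB` splits into `T` sandwiched by
the inner factors times `B` sandwiched by the outer ones. The new operators satisfy the same
commutation hypotheses as `T` and `B`. -/
theorem conj_mul_conj {A : Type*} [Monoid A] [StarMul A] {a a' c c' T B : A}
    (h1 : Commute T c') (h2 : Commute T (star c)) (h3 : Commute B a') (h4 : Commute B (star a))
    (h5 : Commute a' (star c)) (h6 : Commute (star a) (star c)) (h7 : Commute c' a')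
    (h8 : Commute (star a) c') :
    star (a * c) * (T * B) * (a' * c') = (star a * T * a') * (star c * B * c') ∧
      star (a * c) * (B * T) * (a' * c') = (star c * B * c') * (star a * T * a') := by
  constructor
  · calc star (a * c) * (T * B) * (a' * c') = (star c * star a) * T * (B * a') * c' := by
          simp only [star_mul, mul_assoc]
      _ = star a * (star c * T) * a' * B * c' := by
          rw [← h6.eq, h3.eq]; simp only [mul_assoc]
      _ = star a * T * (star c * a') * B * c' := by rw [← h2.eq]; simp only [mul_assoc]
      _ = _ := by rw [← h5.eq]; simp only [mul_assoc]
  · calc star (a * c) * (B * T) * (a' * c') = star c * (star a * B) * T * (a' * c') := by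
          simp only [star_mul, mul_assoc]
      _ = star c * B * star a * (T * c') * a' := by
          rw [← h4.eq, ← h7.eq]; simp only [mul_assoc]
      _ = star c * B * (star a * c') * T * a' := by rw [h1.eq]; simp only [mul_assoc]
      _ = _ := by rw [h8.eq]; simp only [mul_assoc]

/-- **Haag duality** for regions such that both the region and its complement are connected. -/
theorem haag_duality_of_connected (hω : IsGroundState ω) {Λ : Set Vertex}
    (hΛ : LatticeConnected Λ) (hΛc : LatticeConnected Λᶜ) {T : H →L[ℂ] H}
    (hT : G.CommutesWith Λᶜ T) : T ∈ G.vonNeumann Λ := by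
  refine mem_vonNeumann_iff.2 fun B hB => ?_
  symm
  refine ext_inner_pauli (G := G) fun p q => ?_
  obtain ⟨a, c, s, ha1, ha2, hc1, hc2, hp⟩ := pauli_split (G := G) Λ p
  obtain ⟨a', c', s', ha1', ha2', hc1', hc2', hq⟩ := pauli_split (G := G) Λ q
  have hc := commutesWith_pauli (G := G) hc1 hc2
  have hc' := commutesWith_pauli (G := G) hc1' hc2'
  have ha := commutesWith_pauli (G := G) (p := a) (Λ := Λᶜ) (by simpa using ha1) (by simpa using ha2)
  have ha' := commutesWith_pauli (G := G) (p := a') (Λ := Λᶜ) (by simpa using ha1')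
    (by simpa using ha2')
  obtain ⟨e1, e2⟩ := conj_mul_conj (hT.commute_pauli hc1' hc2')
    (by simpa using (hT.star.commute_pauli hc1 hc2).star_star) (hB.commute_pauli ha1' ha2')
    (by simpa using (hB.star.commute_pauli ha1 ha2).star_star)
    (by simpa using (ha'.star.commute_pauli hc1 hc2).star_star)
    ((ha.commute_pauli hc1 hc2).star_star) (hc'.commute_pauli ha1' ha2')
    (ha.star.commute_pauli hc1' hc2')
  -- Matrix elements of `TB` and `BT` between Pauli vectors are vacuum expectations for the
  -- sandwiched operators.
  have h := inner_commute_vec hω hΛ hΛc ((ha.star.mul hT).mul ha') ((hc.star.mul hB).mul hc')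
  rw [← e1, ← e2] at h
  rw [hp, hq]
  simp only [_root_.smul_apply, map_smul, inner_smul_left, inner_smul_right]
  rw [inner_apply_left, inner_apply_left]
  congr 2

/-! ### Adding finitely many sites to a region -/

/-- Averaging over the Pauli group that is generated by `x` and `z`. -/
def twirl {A : Type*} [Ring A] (x z S : A) : A := S + x * S * x + z * S * z + x * z * S * (z * x)

/-- Conjugation by `x` or `z` permutes the four summands. -/
theorem commute_twirl {A : Type*} [Ring A] {x z : A} (hx : x * x = 1) (hz : z * z = 1) (hxz : z * x = -(x * z))
    (S : A) : Commute (twirl x z S) x ∧ Commute (twirl x z S) z := by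
  have hx' (y : A) : x * (x * y) = y := by rw [← mul_assoc, hx, one_mul]
  have hz' (y : A) : z * (z * y) = y := by rw [← mul_assoc, hz, one_mul]
  have hxz' (y : A) : z * (x * y) = -(x * (z * y)) := by
    rw [← mul_assoc, hxz, neg_mul, mul_assoc]
  constructor
  · rw [commute_iff_eq, twirl]
    simp only [mul_add, add_mul, mul_assoc, hx, hxz, hx', mul_neg, neg_mul, neg_neg,
      mul_one]
    abel
  · rw [commute_iff_eq, twirl]
    simp only [mul_add, add_mul, mul_assoc, hz, hxz, hz', hxz', mul_neg, neg_mul, neg_neg,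
      mul_one]
    abel

/-- Fourier inversion over the four Pauli matrices of one site: every operator is a combination of
Pauli matrices whose coefficients commute with that site. -/
theorem four_smul_eq_twirl {A : Type*} [Ring A] {x z : A} (hx : x * x = 1) (hz : z * z = 1)
    (hxz : z * x = -(x * z)) (T : A) : (4 : ℕ) • T = twirl x z T + twirl x z (T * x) * x +
      twirl x z (T * z) * z + twirl x z (T * (z * x)) * (x * z) := by
  have hx' (y : A) : x * (x * y) = y := by rw [← mul_assoc, hx, one_mul]
  have hz' (y : A) : z * (z * y) = y := by rw [← mul_assoc, hz, one_mul]
  have hxz' (y : A) : z * (x * y) = -(x * (z * y)) := by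
    rw [← mul_assoc, hxz, neg_mul, mul_assoc]
  simp only [twirl, add_mul, mul_assoc, hx, hz, hxz, hx', hxz', mul_neg, neg_mul,
    neg_neg, mul_one]
  abel

/-- Haag duality is not affected by adding a site to the region. -/
theorem mem_vonNeumann_insert {Λ : Set Vertex} {v : Vertex}
    (hΛ : ∀ T, G.CommutesWith Λᶜ T → T ∈ G.vonNeumann Λ) {T : H →L[ℂ] H}
    (hT : G.CommutesWith (insert v Λ)ᶜ T) : T ∈ G.vonNeumann (insert v Λ) := by
  by_cases hv : v ∈ Λ
  · rw [Set.insert_eq_of_mem hv] at hT ⊢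
    exact hΛ T hT
  refine mem_vonNeumann_iff.2 fun B hB => ?_
  set x := G.rep (pauliX v) with hxdef
  set z := G.rep (pauliZ v) with hzdef
  have hx : x * x = 1 := G.repX_mul_self {v}
  have hz : z * z = 1 := by rw [hzdef, ← opZ_singleton]; exact G.repZ_mul_self {v}
  have hxz : z * x = -(x * z) := by
    have h := G.repZ_mul_repX {v} {v}
    rw [sgn_singleton, if_pos (Finset.mem_singleton_self v), neg_one_smul] at h
    rw [hzdef, ← opZ_singleton]
    exact h
  have hxC : G.CommutesWith (insert v Λ)ᶜ x := commutesWith_repX (D := {v}) (by simp)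
  have hzC : G.CommutesWith (insert v Λ)ᶜ z := by
    rw [hzdef, ← opZ_singleton]
    exact commutesWith_repZ (by simp)
  -- The average commutes with the site `v` as well as with everything outside `insert v Λ`, hence
  -- with all of `Λᶜ`. Duality for `Λ` then applies to it.
  have key (S : H →L[ℂ] H) (hS : G.CommutesWith (insert v Λ)ᶜ S) : Commute B (twirl x z S) := by
    refine mem_vonNeumann_iff.1 (hΛ _ fun w hw => ?_) B (hB.mono (Set.subset_insert v Λ))
    by_cases hwv : w = v
    · rw [hwv]
      exact commute_twirl hx hz hxz S
    · have hw' : w ∈ (insert v Λ)ᶜ := fun h => h.elim hwv hw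
      have h1 := hxC w hw'
      have h2 := hzC w hw'
      have h3 := hS w hw'
      exact ⟨((h3.1.add_left ((h1.1.mul_left h3.1).mul_left h1.1)).add_left
          ((h2.1.mul_left h3.1).mul_left h2.1)).add_left
          (((h1.1.mul_left h2.1).mul_left h3.1).mul_left (h2.1.mul_left h1.1)),
        ((h3.2.add_left ((h1.2.mul_left h3.2).mul_left h1.2)).add_left
          ((h2.2.mul_left h3.2).mul_left h2.2)).add_left
          (((h1.2.mul_left h2.2).mul_left h3.2).mul_left (h2.2.mul_left h1.2))⟩
  have hBx := (hB v (Set.mem_insert v Λ)).1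
  have hBz := (hB v (Set.mem_insert v Λ)).2
  have h4 : Commute B ((4 : ℕ) • T) := by
    rw [four_smul_eq_twirl hx hz hxz T]
    exact (((key T hT).add_right ((key _ (hT.mul hxC)).mul_right hBx)).add_right
      ((key _ (hT.mul hzC)).mul_right hBz)).add_right
      ((key _ (hT.mul (hzC.mul hxC))).mul_right (hBx.mul_right hBz))
  have h5 := h4.smul_right ((4 : ℂ)⁻¹)
  rwa [← Nat.cast_smul_eq_nsmul ℂ, smul_smul, Nat.cast_ofNat, inv_mul_cancel₀ (by norm_num), one_smul]
    at h5

theorem haag_duality_of_finite (hω : IsGroundState ω) {Λ M : Set Vertex} (hM : M ⊆ Λ)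
    (hfin : (Λ \ M).Finite) (h1 : LatticeConnected M) (h2 : LatticeConnected Mᶜ)
    {T : H →L[ℂ] H} (hT : G.CommutesWith Λᶜ T) : T ∈ G.vonNeumann Λ := by
  have key : ∀ F : Set Vertex, F.Finite → ∀ T, G.CommutesWith (M ∪ F)ᶜ T →
      T ∈ G.vonNeumann (M ∪ F) := by
    intro F hF
    induction F, hF using Set.Finite.induction_on with
    | empty => rw [Set.union_empty]; exact fun T => haag_duality_of_connected hω h1 h2
    | insert _ _ ih => rw [Set.union_insert]; exact fun T => mem_vonNeumann_insert ih
  have := key _ hfin T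
  rw [Set.union_sdiff_cancel hM] at this
  exact this hT

end GNS

/-! ### Connectedness of regions bounded by lines -/

theorem eqvGen_step_mono {S T : Set Vertex} (h : S ⊆ T) {v w : Vertex}
    (hvw : Relation.EqvGen (Step S) v w) : Relation.EqvGen (Step T) v w :=
  hvw.mono fun _ _ h' => ⟨h h'.1, h h'.2.1, h'.2.2⟩

theorem LatticeConnected.union {S T : Set Vertex} (hS : LatticeConnected S)
    (hT : LatticeConnected T) (h : (S ∩ T).Nonempty) : LatticeConnected (S ∪ T) := by
  obtain ⟨u, hu1, hu2⟩ := h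
  have key : ∀ v ∈ S ∪ T, Relation.EqvGen (Step (S ∪ T)) v u := by
    rintro v (hv | hv)
    · exact eqvGen_step_mono Set.subset_union_left (hS v hv u hu1)
    · exact eqvGen_step_mono Set.subset_union_right (hT v hv u hu2)
  exact fun v hv w hw => (key v hv).trans _ _ _ ((key w hw).symm _ _)

theorem eqvGen_row {S : Set Vertex} {m n : ℤ} (k : ℕ) (h : ∀ j : ℕ, j ≤ k → (m + j, n) ∈ S) :
    Relation.EqvGen (Step S) (m, n) (m + k, n) := by
  induction k with
  | zero => simpa using Relation.EqvGen.refl _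
  | succ k ih =>
    refine (ih fun j hj => h j (by omega)).trans _ _ _ (Relation.EqvGen.rel _ _ ?_)
    refine ⟨h k (by omega), h (k + 1) le_rfl, Or.inl ?_⟩
    push_cast
    rw [add_assoc]

/-- A set of vertices is connected if its rows are intervals and consecutive rows overlap in
two consecutive columns. -/
theorem latticeConnected_of_rows {S : Set Vertex}
    (hrow : ∀ m m' k n : ℤ, (m, n) ∈ S → (m', n) ∈ S → m ≤ k → k ≤ m' → (k, n) ∈ S)
    (hcol : ∀ v ∈ S, ∀ w ∈ S, ∀ n, v.2 ≤ n → n < w.2 →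
      ∃ m, (m, n) ∈ S ∧ (m + 1, n) ∈ S ∧ (m, n + 1) ∈ S ∧ (m + 1, n + 1) ∈ S) :
    LatticeConnected S := by
  have h1 : ∀ m m' n, (m, n) ∈ S → (m', n) ∈ S → Relation.EqvGen (Step S) (m, n) (m', n) := by
    intro m m' n hm hm'
    wlog hle : m ≤ m' generalizing m m'
    · exact (this m' m hm' hm (by omega)).symm
    have := eqvGen_row (S := S) (m := m) (n := n) (m' - m).toNat fun j hj =>
      hrow m m' _ n hm hm' (by omega) (by omega)
    rwa [show m + ((m' - m).toNat : ℤ) = m' by omega] at this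
  have h2 : ∀ k : ℕ, ∀ v ∈ S, ∀ w ∈ S, w.2 = v.2 + k → Relation.EqvGen (Step S) v w := by
    intro k
    induction k with
    | zero =>
      intro v hv w hw h
      obtain ⟨a, b⟩ := v
      obtain ⟨c, d⟩ := w
      simp only [Nat.cast_zero, add_zero] at h
      subst h
      exact h1 _ _ _ hv hw
    | succ k ih =>
      intro v hv w hw h
      push_cast at h
      obtain ⟨m, e1, e2, e3, e4⟩ := hcol v hv w hw (v.2 + k) (by omega) (by omega)
      -- Of two consecutive columns exactly one carries a vertical edge from this row upwards.
      obtain ⟨m', f1, f2, f3⟩ : ∃ m', (m', v.2 + (k : ℤ)) ∈ S ∧ (m', v.2 + (k : ℤ) + 1) ∈ S ∧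
          Odd (m' + (v.2 + k)) := by
        rcases Int.even_or_odd (m + (v.2 + k)) with h' | h'
        · refine ⟨m + 1, e2, e4, ?_⟩
          rw [show m + 1 + (v.2 + (k : ℤ)) = m + (v.2 + k) + 1 by ring]
          exact h'.add_one
        · exact ⟨m, e1, e3, h'⟩
      refine (ih v hv _ f1 rfl).trans _ _ _ ?_
      refine (Relation.EqvGen.rel _ (m', v.2 + (k : ℤ) + 1) ⟨f1, f2, Or.inr ⟨rfl, f3⟩⟩).trans _ _ _ ?_
      obtain ⟨a, b⟩ := w
      simp only at h
      rw [show v.2 + (k : ℤ) + 1 = b by omega] at f2 ⊢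
      exact h1 _ _ _ f2 hw
  intro v hv w hw
  rcases le_total v.2 w.2 with h | h
  · exact h2 (w.2 - v.2).toNat v hv w hw (by omega)
  · exact (h2 (v.2 - w.2).toNat w hw v hv (by omega)).symm

/-- If `α` has the sign `σ`, the linear form grows without bound along the row in that direction. If
`α = 0`, it depends on the row only and lies between its values in the rows of `v` and `w`. -/
theorem exists_large {σ : ℤ} (hσ : σ * σ = 1) {α β : ℝ} (hα : 0 ≤ σ * α) {v w : Vertex} {n : ℤ}
    (h1 : v.2 ≤ n) (h2 : n ≤ w.2) : ∃ M : ℤ, ∀ m, M ≤ σ * m →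
      min (α * v.1 + β * v.2) (α * w.1 + β * w.2) ≤ α * m + β * n := by
  have hσ' : (σ : ℝ) * σ = 1 := by exact_mod_cast hσ
  rcases hα.eq_or_lt with h | h
  · have hα0 : α = 0 := by
      have : (σ : ℝ) ≠ 0 := by rintro h; rw [h] at hσ'; norm_num at hσ'
      exact (mul_eq_zero.1 h.symm).resolve_left this
    refine ⟨0, fun m _ => ?_⟩
    have h1' : (v.2 : ℝ) ≤ n := by exact_mod_cast h1
    have h2' : (n : ℝ) ≤ w.2 := by exact_mod_cast h2
    rw [hα0]
    rcases le_total 0 β with hβ | hβ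
    · exact (min_le_left _ _).trans (by nlinarith)
    · exact (min_le_right _ _).trans (by nlinarith)
  · obtain ⟨M, hM⟩ := exists_int_gt ((min (α * v.1 + β * v.2) (α * w.1 + β * w.2) - β * n) / (σ * α))
    refine ⟨M, fun m hm => ?_⟩
    rw [div_lt_iff₀ h] at hM
    have hm' : (M : ℝ) ≤ σ * m := by exact_mod_cast hm
    have : α * m = (σ * m) * (σ * α) := by linear_combination (- α * m) * hσ'
    nlinarith

/-- Both constraints become weaker in the same horizontal direction, so nonempty rows are rays (or
whole rows) in that direction, and neighbouring rows overlap far out. The predicates allow for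
strict, weak and void inequalities. -/
theorem latticeConnected_of_upper {σ : ℤ} (hσ : σ * σ = 1) {P₁ P₂ : ℝ → Prop}
    (h₁ : ∀ x y, P₁ x → x ≤ y → P₁ y) (h₂ : ∀ x y, P₂ x → x ≤ y → P₂ y) {α₁ β₁ α₂ β₂ : ℝ}
    (hα₁ : 0 ≤ σ * α₁) (hα₂ : 0 ≤ σ * α₂) :
    LatticeConnected {v | P₁ (α₁ * v.1 + β₁ * v.2) ∧ P₂ (α₂ * v.1 + β₂ * v.2)} := by
  have hmin : ∀ {P : ℝ → Prop} {x y : ℝ}, P x → P y → P (min x y) := by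
    intro P x y hx hy
    rcases min_choice x y with h | h <;> rwa [h]
  have hmono : ∀ {α : ℝ} {m m' : ℤ}, 0 ≤ σ * α → σ * m ≤ σ * m' → α * m ≤ α * m' := by
    intro α m m' hα hm
    have hσ' : (σ : ℝ) * σ = 1 := by exact_mod_cast hσ
    have hm' : (σ : ℝ) * m ≤ σ * m' := by exact_mod_cast hm
    have e1 : α * m = (σ * α) * (σ * m) := by linear_combination (- α * m) * hσ'
    have e2 : α * m' = (σ * α) * (σ * m') := by linear_combination (- α * m') * hσ'
    rw [e1, e2]
    exact mul_le_mul_of_nonneg_left hm' hα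
  have hright : ∀ m m' n : ℤ, (m, n) ∈ {v : Vertex | P₁ (α₁ * v.1 + β₁ * v.2) ∧
      P₂ (α₂ * v.1 + β₂ * v.2)} → σ * m ≤ σ * m' → (m', n) ∈ {v : Vertex |
      P₁ (α₁ * v.1 + β₁ * v.2) ∧ P₂ (α₂ * v.1 + β₂ * v.2)} := by
    rintro m m' n ⟨e1, e2⟩ h
    have g1 := hmono hα₁ h
    have g2 := hmono hα₂ h
    exact ⟨h₁ _ _ e1 (by simpa using g1), h₂ _ _ e2 (by simpa using g2)⟩
  have hσ2 : σ = 1 ∨ σ = -1 := Int.isUnit_iff.1 (IsUnit.of_mul_eq_one _ hσ)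
  refine latticeConnected_of_rows ?_ ?_
  · intro m m' k n hm hm' h1 h2
    rcases hσ2 with h | h
    · exact hright m k n hm (by rw [h]; omega)
    · exact hright m' k n hm' (by rw [h]; omega)
  · rintro v ⟨hv1, hv2⟩ w ⟨hw1, hw2⟩ n h1 h2
    obtain ⟨M1, hM1⟩ := exists_large (β := β₁) hσ hα₁ h1 h2.le
    obtain ⟨M2, hM2⟩ := exists_large (β := β₂) hσ hα₂ h1 h2.le
    obtain ⟨M3, hM3⟩ := exists_large (β := β₁) hσ hα₁ (show v.2 ≤ n + 1 by omega) (show n + 1 ≤ w.2 by omega)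
    obtain ⟨M4, hM4⟩ := exists_large (β := β₂) hσ hα₂ (show v.2 ≤ n + 1 by omega) (show n + 1 ≤ w.2 by omega)
    set M := max (max M1 M2) (max M3 M4)
    have hM : M1 ≤ M ∧ M2 ≤ M ∧ M3 ≤ M ∧ M4 ≤ M := by omega
    have g1 : ∀ m, M ≤ σ * m → (m, n) ∈ {v : Vertex | P₁ (α₁ * v.1 + β₁ * v.2) ∧
        P₂ (α₂ * v.1 + β₂ * v.2)} := fun m hm =>
      ⟨h₁ _ _ (hmin hv1 hw1) (hM1 m (by omega)), h₂ _ _ (hmin hv2 hw2) (hM2 m (by omega))⟩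
    have g2 : ∀ m, M ≤ σ * m → (m, n + 1) ∈ {v : Vertex | P₁ (α₁ * v.1 + β₁ * v.2) ∧
        P₂ (α₂ * v.1 + β₂ * v.2)} := fun m hm =>
      ⟨h₁ _ _ (hmin hv1 hw1) (hM3 m (by omega)), h₂ _ _ (hmin hv2 hw2) (hM4 m (by omega))⟩
    rcases hσ2 with h | h
    · subst h
      exact ⟨M, g1 _ (by omega), g1 _ (by omega), g2 _ (by omega), g2 _ (by omega)⟩
    · subst h
      exact ⟨-M - 1, g1 _ (by omega), g1 _ (by omega), g2 _ (by omega), g2 _ (by omega)⟩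

theorem latticeConnected_halfPlane (α β γ : ℝ) :
    LatticeConnected {v : Vertex | α * v.1 + β * v.2 ≤ γ} := by
  have hconv : {v : Vertex | α * v.1 + β * v.2 ≤ γ} =
      {v : Vertex | (-γ ≤ (-α) * v.1 + (-β) * v.2) ∧ True} := by
    ext v
    simp only [Set.mem_ofPred_eq, and_true]
    constructor <;> intro h <;> linarith
  rw [hconv]
  rcases le_total α 0 with h | h
  · exact latticeConnected_of_upper (σ := 1) (P₁ := fun x => -γ ≤ x) (P₂ := fun _ => True) (by norm_num)
      (fun _ _ h h' => h.trans h') (fun _ _ _ _ => trivial) (α₂ := 0) (β₂ := 0)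
      (by push_cast; linarith) (by simp)
  · exact latticeConnected_of_upper (σ := -1) (P₁ := fun x => -γ ≤ x) (P₂ := fun _ => True)
      (by norm_num) (fun _ _ h h' => h.trans h') (fun _ _ _ _ => trivial) (α₂ := 0) (β₂ := 0)
      (by push_cast; linarith) (by simp)

/-- The vertices of an intersection of two half planes. -/
def wedge (α₁ β₁ γ₁ α₂ β₂ γ₂ : ℝ) : Set Vertex :=
  {v | γ₁ < α₁ * v.1 + β₁ * v.2 ∧ γ₂ < α₂ * v.1 + β₂ * v.2}

/-- The complement is a union of two half planes. They meet because a large negative multiple of `p`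
satisfies both inequalities. -/
theorem latticeConnected_compl_wedge {α₁ β₁ α₂ β₂ : ℝ} (γ₁ γ₂ : ℝ) {p : Vertex}
    (h₁ : 0 < α₁ * p.1 + β₁ * p.2) (h₂ : 0 < α₂ * p.1 + β₂ * p.2) :
    LatticeConnected (wedge α₁ β₁ γ₁ α₂ β₂ γ₂)ᶜ := by
  have : (wedge α₁ β₁ γ₁ α₂ β₂ γ₂)ᶜ = {v : Vertex | α₁ * v.1 + β₁ * v.2 ≤ γ₁} ∪
      {v : Vertex | α₂ * v.1 + β₂ * v.2 ≤ γ₂} := by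
    ext v
    simp only [wedge, Set.mem_compl_iff, Set.mem_ofPred_eq, not_and_or, not_lt, Set.mem_union]
  rw [this]
  refine (latticeConnected_halfPlane _ _ _).union (latticeConnected_halfPlane _ _ _) ?_
  obtain ⟨N, hN⟩ := exists_nat_gt (max (-γ₁ / (α₁ * p.1 + β₁ * p.2)) (-γ₂ / (α₂ * p.1 + β₂ * p.2)))
  have hN1 := (le_max_left _ _).trans_lt hN
  have hN2 := (le_max_right _ _).trans_lt hN
  rw [div_lt_iff₀ h₁] at hN1
  rw [div_lt_iff₀ h₂] at hN2
  refine ⟨(-N * p.1, -N * p.2), ?_, ?_⟩ <;> simp only [Set.mem_ofPred_eq] <;> push_cast <;> nlinarith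

theorem wedge_comm (α₁ β₁ γ₁ α₂ β₂ γ₂ : ℝ) :
    wedge α₁ β₁ γ₁ α₂ β₂ γ₂ = wedge α₂ β₂ γ₂ α₁ β₁ γ₁ := by
  ext v; exact and_comm

/-- The case of a wedge with bounded rows. -/
theorem exists_connected_of_bounded_rows {α₁ β₁ α₂ β₂ : ℝ} (γ₁ γ₂ : ℝ) {p : Vertex}
    (h₁ : 0 < α₁ * p.1 + β₁ * p.2) (h₂ : 0 < α₂ * p.1 + β₂ * p.2) (hα₁ : 0 < α₁) (hα₂ : α₂ < 0) :
    ∃ M ⊆ wedge α₁ β₁ γ₁ α₂ β₂ γ₂, (wedge α₁ β₁ γ₁ α₂ β₂ γ₂ \ M).Finite ∧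
      LatticeConnected M ∧ LatticeConnected Mᶜ := by
  -- the row of height `n` is the interval `(c₁ - b₁ n, c₂ - b₂ n)`
  obtain ⟨b₁, c₁, e1⟩ : ∃ b₁ c₁ : ℝ, b₁ = β₁ / α₁ ∧ c₁ = γ₁ / α₁ := ⟨_, _, rfl, rfl⟩
  obtain ⟨b₂, c₂, e2⟩ : ∃ b₂ c₂ : ℝ, b₂ = β₂ / α₂ ∧ c₂ = γ₂ / α₂ := ⟨_, _, rfl, rfl⟩
  have hb₁ : β₁ = b₁ * α₁ := by rw [e1.1]; field_simp
  have hc₁ : γ₁ = c₁ * α₁ := by rw [e1.2]; field_simp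
  have hb₂ : β₂ = b₂ * α₂ := by rw [e2.1, div_mul_cancel₀ _ hα₂.ne]
  have hc₂ : γ₂ = c₂ * α₂ := by rw [e2.2, div_mul_cancel₀ _ hα₂.ne]
  have hmem : ∀ m n : ℤ, (m, n) ∈ wedge α₁ β₁ γ₁ α₂ β₂ γ₂ ↔
      c₁ - b₁ * n < m ∧ (m : ℝ) < c₂ - b₂ * n := by
    intro m n
    simp only [wedge, Set.mem_ofPred_eq, hb₁, hc₁, hb₂, hc₂]
    refine and_congr ?_ ?_
    · rw [show α₁ * m + b₁ * α₁ * n = (m + b₁ * n) * α₁ by ring, mul_lt_mul_iff_left₀ hα₁,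
        sub_lt_iff_lt_add]
    · rw [show α₂ * m + b₂ * α₂ * n = (m + b₂ * n) * α₂ by ring, mul_lt_mul_right_of_neg hα₂,
        lt_sub_iff_add_lt]
  -- The width of row `n` is `c₂ - c₁ + (b₁ - b₂) n`. The interior direction `p` shows that the
  -- bounding lines are not parallel; `τ` below is the vertical direction in which the wedge widens.
  have hκ : 0 < (b₁ - b₂) * p.2 := by
    have g1 : 0 < p.1 + b₁ * p.2 := by
      rw [hb₁, show α₁ * p.1 + b₁ * α₁ * p.2 = (p.1 + b₁ * p.2) * α₁ by ring] at h₁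
      by_contra hcon
      nlinarith
    have g2 : p.1 + b₂ * p.2 < 0 := by
      rw [hb₂, show α₂ * p.1 + b₂ * α₂ * p.2 = (p.1 + b₂ * p.2) * α₂ by ring] at h₂
      by_contra hcon
      nlinarith
    linarith
  obtain ⟨τ, hτ, hκτ⟩ : ∃ τ : ℤ, (τ = 1 ∨ τ = -1) ∧ 0 < (b₁ - b₂) * τ := by
    rcases lt_trichotomy (b₁ - b₂) 0 with h | h | h
    · exact ⟨-1, Or.inr rfl, by push_cast; linarith⟩
    · rw [h] at hκ; simp at hκ
    · exact ⟨1, Or.inl rfl, by push_cast; linarith⟩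
  have hτ2 : (τ : ℝ) * τ = 1 := by rcases hτ with h | h <;> rw [h] <;> norm_num
  -- From row `N` on, the width exceeds 2 plus the possible shifts `|b₁|`, `|b₂|` of the two ends,
  -- which leaves room for two columns common to consecutive rows. The finitely many vertices in
  -- earlier rows are discarded.
  obtain ⟨N, hN⟩ := exists_int_gt ((2 + |b₁| + |b₂| + c₁ - c₂) / ((b₁ - b₂) * τ))
  rw [div_lt_iff₀ hκτ] at hN
  have hwide : ∀ n : ℤ, N ≤ τ * n → c₁ - b₁ * n + |b₁| + |b₂| + 2 < c₂ - b₂ * n := by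
    intro n hn
    have hn' : (N : ℝ) ≤ τ * n := by exact_mod_cast hn
    have : (b₁ - b₂) * n = (b₁ - b₂) * τ * (τ * n) := by linear_combination (-(b₁ - b₂) * n) * hτ2
    nlinarith
  refine ⟨{v | v ∈ wedge α₁ β₁ γ₁ α₂ β₂ γ₂ ∧ N ≤ τ * v.2}, fun v hv => hv.1, ?_, ?_, ?_⟩
  · obtain ⟨K, hK⟩ := exists_int_gt ((c₁ - c₂) / ((b₁ - b₂) * τ))
    -- Rows with `τ n ≤ K'` are empty, so the discarded part has bounded height; its rows are
    -- bounded intervals.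
    obtain ⟨K', hK'⟩ := exists_int_lt ((c₁ - c₂) / ((b₁ - b₂) * τ))
    rw [lt_div_iff₀ hκτ] at hK'
    obtain ⟨B, hB⟩ := exists_int_gt (max |(K' : ℝ)| |(N : ℝ)|)
    have hB1 := (le_max_left _ _).trans_lt hB
    have hB2 := (le_max_right _ _).trans_lt hB
    obtain ⟨X, hX⟩ := exists_int_gt (|c₁| + |c₂| + (|b₁| + |b₂|) * B)
    refine (((Set.finite_Icc (-X) X).prod (Set.finite_Icc (-B) B)).subset ?_)
    rintro ⟨m, n⟩ ⟨hv, hv'⟩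
    have hn : τ * n < N := by
      by_contra hcon
      exact hv' ⟨hv, not_lt.1 hcon⟩
    rw [hmem] at hv
    have hn1 : (τ : ℝ) * n < N := by exact_mod_cast hn
    have hn2 : (K' : ℝ) < τ * n := by
      have : (b₁ - b₂) * n = (b₁ - b₂) * τ * (τ * n) := by linear_combination (-(b₁ - b₂) * n) * hτ2
      have h3 : (K' : ℝ) * ((b₁ - b₂) * τ) < (τ * n) * ((b₁ - b₂) * τ) := by nlinarith [hv.1, hv.2]
      exact lt_of_mul_lt_mul_right h3 hκτ.le
    have hn3 : |(n : ℝ)| ≤ B := by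
      have : |(τ : ℝ) * n| = |(n : ℝ)| := by
        rcases hτ with h | h <;> rw [h] <;> simp
      rw [← this, abs_le]
      constructor
      · linarith [neg_abs_le (K' : ℝ)]
      · linarith [le_abs_self (N : ℝ)]
    have g1 : |b₁ * n| ≤ |b₁| * B := by
      rw [abs_mul]; exact mul_le_mul_of_nonneg_left hn3 (abs_nonneg _)
    have g2 : |b₂ * n| ≤ |b₂| * B := by
      rw [abs_mul]; exact mul_le_mul_of_nonneg_left hn3 (abs_nonneg _)
    have g3 : 0 ≤ |b₁| * B := (abs_nonneg _).trans g1
    have g4 : 0 ≤ |b₂| * B := (abs_nonneg _).trans g2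
    rw [abs_le] at g1 g2 hn3
    have g5 := abs_nonneg c₁
    have g6 := abs_nonneg c₂
    have g7 := neg_abs_le c₁
    have g8 := le_abs_self c₂
    refine ⟨⟨?_, ?_⟩, ⟨?_, ?_⟩⟩ <;> simp only
    · have : -(X : ℝ) ≤ m := by linarith [hv.1]
      exact_mod_cast this
    · have : (m : ℝ) ≤ X := by linarith [hv.2]
      exact_mod_cast this
    · exact_mod_cast hn3.1
    · exact_mod_cast hn3.2
  · refine latticeConnected_of_rows ?_ ?_
    · rintro m m' k n ⟨hm, hmN⟩ ⟨hm', _⟩ hk hk'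
      refine ⟨?_, hmN⟩
      rw [hmem] at hm hm' ⊢
      have g1 : (m : ℝ) ≤ k := by exact_mod_cast hk
      have g2 : (k : ℝ) ≤ m' := by exact_mod_cast hk'
      exact ⟨by linarith [hm.1], by linarith [hm'.2]⟩
    · rintro v ⟨-, hv⟩ w ⟨-, hw⟩ n hn hn'
      have hN1 : N ≤ τ * n := by rcases hτ with h | h <;> rw [h] at hv hw ⊢ <;> omega
      have hN2 : N ≤ τ * (n + 1) := by rcases hτ with h | h <;> rw [h] at hv hw ⊢ <;> omega
      have hw1 := hwide n hN1
      -- The larger of the left ends of the two rows; the columns `⌊L⌋ + 1` and `⌊L⌋ + 2` lie in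
      -- both.
      set L := max (c₁ - b₁ * n) (c₁ - b₁ * (n + 1)) with hL
      have hL1 : c₁ - b₁ * n ≤ L := le_max_left _ _
      have hL2 : c₁ - b₁ * (n + 1) ≤ L := le_max_right _ _
      have hL3 : L ≤ c₁ - b₁ * n + |b₁| := by
        refine max_le ?_ ?_
        · linarith [abs_nonneg b₁]
        · linarith [neg_abs_le b₁]
      have hR : c₂ - b₂ * n - |b₂| ≤ c₂ - b₂ * (n + 1) := by linarith [le_abs_self b₂]
      have hf1 := Int.lt_floor_add_one L
      have hf2 := Int.floor_le L
      have hb := abs_nonneg b₂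
      refine ⟨⌊L⌋ + 1, ⟨?_, hN1⟩, ⟨?_, hN1⟩, ⟨?_, hN2⟩, ⟨?_, hN2⟩⟩ <;> rw [hmem] <;> push_cast <;>
        constructor <;> linarith
  · have hc : {v | v ∈ wedge α₁ β₁ γ₁ α₂ β₂ γ₂ ∧ N ≤ τ * v.2}ᶜ = (wedge α₁ β₁ γ₁ α₂ β₂ γ₂)ᶜ ∪
        {v : Vertex | (0 : ℝ) * v.1 + τ * v.2 ≤ N - 1} := by
      ext v
      simp only [Set.mem_compl_iff, Set.mem_ofPred_eq, not_and_or, not_le, Set.mem_union, zero_mul,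
        zero_add]
      refine or_congr Iff.rfl ?_
      rw [← Int.le_sub_one_iff]
      exact_mod_cast Iff.rfl
    rw [hc]
    refine (latticeConnected_compl_wedge γ₁ γ₂ h₁ h₂).union (latticeConnected_halfPlane _ _ _) ?_
    obtain ⟨m, hm⟩ := exists_int_lt (c₁ - b₁ * (τ * (N - 1) : ℤ))
    refine ⟨(m, τ * (N - 1)), ?_, ?_⟩
    · rw [Set.mem_compl_iff, hmem]
      exact fun h => lt_asymm h.1 hm
    · simp only [Set.mem_ofPred_eq, zero_mul, zero_add]
      push_cast
      rw [← mul_assoc, hτ2, one_mul]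

/-- If `α₁` and `α₂` have the same weak sign, the rows are unbounded on a common side and nothing
has to be removed. For opposite signs the rows are bounded, and the narrow tip may be disconnected.
-/
theorem exists_connected_wedge {α₁ β₁ α₂ β₂ : ℝ} (γ₁ γ₂ : ℝ) {p : Vertex}
    (h₁ : 0 < α₁ * p.1 + β₁ * p.2) (h₂ : 0 < α₂ * p.1 + β₂ * p.2) :
    ∃ M ⊆ wedge α₁ β₁ γ₁ α₂ β₂ γ₂, (wedge α₁ β₁ γ₁ α₂ β₂ γ₂ \ M).Finite ∧
      LatticeConnected M ∧ LatticeConnected Mᶜ := by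
  have hdirect : ∀ σ : ℤ, σ * σ = 1 → 0 ≤ σ * α₁ → 0 ≤ σ * α₂ →
      ∃ M ⊆ wedge α₁ β₁ γ₁ α₂ β₂ γ₂, (wedge α₁ β₁ γ₁ α₂ β₂ γ₂ \ M).Finite ∧
        LatticeConnected M ∧ LatticeConnected Mᶜ := fun σ hσ h1 h2 =>
    ⟨_, subset_rfl, by simp, latticeConnected_of_upper (P₁ := fun x => γ₁ < x)
      (P₂ := fun x => γ₂ < x) hσ (fun _ _ h h' => h.trans_le h') (fun _ _ h h' => h.trans_le h') h1 h2,
      latticeConnected_compl_wedge γ₁ γ₂ h₁ h₂⟩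
  rcases lt_trichotomy α₁ 0 with g1 | g1 | g1
  · rcases le_or_gt α₂ 0 with g2 | g2
    · exact hdirect (-1) (by norm_num) (by push_cast; linarith) (by push_cast; linarith)
    · rw [wedge_comm]
      exact exists_connected_of_bounded_rows γ₂ γ₁ h₂ h₁ g2 g1
  · rcases le_total α₂ 0 with g2 | g2
    · exact hdirect (-1) (by norm_num) (by push_cast; linarith) (by push_cast; linarith)
    · exact hdirect 1 (by norm_num) (by push_cast; linarith) (by push_cast; linarith)
  · rcases le_or_gt 0 α₂ with g2 | g2
    · exact hdirect 1 (by norm_num) (by push_cast; linarith) (by push_cast; linarith)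
    · exact exists_connected_of_bounded_rows γ₁ γ₂ h₁ h₂ g1 g2

/-! ### Directions of cones -/

theorem toPlane_add (v w : Vertex) : toPlane (v + w) = toPlane v + toPlane w := by
  apply Complex.ext <;> simp [toPlane]

theorem toPlane_neg (v : Vertex) : toPlane (-v) = -toPlane v := by
  apply Complex.ext <;> simp [toPlane]

theorem toPlane_zero : toPlane 0 = 0 := by
  apply Complex.ext <;> simp [toPlane]

theorem toPlane_nsmul (n : ℕ) (v : Vertex) : toPlane (n • v) = n * toPlane v := by
  apply Complex.ext <;> simp [toPlane]

namespace Cone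

/-- The cone, translated to the origin. -/
def dirs (Λ : Cone) : Set ℂ := {z | ‖z‖ * Real.cos Λ.angle < (conj Λ.axis * z).re}

theorem mem_region_iff {Λ : Cone} {z : ℂ} : z ∈ Λ.region ↔ z - Λ.apex ∈ Λ.dirs := Iff.rfl

theorem dirs_translate (Λ : Cone) (x : ℤ × ℤ) : (Λ.translate x).dirs = Λ.dirs := rfl

theorem apex_translate (Λ : Cone) (x : ℤ × ℤ) : (Λ.translate x).apex = Λ.apex + toPlane x := rfl

theorem cos_angle_nonneg {Λ : Cone} (hΛ : Λ.angle ≤ Real.pi / 2) : 0 ≤ Real.cos Λ.angle :=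
  Real.cos_nonneg_of_neg_pi_div_two_le_of_le (by linarith [Λ.angle_pos, Real.pi_pos]) hΛ

theorem sin_angle_pos (Λ : Cone) : 0 < Real.sin Λ.angle :=
  Real.sin_pos_of_pos_of_lt_pi Λ.angle_pos Λ.angle_lt

/-- The triangle inequality may be multiplied by the cosine because it is nonnegative: convexity of
the cone enters here. -/
theorem add_mem_dirs {Λ : Cone} (hΛ : Λ.angle ≤ Real.pi / 2) {z w : ℂ} (hz : z ∈ Λ.dirs)
    (hw : w ∈ Λ.dirs) : z + w ∈ Λ.dirs := by
  have hc := cos_angle_nonneg hΛ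
  have h1 : ‖z‖ * Real.cos Λ.angle < (conj Λ.axis * z).re := hz
  have h2 : ‖w‖ * Real.cos Λ.angle < (conj Λ.axis * w).re := hw
  change ‖z + w‖ * Real.cos Λ.angle < (conj Λ.axis * (z + w)).re
  rw [mul_add, Complex.add_re]
  have := mul_le_mul_of_nonneg_right (norm_add_le z w) hc
  linarith

theorem smul_mem_dirs {Λ : Cone} {z : ℂ} (hz : z ∈ Λ.dirs) {r : ℝ} (hr : 0 < r) :
    (r : ℂ) * z ∈ Λ.dirs := by
  have h1 : ‖z‖ * Real.cos Λ.angle < (conj Λ.axis * z).re := hz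
  change ‖(r : ℂ) * z‖ * Real.cos Λ.angle < (conj Λ.axis * ((r : ℂ) * z)).re
  rw [norm_mul, Complex.norm_real, Real.norm_eq_abs, abs_of_pos hr,
    show conj Λ.axis * ((r : ℂ) * z) = (r : ℂ) * (conj Λ.axis * z) by ring, Complex.re_ofReal_mul,
    mul_assoc]
  exact mul_lt_mul_of_pos_left h1 hr

theorem isOpen_dirs (Λ : Cone) : IsOpen Λ.dirs :=
  isOpen_lt (by fun_prop) (by fun_prop)

theorem axis_mem_dirs (Λ : Cone) : Λ.axis ∈ Λ.dirs := by
  have hc : Real.cos Λ.angle < 1 := by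
    have := Real.cos_lt_cos_of_nonneg_of_le_pi le_rfl Λ.angle_lt.le Λ.angle_pos
    simpa using this
  change ‖Λ.axis‖ * Real.cos Λ.angle < (conj Λ.axis * Λ.axis).re
  rw [← Complex.normSq_eq_conj_mul_self, Complex.normSq_eq_norm_sq, Λ.norm_axis]
  simpa using hc

theorem zero_notMem_dirs (Λ : Cone) : (0 : ℂ) ∉ Λ.dirs := by
  simp [dirs]

theorem exists_toPlane_mem_dirs (Λ : Cone) : ∃ p : Vertex, toPlane p ∈ Λ.dirs := by
  obtain ⟨x, hx⟩ := ({ Λ with apex := 0 } : Cone).exists_translate 0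
  refine ⟨-x, ?_⟩
  have : toPlane 0 - (0 + toPlane x) ∈ Λ.dirs := hx
  rwa [toPlane_zero, zero_add, zero_sub, ← toPlane_neg] at this

/-- Write `w + n p = n (p + w / n)`; the directions form an open set that is stable under positive
scaling. -/
theorem eventually_add_mem_dirs {Λ : Cone} {p : ℂ} (hp : p ∈ Λ.dirs) (w : ℂ) :
    ∀ᶠ n : ℕ in atTop, w + n * p ∈ Λ.dirs := by
  have hlim : Tendsto (fun n : ℕ => p + (n : ℂ)⁻¹ * w) atTop (𝓝 p) := by
    have := (tendsto_inv_atTop_nhds_zero_nat (𝕜 := ℂ)).mul_const w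
    simpa using this.const_add p
  filter_upwards [hlim (Λ.isOpen_dirs.mem_nhds hp), eventually_gt_atTop 0] with n hn hn0
  have h1 := smul_mem_dirs (Λ := Λ) hn (r := n) (by exact_mod_cast hn0)
  have : (n : ℂ) ≠ 0 := by exact_mod_cast hn0.ne'
  convert h1 using 1
  push_cast
  field_simp
  ring

theorem region_subset_of_dirs {N M : Cone} (hM : M.angle ≤ Real.pi / 2) (h : N.dirs ⊆ M.dirs)
    (hw : N.apex - M.apex ∈ M.dirs) : N.region ⊆ M.region := by
  intro z hz
  have := add_mem_dirs hM (h hz) hw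
  rw [mem_region_iff]
  convert this using 1
  ring

theorem region_subset_of_apex_eq {N M : Cone} (h : N.dirs ⊆ M.dirs)
    (hw : N.apex = M.apex) : N.region ⊆ M.region := by
  intro z hz
  have h1 : z - N.apex ∈ N.dirs := hz
  rw [hw] at h1
  exact h h1

theorem eventually_translate_subset {N M : Cone} (hM : M.angle ≤ Real.pi / 2)
    (h : N.dirs ⊆ M.dirs) {p : Vertex} (hp : toPlane p ∈ M.dirs) :
    ∀ᶠ n : ℕ in atTop, (N.translate (n • p)).region ⊆ M.region := by
  filter_upwards [eventually_add_mem_dirs hp (N.apex - M.apex)] with n hn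
  refine region_subset_of_dirs hM h ?_
  rw [apex_translate, toPlane_nsmul]
  convert hn using 1
  ring

theorem eventually_subset_translate {N M : Cone} (hM : M.angle ≤ Real.pi / 2)
    (h : N.dirs ⊆ M.dirs) {p : Vertex} (hp : toPlane p ∈ M.dirs) :
    ∀ᶠ n : ℕ in atTop, N.region ⊆ (M.translate (-(n • p))).region := by
  filter_upwards [eventually_add_mem_dirs hp (N.apex - M.apex)] with n hn
  refine region_subset_of_dirs (by exact hM) h ?_
  rw [apex_translate, toPlane_neg, toPlane_nsmul]
  change _ ∈ M.dirs
  convert hn using 1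
  ring

theorem eventually_mem_translate {M : Cone} {p : Vertex} (hp : toPlane p ∈ M.dirs) (z : ℂ) :
    ∀ᶠ n : ℕ in atTop, z ∈ (M.translate (-(n • p))).region := by
  filter_upwards [eventually_add_mem_dirs hp (z - M.apex)] with n hn
  change z - (M.apex + toPlane (-(n • p))) ∈ M.dirs
  rw [toPlane_neg, toPlane_nsmul]
  convert hn using 1
  ring

theorem translate_region_mono {N M : Cone} (h : N.region ⊆ M.region) (x : ℤ × ℤ) :
    (N.translate x).region ⊆ (M.translate x).region := by
  intro z hz
  have h1 : z - toPlane x ∈ N.region := by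
    have : z - (N.apex + toPlane x) ∈ N.dirs := hz
    rw [mem_region_iff]
    convert this using 1
    ring
  have h2 : z - toPlane x - M.apex ∈ M.dirs := h h1
  change z - (M.apex + toPlane x) ∈ M.dirs
  convert h2 using 1
  ring

theorem translate_translate (Λ : Cone) (x y : ℤ × ℤ) :
    (Λ.translate x).translate y = Λ.translate (x + y) := by
  simp only [translate, toPlane_add, add_assoc]

theorem vertices_mono {N M : Cone} (h : N.region ⊆ M.region) : N.vertices ⊆ M.vertices :=
  fun _ hv => h hv

/-- Both inequalities force a positive real part and can be squared; they then agree by sin² + cos²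
= 1. The right side is a pair of linear inequalities, hence a wedge. -/
theorem mem_dirs_iff {Λ : Cone} (hΛ : Λ.angle ≤ Real.pi / 2) {z : ℂ} : z ∈ Λ.dirs ↔
    |(conj Λ.axis * z).im| * Real.cos Λ.angle < (conj Λ.axis * z).re * Real.sin Λ.angle := by
  have hc := cos_angle_nonneg hΛ
  have hs := Λ.sin_angle_pos
  have hcs := Real.sin_sq_add_cos_sq Λ.angle
  have hn : ‖z‖ = ‖conj Λ.axis * z‖ := by rw [norm_mul, Complex.norm_conj, Λ.norm_axis, one_mul]
  change ‖z‖ * Real.cos Λ.angle < (conj Λ.axis * z).re ↔ _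
  rw [hn]
  generalize conj Λ.axis * z = w
  set c := Real.cos Λ.angle
  set s := Real.sin Λ.angle
  have hsq : ‖w‖ ^ 2 = w.re ^ 2 + w.im ^ 2 := by
    rw [← Complex.normSq_eq_norm_sq, Complex.normSq_apply]; ring
  have him := sq_abs w.im
  constructor
  · intro h
    have hx : 0 < w.re := lt_of_le_of_lt (by positivity) h
    have h2 : (‖w‖ * c) ^ 2 < w.re ^ 2 := pow_lt_pow_left₀ h (by positivity) two_ne_zero
    refine lt_of_pow_lt_pow_left₀ 2 (by positivity) ?_
    rw [mul_pow, mul_pow, him]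
    rw [mul_pow, hsq] at h2
    nlinarith
  · intro h
    have hx : 0 < w.re := by
      have : 0 < w.re * s := lt_of_le_of_lt (by positivity) h
      by_contra hcon
      nlinarith
    have h2 : (|w.im| * c) ^ 2 < (w.re * s) ^ 2 := pow_lt_pow_left₀ h (by positivity) two_ne_zero
    refine lt_of_pow_lt_pow_left₀ 2 hx.le ?_
    rw [mul_pow, hsq]
    rw [mul_pow, mul_pow, him] at h2
    nlinarith

theorem vertices_eq_wedge {Λ : Cone} (hΛ : Λ.angle ≤ Real.pi / 2) : ∃ α₁ β₁ γ₁ α₂ β₂ γ₂ : ℝ,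
    Λ.vertices = wedge α₁ β₁ γ₁ α₂ β₂ γ₂ ∧
      ∃ p : Vertex, 0 < α₁ * p.1 + β₁ * p.2 ∧ 0 < α₂ * p.1 + β₂ * p.2 := by
  set c := Real.cos Λ.angle with hcdef
  set s := Real.sin Λ.angle with hsdef
  set a := Λ.axis
  have hc : 0 ≤ c := cos_angle_nonneg hΛ
  have key : ∀ z : ℂ, z ∈ Λ.dirs ↔
      0 < (s * a.re + c * a.im) * z.re + (s * a.im - c * a.re) * z.im ∧
      0 < (s * a.re - c * a.im) * z.re + (s * a.im + c * a.re) * z.im := by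
    intro z
    rw [mem_dirs_iff hΛ, ← hcdef, ← hsdef]
    have : |(conj a * z).im| * c = |(conj a * z).im * c| := by rw [abs_mul, abs_of_nonneg hc]
    rw [this, abs_lt]
    simp only [Complex.mul_re, Complex.mul_im, Complex.conj_re, Complex.conj_im]
    constructor
    · rintro ⟨h1, h2⟩
      constructor <;> nlinarith
    · rintro ⟨h1, h2⟩
      constructor <;> nlinarith
  refine ⟨s * a.re + c * a.im, s * a.im - c * a.re, (s * a.re + c * a.im) * Λ.apex.re +
    (s * a.im - c * a.re) * Λ.apex.im, s * a.re - c * a.im, s * a.im + c * a.re,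
    (s * a.re - c * a.im) * Λ.apex.re + (s * a.im + c * a.re) * Λ.apex.im, ?_, ?_⟩
  · ext v
    change toPlane v - Λ.apex ∈ Λ.dirs ↔ _
    rw [key]
    simp only [wedge, Set.mem_ofPred_eq, toPlane, Complex.sub_re, Complex.sub_im]
    refine and_congr ?_ ?_ <;> constructor <;> intro h <;> linarith
  · obtain ⟨p, hp⟩ := Λ.exists_toPlane_mem_dirs
    exact ⟨p, (key _).1 hp⟩

end Cone

/-- **Haag duality** for convex cones. -/
theorem GNS.haag_duality {G : GNS ω H} (hω : IsGroundState ω) {Λ : Cone}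
    (hΛ : Λ.angle ≤ Real.pi / 2) {T : H →L[ℂ] H} (hT : G.CommutesWith Λ.verticesᶜ T) :
    T ∈ G.vonNeumann Λ.vertices := by
  obtain ⟨α₁, β₁, γ₁, α₂, β₂, γ₂, hv, p, h1, h2⟩ := Cone.vertices_eq_wedge hΛ
  rw [hv] at hT ⊢
  obtain ⟨M, hM, hfin, hc, hc'⟩ := exists_connected_wedge γ₁ γ₂ h1 h2
  exact haag_duality_of_finite hω hM hfin hc hc' hT

/-! ### The bicommutant theorem -/

/-- The operator that acts as `a` on every summand. -/
def amplify (n : ℕ) (a : H →L[ℂ] H) :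
    PiLp 2 (fun _ : Fin n => H) →L[ℂ] PiLp 2 (fun _ : Fin n => H) :=
  ((PiLp.continuousLinearEquiv 2 ℂ (fun _ : Fin n => H)).symm : _ →L[ℂ] _) ∘L
    ContinuousLinearMap.pi fun i => a ∘L PiLp.proj 2 (fun _ : Fin n => H) i

/-- The inclusion of a summand. -/
def summand {n : ℕ} (j : Fin n) : H →L[ℂ] PiLp 2 (fun _ : Fin n => H) :=
  ((PiLp.continuousLinearEquiv 2 ℂ (fun _ : Fin n => H)).symm : _ →L[ℂ] _) ∘L
    ContinuousLinearMap.single ℂ (fun _ : Fin n => H) j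

theorem amplify_apply {n : ℕ} (a : H →L[ℂ] H) (v : PiLp 2 (fun _ : Fin n => H)) (i : Fin n) :
    amplify n a v i = a (v i) := rfl

theorem summand_apply {n : ℕ} (j : Fin n) (ξ : H) (i : Fin n) :
    (summand j ξ : PiLp 2 (fun _ : Fin n => H)) i = if i = j then ξ else 0 := by
  have : (summand j ξ : PiLp 2 (fun _ : Fin n => H)) i = Pi.single (M := fun _ => H) j ξ i := rfl
  rw [this, Pi.single_apply]

theorem sum_summand {n : ℕ} (v : PiLp 2 (fun _ : Fin n => H)) : ∑ j, summand j (v j) = v := by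
  ext i
  rw [WithLp.ofLp_sum, Finset.sum_apply]
  simp [summand_apply]

theorem amplify_summand {n : ℕ} (a : H →L[ℂ] H) (j : Fin n) (ξ : H) :
    amplify n a (summand j ξ) = summand j (a ξ) := by
  ext i
  rw [amplify_apply, summand_apply, summand_apply]
  split_ifs
  · rfl
  · exact map_zero a

theorem inner_amplify {n : ℕ} (a : H →L[ℂ] H) (v w : PiLp 2 (fun _ : Fin n => H)) :
    inner ℂ v (amplify n a w) = inner ℂ (amplify n (star a) v) w := by
  rw [PiLp.inner_apply, PiLp.inner_apply]
  refine Finset.sum_congr rfl fun i _ => ?_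
  rw [amplify_apply, amplify_apply, ContinuousLinearMap.star_eq_adjoint,
    ContinuousLinearMap.adjoint_inner_left]

/-- The bicommutant of a self-adjoint unital algebra is contained in its strong closure. -/
theorem exists_approx_of_bicommutant {A : StarSubalgebra ℂ (H →L[ℂ] H)} {b : H →L[ℂ] H}
    (hb : ∀ T : H →L[ℂ] H, (∀ a ∈ A, Commute T a) → Commute T b) {n : ℕ} (ξ : Fin n → H)
    {ε : ℝ} (hε : 0 < ε) : ∃ a ∈ A, ∀ i, ‖a (ξ i) - b (ξ i)‖ < ε := by
  set X : PiLp 2 (fun _ : Fin n => H) := WithLp.toLp 2 ξ with hX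
  let orbit : (H →L[ℂ] H) →ₗ[ℂ] PiLp 2 (fun _ : Fin n => H) :=
    { toFun := fun a => amplify n a X
      map_add' := fun a a' => rfl
      map_smul' := fun c a => rfl }
  -- Von Neumann's argument: the projection onto the closed orbit of `X` commutes with the amplified
  -- algebra. Its matrix entries therefore lie in the commutant of `A`, so they commute with `b`,
  -- and the amplified `b` maps `X` into the closed orbit.
  set M := (A.toSubalgebra.toSubmodule.map orbit).topologicalClosure with hM
  have : CompleteSpace M := (Submodule.isClosed_topologicalClosure _).completeSpace_coe
  have hinv : ∀ a ∈ A, ∀ v ∈ M, amplify n a v ∈ M := by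
    intro a ha v hv
    refine map_mem_closure (f := amplify n a) (amplify n a).continuous hv ?_
    rintro _ ⟨a', ha', rfl⟩
    have ha'' : a' ∈ A := ha'
    exact ⟨a * a', (mul_mem ha ha'' : a * a' ∈ A), rfl⟩
  have hP : ∀ a ∈ A, ∀ v, M.starProjection (amplify n a v) = amplify n a (M.starProjection v) := by
    intro a ha v
    refine Submodule.eq_starProjection_of_mem_of_inner_eq_zero
      (hinv a ha _ (M.starProjection_apply_mem v)) fun w hw => ?_
    rw [← map_sub, inner_eq_zero_symm, inner_amplify]
    exact Submodule.inner_right_of_mem_orthogonal (hinv _ (star_mem ha) w hw)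
      (M.sub_starProjection_mem_orthogonal v)
  have hentry : ∀ i j : Fin n, Commute (PiLp.proj 2 (fun _ : Fin n => H) i ∘L M.starProjection ∘L
      summand j : H →L[ℂ] H) b := by
    intro i j
    refine hb _ fun a ha => ?_
    ext ζ
    change M.starProjection (summand j (a ζ)) i = a (M.starProjection (summand j ζ) i)
    rw [← amplify_summand, hP a ha, amplify_apply]
  have hPb : ∀ v, M.starProjection (amplify n b v) = amplify n b (M.starProjection v) := by
    intro v
    rw [← sum_summand v]
    simp only [map_sum, amplify_summand]
    refine Finset.sum_congr rfl fun j _ => ?_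
    ext i
    exact congrArg (fun T : H →L[ℂ] H => T (v j)) (hentry i j).eq
  have hXM : X ∈ M := Submodule.le_topologicalClosure _ ⟨1, one_mem A, by ext i; rfl⟩
  have hbX : amplify n b X ∈ M := by
    have h := hPb X
    rw [Submodule.starProjection_eq_self_iff.2 hXM] at h
    rw [← h]
    exact M.starProjection_apply_mem _
  obtain ⟨_, ⟨a, ha, rfl⟩, hdist⟩ := Metric.mem_closure_iff.1 hbX ε hε
  refine ⟨a, ha, fun i => lt_of_le_of_lt ?_ hdist⟩
  rw [dist_comm, dist_eq_norm]
  exact PiLp.norm_apply_le (orbit a - amplify n b X) i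

/-! ### Locality of observables -/

theorem pauliX_commute_pauliX (v w : Vertex) : Commute (pauliX v) (pauliX w) := by
  rw [← opX_singleton, ← opX_singleton, commute_iff_eq, opX_mul, opX_mul, symmDiff_comm]

theorem pauliZ_commute_pauliZ (v w : Vertex) : Commute (pauliZ v) (pauliZ w) := by
  rw [← opZ_singleton, ← opZ_singleton, commute_iff_eq, opZ_mul, opZ_mul, symmDiff_comm]

theorem pauliX_commute_pauliZ {v w : Vertex} (h : v ≠ w) : Commute (pauliX v) (pauliZ w) := by
  rw [← opX_singleton, ← opZ_singleton, commute_iff_eq, opX_mul_opZ,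
    sgn_of_disjoint (by simpa using h), one_smul]

theorem commute_of_commute_pauli {Λ : Set Vertex} {c : QuasiLocal}
    (hX : ∀ v ∈ Λ, Commute c (pauliX v)) (hZ : ∀ v ∈ Λ, Commute c (pauliZ v)) (a : QuasiLocal)
    (ha : (a : Config →L[ℂ] Config) ∈ localAlgebra Λ) : Commute c a := by
  refine localAlgebra_induction (P := fun a => Commute c a) ?_ hX hZ ?_ ?_ ?_ a ha
  · exact isClosed_eq (by fun_prop) (by fun_prop)
  · exact fun r => (Algebra.commutes r c).symm
  · exact fun a b ha hb => ha.add_right hb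
  · exact fun a b ha hb => ha.mul_right hb

/-- Observables in disjoint regions commute. -/
theorem commute_of_disjoint {Λ M : Set Vertex} (h : Disjoint Λ M) {a b : QuasiLocal}
    (ha : (a : Config →L[ℂ] Config) ∈ localAlgebra Λ)
    (hb : (b : Config →L[ℂ] Config) ∈ localAlgebra M) : Commute a b := by
  have hne : ∀ v ∈ Λ, ∀ w ∈ M, v ≠ w := fun v hv w hw e => Set.disjoint_left.1 h hv (e ▸ hw)
  refine commute_of_commute_pauli (fun w hw => ?_) (fun w hw => ?_) b hb
  · exact (commute_of_commute_pauli (fun v _ => pauliX_commute_pauliX w v)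
      (fun v hv => pauliX_commute_pauliZ (hne v hv w hw).symm) a ha).symm
  · exact (commute_of_commute_pauli (fun v hv => (pauliX_commute_pauliZ (hne v hv w hw)).symm)
      (fun v _ => pauliZ_commute_pauliZ w v) a ha).symm

/-! ### Approximation in cone algebras and in the auxiliary algebra -/

namespace GNS

variable {G : GNS ω H} {Λ₀ : Cone}

theorem vonNeumann_le_aux (x : ℤ × ℤ) :
    G.vonNeumann (Λ₀.translate x).vertices ≤ G.aux Λ₀ :=
  (le_iSup (fun x => G.vonNeumann (Λ₀.translate x).vertices) x).trans
    (StarSubalgebra.le_topologicalClosure _)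

theorem isClosed_aux (G : GNS ω H) (Λ₀ : Cone) : IsClosed (G.aux Λ₀ : Set (H →L[ℂ] H)) :=
  StarSubalgebra.isClosed_topologicalClosure _

theorem exists_common_translate (hΛ₀ : Λ₀.angle ≤ Real.pi / 2) (x y : ℤ × ℤ) : ∃ z : ℤ × ℤ,
    (Λ₀.translate x).region ⊆ (Λ₀.translate z).region ∧
      (Λ₀.translate y).region ⊆ (Λ₀.translate z).region := by
  obtain ⟨p, hp⟩ := Λ₀.exists_toPlane_mem_dirs
  have h (x : ℤ × ℤ) := Cone.eventually_subset_translate (N := Λ₀.translate x) (M := Λ₀) hΛ₀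
    subset_rfl hp
  obtain ⟨n, h1, h2⟩ := ((h x).and (h y)).exists
  exact ⟨_, h1, h2⟩

theorem exists_approx_aux (hΛ₀ : Λ₀.angle ≤ Real.pi / 2) {b : H →L[ℂ] H} (hb : b ∈ G.aux Λ₀)
    {ε : ℝ} (hε : 0 < ε) :
    ∃ x : ℤ × ℤ, ∃ c ∈ G.vonNeumann (Λ₀.translate x).vertices, ‖b - c‖ < ε := by
  have hdir : Directed (· ≤ ·) fun x : ℤ × ℤ => G.vonNeumann (Λ₀.translate x).vertices := by
    intro x y
    obtain ⟨z, h1, h2⟩ := exists_common_translate hΛ₀ x y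
    exact ⟨z, vonNeumann_mono (Cone.vertices_mono h1), vonNeumann_mono (Cone.vertices_mono h2)⟩
  obtain ⟨c, hc, hd⟩ := Metric.mem_closure_iff.1 hb ε hε
  rw [StarSubalgebra.coe_iSup_of_directed hdir, Set.mem_iUnion] at hc
  obtain ⟨x, hx⟩ := hc
  exact ⟨x, c, hx, by rwa [dist_eq_norm] at hd⟩

/-- Elements of `π₀(𝒜(Λ))''` are strong limits of elements of `π₀(𝒜(Λ))`. -/
theorem exists_net {Λ : Set Vertex} {b : H →L[ℂ] H} (hb : b ∈ G.vonNeumann Λ) :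
    ∃ u : Finset H × ℕ → QuasiLocal, (∀ i, (u i : Config →L[ℂ] Config) ∈ localAlgebra Λ) ∧
      ∀ η : H, Tendsto (fun i => G.rep (u i) η) atTop (𝓝 (b η)) := by
  let A : StarSubalgebra ℂ (H →L[ℂ] H) :=
    ((localAlgebra Λ).comap (localAlgebra Set.univ).subtype).map G.rep
  have hA : ∀ T : H →L[ℂ] H, (∀ a ∈ A, Commute T a) → Commute T b := fun T hT =>
    mem_vonNeumann_iff.1 hb T (commutesWith_iff.2 fun a ha => hT _ ⟨a, ha, rfl⟩)
  -- The index `(F, n)` asks for an error below `1 / (n + 1)` on the vectors in `F`, so the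
  -- resulting net converges strongly.
  have key : ∀ i : Finset H × ℕ, ∃ a : QuasiLocal, (a : Config →L[ℂ] Config) ∈ localAlgebra Λ ∧
      ∀ η ∈ i.1, ‖G.rep a η - b η‖ < 1 / ((i.2 : ℝ) + 1) := by
    rintro ⟨F, n⟩
    obtain ⟨_, ⟨a, ha, rfl⟩, h⟩ := exists_approx_of_bicommutant hA
      (fun i => (F.equivFin.symm i : H)) (ε := 1 / ((n : ℝ) + 1)) Nat.one_div_pos_of_nat
    refine ⟨a, ha, fun η hη => ?_⟩
    have := h (F.equivFin ⟨η, hη⟩)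
    rwa [Equiv.symm_apply_apply] at this
  choose u hu hu' using key
  refine ⟨u, hu, fun η => ?_⟩
  rw [tendsto_iff_norm_sub_tendsto_zero]
  have hlim : Tendsto (fun i : Finset H × ℕ => 1 / ((i.2 : ℝ) + 1)) atTop (𝓝 0) :=
    tendsto_one_div_add_atTop_nhds_zero_nat.comp
      (by rw [← prod_atTop_atTop_eq]; exact tendsto_snd)
  refine squeeze_zero' (Eventually.of_forall fun _ => norm_nonneg _) ?_ hlim
  filter_upwards [eventually_ge_atTop ({η}, 0)] with i hi
  exact (hu' i η (hi.1 (Finset.mem_singleton_self η))).le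

theorem continuous_endo (e : G.aux Λ₀ →⋆ₐ[ℂ] G.aux Λ₀) : Continuous e :=
  haveI := isClosed_aux G Λ₀
  AddMonoidHomClass.continuous_of_bound e 1
    (fun b => by simpa using NonUnitalStarAlgHom.norm_apply_le e b)

/-- Two continuous functions on `𝒜ᵃᵘ` agree if they agree on the cone algebras. -/
theorem aux_induction (hΛ₀ : Λ₀.angle ≤ Real.pi / 2) {P : G.aux Λ₀ → Prop}
    (hP : IsClosed {b | P b})
    (h : ∀ x : ℤ × ℤ, ∀ b : G.aux Λ₀, (b : H →L[ℂ] H) ∈ G.vonNeumann (Λ₀.translate x).vertices → P b)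
    (b : G.aux Λ₀) : P b := by
  have : b ∈ closure {b | P b} := by
    rw [Metric.mem_closure_iff]
    intro ε hε
    obtain ⟨x, c, hc, hbc⟩ := exists_approx_aux hΛ₀ b.2 hε
    refine ⟨⟨c, vonNeumann_le_aux x hc⟩, h x _ hc, ?_⟩
    rw [Subtype.dist_eq, dist_eq_norm]
    exact hbc
  rwa [hP.closure_eq] at this

/-! ### Unitary implementers -/

/-- The representation `π` of `𝒜(Λ)` is implemented by the unitary `V`. -/
def Implements (G : GNS ω H) (π : QuasiLocal →⋆ₐ[ℂ] (H →L[ℂ] H)) (Λ : Set Vertex)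
    (V : H →L[ℂ] H) : Prop :=
  V ∈ unitary (H →L[ℂ] H) ∧
    ∀ a : QuasiLocal, (a : Config →L[ℂ] Config) ∈ localAlgebra Λ → π a = star V * G.rep a * V

theorem Implements.mono {π : QuasiLocal →⋆ₐ[ℂ] (H →L[ℂ] H)} {Λ M : Set Vertex} {V : H →L[ℂ] H}
    (h : G.Implements π M V) (hΛ : Λ ⊆ M) : G.Implements π Λ V :=
  ⟨h.1, fun a ha => h.2 a (localAlgebra_mono hΛ ha)⟩

theorem mul_star_of_unitary {V : H →L[ℂ] H} (hV : V ∈ unitary (H →L[ℂ] H)) (A : H →L[ℂ] H) :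
    V * (star V * A) = A := by rw [← mul_assoc, (Unitary.mem_iff.1 hV).2, one_mul]

theorem star_mul_of_unitary {V : H →L[ℂ] H} (hV : V ∈ unitary (H →L[ℂ] H)) (A : H →L[ℂ] H) :
    star V * (V * A) = A := by rw [← mul_assoc, (Unitary.mem_iff.1 hV).1, one_mul]

theorem LocalizedIn.implements {π : QuasiLocal →⋆ₐ[ℂ] (H →L[ℂ] H)} {N : Cone}
    (h : G.LocalizedIn π N) {Λ : Set Vertex} (hΛ : Disjoint Λ N.vertices) :
    G.Implements π Λ 1 :=
  ⟨one_mem _, fun a ha => by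
    rw [star_one, one_mul, mul_one]
    exact h a (localAlgebra_mono hΛ.subset_compl_right ha)⟩

theorem LocalizedIn.mono {π : QuasiLocal →⋆ₐ[ℂ] (H →L[ℂ] H)} {N M : Cone}
    (h : G.LocalizedIn π N) (hNM : N.region ⊆ M.region) : G.LocalizedIn π M :=
  fun a ha => h a (localAlgebra_mono (Set.compl_subset_compl.2 (Cone.vertices_mono hNM)) ha)

/-- The open half-plane opposite to the axis misses a convex cone with the same apex. -/
theorem exists_disjoint_cone (N : Cone) (hN : N.angle ≤ Real.pi / 2) :
    ∃ M : Cone, Disjoint N.vertices M.vertices := by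
  refine ⟨⟨N.apex, -N.axis, Real.pi / 2, by rw [norm_neg]; exact N.norm_axis, by positivity,
    by linarith [Real.pi_pos]⟩, Set.disjoint_left.2 fun v h1 h2 => ?_⟩
  have h1' : ‖toPlane v - N.apex‖ * Real.cos N.angle < (conj N.axis * (toPlane v - N.apex)).re := h1
  have h2' : ‖toPlane v - N.apex‖ * Real.cos (Real.pi / 2) <
    (conj (-N.axis) * (toPlane v - N.apex)).re := h2
  rw [Real.cos_pi_div_two, mul_zero, map_neg, neg_mul, Complex.neg_re] at h2'
  have := mul_nonneg (norm_nonneg (toPlane v - N.apex)) (Cone.cos_angle_nonneg hN)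
  linarith

/-- Transport `π` to a cone disjoint from `N`; on the observables in `N` the transported
homomorphism is `π₀`. -/
theorem Transportable.exists_implements {π : QuasiLocal →⋆ₐ[ℂ] (H →L[ℂ] H)}
    (h : G.Transportable π) {N : Cone} (hN : N.angle ≤ Real.pi / 2) :
    ∃ V, G.Implements π N.vertices V := by
  obtain ⟨M, hM⟩ := exists_disjoint_cone N hN
  obtain ⟨π', hπ', U, hU, h⟩ := h M
  refine ⟨star U, Unitary.star_mem hU, fun a ha => ?_⟩
  rw [star_star, ← hπ' a (localAlgebra_mono hM.subset_compl_right ha), h, ← mul_assoc, ← mul_assoc,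
    (Unitary.mem_iff.1 hU).2, one_mul, mul_assoc, (Unitary.mem_iff.1 hU).2, mul_one]

/-- Undoing the conjugations on both sides turns the intertwining relation into commutation with
`π₀`. -/
theorem Implements.commutesWith {π π' : QuasiLocal →⋆ₐ[ℂ] (H →L[ℂ] H)} {Λ : Set Vertex}
    {V V' T : H →L[ℂ] H} (h : G.Implements π Λ V) (h' : G.Implements π' Λ V')
    (hT : ∀ a : QuasiLocal, (a : Config →L[ℂ] Config) ∈ localAlgebra Λ → T * π a = π' a * T) :
    G.CommutesWith Λ (V' * T * star V) := by
  refine commutesWith_iff.2 fun a ha => ?_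
  have e := hT a ha
  rw [h.2 a ha, h'.2 a ha] at e
  have e' := congrArg (fun A => V' * A * star V) e
  simp only [mul_assoc, mul_star_of_unitary h'.1] at e'
  rw [(Unitary.mem_iff.1 h.1).2, mul_one] at e'
  rw [commute_iff_eq]
  simpa only [mul_assoc] using e'

/-- Unitaries that implement intertwined representations act in an intertwined way on the weak
closure. -/
theorem Implements.intertwine {π π' : QuasiLocal →⋆ₐ[ℂ] (H →L[ℂ] H)} {Λ : Set Vertex}
    {V V' T : H →L[ℂ] H} (h : G.Implements π Λ V) (h' : G.Implements π' Λ V')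
    (hT : ∀ a : QuasiLocal, (a : Config →L[ℂ] Config) ∈ localAlgebra Λ → T * π a = π' a * T)
    {b : H →L[ℂ] H} (hb : b ∈ G.vonNeumann Λ) :
    T * (star V * b * V) = (star V' * b * V') * T := by
  have e := (mem_vonNeumann_iff.1 hb _ (h.commutesWith h' hT)).eq
  have e' := congrArg (fun A => star V' * A * V) e
  simp only [mul_assoc, star_mul_of_unitary h'.1] at e'
  rw [(Unitary.mem_iff.1 h.1).1, mul_one] at e'
  simpa only [mul_assoc] using e'

/-- The identity intertwines `π` with itself, so the action on the weak closure does not depend on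
the implementing unitary. -/
theorem Implements.conj_eq {π : QuasiLocal →⋆ₐ[ℂ] (H →L[ℂ] H)} {Λ : Set Vertex}
    {V V' : H →L[ℂ] H} (h : G.Implements π Λ V) (h' : G.Implements π Λ V')
    {b : H →L[ℂ] H} (hb : b ∈ G.vonNeumann Λ) : star V * b * V = star V' * b * V' := by
  simpa using h.intertwine h' (T := 1) (fun a _ => by simp) hb

/-- If `π` is localized in `N`, then its weak extension maps cone algebras in `N` to the cone
algebra of `N`. -/
theorem Implements.conj_mem (hω : IsGroundState ω) {π : QuasiLocal →⋆ₐ[ℂ] (H →L[ℂ] H)}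
    {Λ : Set Vertex} {V : H →L[ℂ] H} (h : G.Implements π Λ V) {N : Cone}
    (hN : N.angle ≤ Real.pi / 2) (hloc : G.LocalizedIn π N) (hΛ : Λ ⊆ N.vertices)
    {b : H →L[ℂ] H} (hb : b ∈ G.vonNeumann Λ) : star V * b * V ∈ G.vonNeumann N.vertices := by
  refine haag_duality hω hN (commutesWith_iff.2 fun a ha => ?_)
  have := h.intertwine h (T := G.rep a) (fun c hc => ?_) hb
  · exact this.symm
  · rw [← hloc a ha]
    exact ((commute_of_disjoint (Set.disjoint_compl_left_iff_subset.2 hΛ) ha hc).map π).eq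

end GNS

/-! ### The extension to the auxiliary algebra -/

/-! ### Inclusions of convex cones -/

theorem Cone.norm_mul_cos_le_of_region_subset {N M : Cone} (hM : M.angle ≤ Real.pi / 2)
    (h : N.region ⊆ M.region) {w : ℂ} (hw : w ∈ N.dirs) :
    ‖w‖ * Real.cos M.angle ≤ (conj M.axis * w).re := by
  by_contra! hr
  have hc := Cone.cos_angle_nonneg hM
  set d := ‖w‖ * Real.cos M.angle - (conj M.axis * w).re with hd
  set K := (conj M.axis * (N.apex - M.apex)).re + ‖N.apex - M.apex‖ * Real.cos M.angle with hK
  have hd0 : 0 < d := by linarith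
  -- A ray in a direction that violates the closed condition by `d` loses `s d` at distance
  -- parameter `s`, while the offset of the apexes contributes at most `K`. This `s` is large enough
  -- for the ray to have left `M`.
  set s : ℝ := (|K| + 1) / d with hs
  have hs0 : 0 < s := by positivity
  have hsd : s * d = |K| + 1 := div_mul_cancel₀ _ hd0.ne'
  have hmem : N.apex + s * w ∈ N.region := by
    rw [Cone.mem_region_iff, add_sub_cancel_left]
    exact Cone.smul_mem_dirs hw hs0
  have h1 : ‖N.apex + s * w - M.apex‖ * Real.cos M.angle <
    (conj M.axis * (N.apex + s * w - M.apex)).re := h hmem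
  have h2 : (conj M.axis * (N.apex + s * w - M.apex)).re =
      s * (conj M.axis * w).re + (conj M.axis * (N.apex - M.apex)).re := by
    have : conj M.axis * (N.apex + s * w - M.apex) =
        s * (conj M.axis * w) + conj M.axis * (N.apex - M.apex) := by ring
    rw [this, Complex.add_re, Complex.re_ofReal_mul]
  have h3 : s * ‖w‖ - ‖N.apex - M.apex‖ ≤ ‖N.apex + s * w - M.apex‖ := by
    have := norm_sub_norm_le (s * w) (-(N.apex - M.apex))
    rw [norm_mul, Complex.norm_real, Real.norm_of_nonneg hs0.le, norm_neg] at this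
    rwa [sub_neg_eq_add, show (s : ℂ) * w + (N.apex - M.apex) = N.apex + s * w - M.apex by ring] at this
  have h4 := mul_le_mul_of_nonneg_right h3 hc
  have h5 : s * d = s * (‖w‖ * Real.cos M.angle) - s * (conj M.axis * w).re := by rw [hd]; ring
  have h6 : s * (‖w‖ * Real.cos M.angle) - s * (conj M.axis * w).re < K := by
    rw [hK]
    linarith
  linarith [le_abs_self K]

theorem Cone.re_nonneg_of_region_subset {N M : Cone} (hM : M.angle ≤ Real.pi / 2)
    (h : N.region ⊆ M.region) {w : ℂ} (hw : w ∈ N.dirs) : 0 ≤ (conj M.axis * w).re :=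
  (mul_nonneg (norm_nonneg w) (Cone.cos_angle_nonneg hM)).trans
    (Cone.norm_mul_cos_le_of_region_subset hM h hw)

/-- A cone wider than a half-plane contains the two directions perpendicular to its axis, even after
a slight tilt by `-ε M.axis`. Their sum `-2ε M.axis` points out of `M`, although both have
nonnegative component along the axis of `M`. -/
theorem Cone.angle_le_of_region_subset {N M : Cone} (hM : M.angle ≤ Real.pi / 2)
    (h : N.region ⊆ M.region) : N.angle ≤ Real.pi / 2 := by
  by_contra! hN
  have hc : Real.cos N.angle < 0 :=
    Real.cos_neg_of_pi_div_two_lt_of_lt hN (by linarith [N.angle_lt, Real.pi_pos])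
  have hc1 := Real.neg_one_le_cos N.angle
  set ε : ℝ := -Real.cos N.angle / 3 with hε
  have hε0 : 0 < ε := by linarith
  have key : ∀ j : ℂ, ‖j‖ = 1 → j.re = 0 → j * N.axis - ε * M.axis ∈ N.dirs := by
    intro j hj hj0
    have e : conj N.axis * N.axis = 1 := by
      rw [← Complex.normSq_eq_conj_mul_self, Complex.normSq_eq_norm_sq, N.norm_axis]
      simp
    have h1 : (conj N.axis * (j * N.axis - ε * M.axis)).re = -(ε * (conj N.axis * M.axis).re) := by
      have : conj N.axis * (j * N.axis - ε * M.axis) = j - ε * (conj N.axis * M.axis) := by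
        linear_combination j * e
      rw [this, Complex.sub_re, Complex.re_ofReal_mul, hj0, zero_sub]
    have h2 : (conj N.axis * M.axis).re ≤ 1 := by
      refine (Complex.re_le_norm _).trans ?_
      rw [norm_mul, Complex.norm_conj, N.norm_axis, M.norm_axis, one_mul]
    have h3 : 1 - ε ≤ ‖j * N.axis - ε * M.axis‖ := by
      have := norm_sub_norm_le (j * N.axis) (ε * M.axis)
      rwa [norm_mul, norm_mul, hj, N.norm_axis, M.norm_axis, Complex.norm_real,
        Real.norm_of_nonneg hε0.le, mul_one, mul_one] at this
    change ‖j * N.axis - ε * M.axis‖ * Real.cos N.angle < _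
    rw [h1]
    nlinarith
  have h1 := Cone.re_nonneg_of_region_subset hM h (key Complex.I (by simp) (by simp))
  have h2 := Cone.re_nonneg_of_region_subset hM h (key (-Complex.I) (by simp) (by simp))
  have e : conj M.axis * M.axis = 1 := by
    rw [← Complex.normSq_eq_conj_mul_self, Complex.normSq_eq_norm_sq, M.norm_axis]
    simp
  have h3 : (conj M.axis * (Complex.I * N.axis - ε * M.axis)).re +
      (conj M.axis * (-Complex.I * N.axis - ε * M.axis)).re = -(2 * ε) := by
    rw [← Complex.add_re]
    have : conj M.axis * (Complex.I * N.axis - ε * M.axis) +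
        conj M.axis * (-Complex.I * N.axis - ε * M.axis) = ((-(2 * ε) : ℝ) : ℂ) := by
      push_cast
      linear_combination (-2 * ε : ℂ) * e
    rw [this, Complex.ofReal_re]
  linarith

theorem Cone.FitsIn.angle_le {N Λ₀ : Cone} (h : N.FitsIn Λ₀) (hΛ₀ : Λ₀.angle ≤ Real.pi / 2) :
    N.angle ≤ Real.pi / 2 := by
  obtain ⟨x, hx⟩ := h
  exact Cone.angle_le_of_region_subset (M := Λ₀.translate x) hΛ₀ hx

/-! ### Existence of the extension -/

namespace GNS

variable {G : GNS ω H} {Λ₀ : Cone}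

theorem inner_conj_apply (V A : H →L[ℂ] H) (ξ η : H) :
    inner ℂ ξ ((star V * A * V) η) = inner ℂ (V ξ) (A (V η)) := by
  rw [mul_assoc, mul_apply_eq_comp, mul_apply_eq_comp, ContinuousLinearMap.star_eq_adjoint,
    ContinuousLinearMap.adjoint_inner_right]

theorem intertwine_of_local {φ ψ : QuasiLocal →⋆ₐ[ℂ] (H →L[ℂ] H)} {T : H →L[ℂ] H}
    (h : ∀ v, ∀ a : QuasiLocal, (a : Config →L[ℂ] Config) ∈ localAlgebra {v} → T * φ a = ψ a * T)
    (a : QuasiLocal) : T * φ a = ψ a * T :=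
  intertwine_of_pauli (fun v _ => h v _ (sigmaX_mem (Set.mem_singleton v)))
    (fun v _ => h v _ (sigmaZ_mem (Set.mem_singleton v))) a a.2

theorem eq_of_local {φ ψ : QuasiLocal →⋆ₐ[ℂ] (H →L[ℂ] H)}
    (h : ∀ v, ∀ a : QuasiLocal, (a : Config →L[ℂ] Config) ∈ localAlgebra {v} → φ a = ψ a)
    (a : QuasiLocal) : φ a = ψ a := by
  simpa using intertwine_of_local (φ := φ) (ψ := ψ) (T := 1)
    (fun v a ha => by simpa using h v a ha) a

theorem LocalizedIn.map_mem (hω : IsGroundState ω) {π : QuasiLocal →⋆ₐ[ℂ] (H →L[ℂ] H)} {N : Cone}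
    (hN : N.angle ≤ Real.pi / 2) (hloc : G.LocalizedIn π N) {a : QuasiLocal}
    (ha : (a : Config →L[ℂ] Config) ∈ localAlgebra N.vertices) :
    π a ∈ G.vonNeumann N.vertices := by
  refine haag_duality hω hN (commutesWith_iff.2 fun c hc => ?_)
  rw [← hloc c hc]
  exact (commute_of_disjoint disjoint_compl_right ha hc).map π

theorem LocalizedIn.intertwiner_mem (hω : IsGroundState ω)
    {π π' : QuasiLocal →⋆ₐ[ℂ] (H →L[ℂ] H)} {N : Cone} (hN : N.angle ≤ Real.pi / 2)
    (hπ : G.LocalizedIn π N) (hπ' : G.LocalizedIn π' N) {T : H →L[ℂ] H}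
    (hT : ∀ a, T * π a = π' a * T) : T ∈ G.vonNeumann N.vertices := by
  refine haag_duality hω hN (commutesWith_iff.2 fun c hc => ?_)
  have := hT c
  rwa [hπ c hc, hπ' c hc] at this

theorem exists_common_fitsIn (hΛ₀ : Λ₀.angle ≤ Real.pi / 2) {N M : Cone} (hN : N.FitsIn Λ₀)
    (hM : M.FitsIn Λ₀) (y : ℤ × ℤ) : ∃ z : ℤ × ℤ, N.region ⊆ (Λ₀.translate z).region ∧
      M.region ⊆ (Λ₀.translate z).region ∧
        (Λ₀.translate y).region ⊆ (Λ₀.translate z).region := by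
  obtain ⟨x, hx⟩ := hN
  obtain ⟨x', hx'⟩ := hM
  obtain ⟨z, h1, h2⟩ := exists_common_translate hΛ₀ x x'
  obtain ⟨z', h3, h4⟩ := exists_common_translate hΛ₀ z y
  exact ⟨z', (hx.trans h1).trans h3, (hx'.trans h2).trans h3, h4⟩

/-- Conjugations with unitaries implementing `ρ` on growing translates of `Λ₀` are eventually
constant on each cone algebra. As they are isometric, they converge in norm on the closure `𝒜ᵃᵘ`.
Weak continuity is clear, since on a cone algebra the limit is one fixed conjugation. -/
theorem exists_isExtension (hω : IsGroundState ω) (hΛ₀ : Λ₀.angle ≤ Real.pi / 2) {ρ : G.Endo Λ₀}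
    (hρ : IsSector ρ) : ∃ e, IsExtension ρ e := by
  obtain ⟨N, hN, hloc⟩ := hρ.localized
  obtain ⟨p, hp⟩ := Λ₀.exists_toPlane_mem_dirs
  have hV (x : ℤ × ℤ) := hρ.transportable.exists_implements (N := Λ₀.translate x) hΛ₀
  choose V hV using hV
  let u : ℕ → unitary (H →L[ℂ] H) := fun n => ⟨V (-(n • p)), (hV _).1⟩
  let φ : ℕ → (H →L[ℂ] H) ≃⋆ₐ[ℂ] (H →L[ℂ] H) := fun n => Unitary.conjStarAlgAut ℂ _ (star (u n))
  have hφ : ∀ n b, φ n b = star (V (-(n • p))) * b * V (-(n • p)) := fun n b => by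
    simp only [φ, Unitary.conjStarAlgAut_star_apply]
    rfl
  have hloc' : ∀ y c, c ∈ G.vonNeumann (Λ₀.translate y).vertices →
      star (V y) * c * V y ∈ G.aux Λ₀ ∧ ∀ᶠ n in atTop, φ n c = star (V y) * c * V y := by
    intro y c hc
    refine ⟨?_, ?_⟩
    · obtain ⟨z, h1, -, h2⟩ := exists_common_fitsIn hΛ₀ hN hN y
      rw [(hV y).conj_eq ((hV z).mono (Cone.vertices_mono h2)) hc]
      exact vonNeumann_le_aux z ((hV z).conj_mem hω (N := Λ₀.translate z) hΛ₀ (hloc.mono h1) subset_rfl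
        (vonNeumann_mono (Cone.vertices_mono h2) hc))
    · filter_upwards [Cone.eventually_subset_translate (N := Λ₀.translate y) (M := Λ₀) hΛ₀
        subset_rfl hp] with n hn
      rw [hφ]
      exact ((hV _).mono (Cone.vertices_mono hn)).conj_eq (hV y) hc
  -- Approximation by a cone element gives the Cauchy property and, at the same time, shows that the
  -- limit lies in the closed algebra `𝒜ᵃᵘ`.
  have happ : ∀ b ∈ G.aux Λ₀, ∀ ε > 0, ∃ d ∈ G.aux Λ₀, ∀ᶠ n in atTop, dist (φ n b) d < ε := by
    intro b hb ε hε
    obtain ⟨x, c, hc, hbc⟩ := exists_approx_aux hΛ₀ hb hε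
    obtain ⟨h1, h2⟩ := hloc' x c hc
    refine ⟨_, h1, ?_⟩
    filter_upwards [h2] with n hn
    rw [← hn, dist_eq_norm, ← map_sub]
    exact (NonUnitalStarAlgHom.norm_apply_le (φ n) (b - c)).trans_lt hbc
  have hlim : ∀ b : G.aux Λ₀, ∃ L : G.aux Λ₀, Tendsto (fun n => φ n (b : H →L[ℂ] H)) atTop (𝓝 (L : H →L[ℂ] H)) := by
    intro b
    have hcau : CauchySeq fun n => φ n (b : H →L[ℂ] H) := by
      refine Metric.cauchySeq_iff'.2 fun ε hε => ?_
      obtain ⟨d, -, hd⟩ := happ b b.2 (ε / 2) (by positivity)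
      obtain ⟨n₀, hn₀⟩ := eventually_atTop.1 hd
      refine ⟨n₀, fun n hn => ?_⟩
      have h1 := hn₀ n hn
      have h2 := hn₀ n₀ le_rfl
      rw [dist_comm] at h2
      linarith [dist_triangle (φ n (b : H →L[ℂ] H)) d (φ n₀ b)]
    obtain ⟨L, hL⟩ := cauchySeq_tendsto_of_complete hcau
    have : L ∈ closure (G.aux Λ₀ : Set (H →L[ℂ] H)) := by
      refine Metric.mem_closure_iff.2 fun ε hε => ?_
      obtain ⟨d, hd, hd'⟩ := happ b b.2 (ε / 2) (by positivity)
      have h1 := le_of_tendsto (hL.dist (tendsto_const_nhds (x := d))) (hd'.mono fun n hn => hn.le)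
      exact ⟨d, hd, by linarith⟩
    rw [(isClosed_aux G Λ₀).closure_eq] at this
    exact ⟨⟨L, this⟩, hL⟩
  choose L hL using hlim
  let e : G.aux Λ₀ →⋆ₐ[ℂ] G.aux Λ₀ :=
    { toFun := L
      map_one' := Subtype.ext (tendsto_nhds_unique (hL 1) (by simp))
      map_mul' := fun a b => Subtype.ext (tendsto_nhds_unique (hL (a * b))
        (((hL a).mul (hL b)).congr fun n => (map_mul (φ n) _ _).symm))
      map_zero' := Subtype.ext (tendsto_nhds_unique (hL 0) (by simp))
      map_add' := fun a b => Subtype.ext (tendsto_nhds_unique (hL (a + b))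
        (((hL a).add (hL b)).congr fun n => (map_add (φ n) _ _).symm))
      commutes' := fun r => Subtype.ext (tendsto_nhds_unique (hL (algebraMap ℂ _ r)) (by
        refine tendsto_const_nhds.congr fun n => ?_
        exact ((φ n).toAlgEquiv.commutes r).symm))
      map_star' := fun a => Subtype.ext (tendsto_nhds_unique (hL (star a))
        ((hL a).star.congr fun n => (map_star (φ n) _).symm)) }
  have he : ∀ y (b : G.aux Λ₀), (b : H →L[ℂ] H) ∈ G.vonNeumann (Λ₀.translate y).vertices →
      (e b : H →L[ℂ] H) = star (V y) * b * V y := fun y b hb =>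
    tendsto_nhds_unique (hL b) (tendsto_const_nhds.congr' ((hloc' y b hb).2.mono fun n hn => hn.symm))
  refine ⟨e, fun a => ?_, fun y l b hc hb h ξ η => ?_⟩
  · refine Subtype.ext (eq_of_local (φ := (G.aux Λ₀).subtype.comp (e.comp (G.incl Λ₀)))
      (ψ := Endo.toRep ρ) (fun v a ha => ?_) a)
    obtain ⟨x, hx⟩ := Λ₀.exists_translate v
    have ha' : (a : Config →L[ℂ] Config) ∈ localAlgebra (Λ₀.translate x).vertices :=
      localAlgebra_mono (by simpa using hx) ha
    rw [(hV x).2 a ha']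
    exact he x _ (G.rep_mem_vonNeumann ha')
  · rw [he y b hb, inner_conj_apply]
    refine (h (V y ξ) (V y η)).congr' ?_
    filter_upwards [hc] with c hc
    rw [he y c hc, inner_conj_apply]

end GNS

/-! ### Properties of the extension -/

namespace GNS

variable {G : GNS ω H} {Λ₀ : Cone}

theorem clm_ext_inner {A B : H →L[ℂ] H} (h : ∀ ξ η : H, inner ℂ ξ (A η) = inner ℂ ξ (B η)) :
    A = B :=
  ContinuousLinearMap.ext fun η => ext_inner_left ℂ fun ξ => h ξ η

instance neBot_atTop_finset_prod : (atTop : Filter (Finset H × ℕ)).NeBot := by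
  classical
  infer_instance

theorem IsExtension.tendsto_of_net {ρ : G.Endo Λ₀} {e : G.aux Λ₀ →⋆ₐ[ℂ] G.aux Λ₀}
    (he : IsExtension ρ e) {Λ : Set Vertex} {x : ℤ × ℤ} (hΛ : Λ ⊆ (Λ₀.translate x).vertices)
    {b : G.aux Λ₀} (hb : (b : H →L[ℂ] H) ∈ G.vonNeumann Λ) {u : Finset H × ℕ → QuasiLocal}
    (hu : ∀ i, (u i : Config →L[ℂ] Config) ∈ localAlgebra Λ)
    (hlim : ∀ η : H, Tendsto (fun i => G.rep (u i) η) atTop (𝓝 ((b : H →L[ℂ] H) η))) (ξ η : H) :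
    Tendsto (fun i => inner ℂ ξ ((ρ (u i) : H →L[ℂ] H) η)) atTop
      (𝓝 (inner ℂ ξ ((e b : H →L[ℂ] H) η))) := by
  have := he.weakly_continuous x (map (fun i => G.incl Λ₀ (u i)) atTop) b
    (eventually_map.2 (Eventually.of_forall fun i =>
      G.rep_mem_vonNeumann (localAlgebra_mono hΛ (hu i))))
    (vonNeumann_mono hΛ hb) (fun ξ η => tendsto_map'_iff.2 (tendsto_const_nhds.inner (hlim η))) ξ η
  refine (tendsto_map'_iff.1 this).congr fun i => ?_
  rw [Function.comp_apply, he.extends_rep]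

/-- Both sides are weak limits along the same net of local observables. -/
theorem IsExtension.apply_eq {ρ : G.Endo Λ₀} {e : G.aux Λ₀ →⋆ₐ[ℂ] G.aux Λ₀}
    (he : IsExtension ρ e) {Λ : Set Vertex} {V : H →L[ℂ] H} (hV : G.Implements (Endo.toRep ρ) Λ V)
    {x : ℤ × ℤ} (hΛ : Λ ⊆ (Λ₀.translate x).vertices) {b : G.aux Λ₀}
    (hb : (b : H →L[ℂ] H) ∈ G.vonNeumann Λ) : (e b : H →L[ℂ] H) = star V * b * V := by
  obtain ⟨u, hu, hlim⟩ := exists_net hb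
  refine clm_ext_inner fun ξ η => tendsto_nhds_unique (he.tendsto_of_net hΛ hb hu hlim ξ η) ?_
  rw [inner_conj_apply]
  refine ((tendsto_const_nhds (x := V ξ)).inner (hlim (V η))).congr fun i => ?_
  rw [← inner_conj_apply, ← hV.2 _ (hu i)]
  rfl

theorem IsExtension.eq (hΛ₀ : Λ₀.angle ≤ Real.pi / 2) {ρ : G.Endo Λ₀}
    {e e' : G.aux Λ₀ →⋆ₐ[ℂ] G.aux Λ₀} (he : IsExtension ρ e) (he' : IsExtension ρ e') : e = e' := by
  ext1 b
  refine aux_induction hΛ₀ (P := fun b => e b = e' b)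
    (isClosed_eq (continuous_endo e) (continuous_endo e')) (fun x b hb => ?_) b
  obtain ⟨u, hu, hlim⟩ := exists_net hb
  exact Subtype.ext (clm_ext_inner fun ξ η => tendsto_nhds_unique
    (he.tendsto_of_net subset_rfl hb hu hlim ξ η) (he'.tendsto_of_net subset_rfl hb hu hlim ξ η))

theorem ext_eq (hΛ₀ : Λ₀.angle ≤ Real.pi / 2) {ρ : G.Endo Λ₀} {e : G.aux Λ₀ →⋆ₐ[ℂ] G.aux Λ₀}
    (he : IsExtension ρ e) : ext ρ = e := by
  have h : ∃ e, IsExtension ρ e := ⟨e, he⟩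
  rw [ext, dif_pos h]
  exact h.choose_spec.eq hΛ₀ he

theorem isExtension_ext (hω : IsGroundState ω) (hΛ₀ : Λ₀.angle ≤ Real.pi / 2) {ρ : G.Endo Λ₀}
    (hρ : IsSector ρ) : IsExtension ρ (ext ρ) := by
  obtain ⟨e, he⟩ := exists_isExtension hω hΛ₀ hρ
  rwa [ext_eq hΛ₀ he]

theorem ext_incl (hω : IsGroundState ω) (hΛ₀ : Λ₀.angle ≤ Real.pi / 2) {ρ : G.Endo Λ₀}
    (hρ : IsSector ρ) (a : QuasiLocal) : ext ρ (G.incl Λ₀ a) = ρ a :=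
  (isExtension_ext hω hΛ₀ hρ).extends_rep a

/-- Intertwiners of `ρ` and `ρ'` intertwine the extensions. -/
theorem IsIntertwiner.ext (hω : IsGroundState ω) (hΛ₀ : Λ₀.angle ≤ Real.pi / 2)
    {ρ ρ' : G.Endo Λ₀} (hρ : IsSector ρ) (hρ' : IsSector ρ') {T : H →L[ℂ] H}
    (hT : IsIntertwiner ρ ρ' T) (b : G.aux Λ₀) :
    T * (GNS.ext ρ b : H →L[ℂ] H) = (GNS.ext ρ' b : H →L[ℂ] H) * T := by
  refine aux_induction hΛ₀ (P := fun b => T * (GNS.ext ρ b : H →L[ℂ] H) =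
    (GNS.ext ρ' b : H →L[ℂ] H) * T) ?_ (fun x b hb => ?_) b
  · have h1 := continuous_subtype_val.comp (continuous_endo (GNS.ext ρ))
    have h2 := continuous_subtype_val.comp (continuous_endo (GNS.ext ρ'))
    exact isClosed_eq (continuous_const.mul h1) (h2.mul continuous_const)
  · obtain ⟨V, hV⟩ := hρ.transportable.exists_implements (N := Λ₀.translate x) hΛ₀
    obtain ⟨V', hV'⟩ := hρ'.transportable.exists_implements (N := Λ₀.translate x) hΛ₀
    rw [(isExtension_ext hω hΛ₀ hρ).apply_eq hV subset_rfl hb,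
      (isExtension_ext hω hΛ₀ hρ').apply_eq hV' subset_rfl hb]
    exact hV.intertwine hV' (fun a _ => hT a) hb

/-- Away from its localization cone, `ρ` is implemented by the identity. -/
theorem ext_apply_of_disjoint (hω : IsGroundState ω) (hΛ₀ : Λ₀.angle ≤ Real.pi / 2)
    {ρ : G.Endo Λ₀} (hρ : IsSector ρ) {N : Cone} (hloc : G.LocalizedIn (Endo.toRep ρ) N)
    {M : Cone} (hMN : Disjoint M.vertices N.vertices) (hM : M.FitsIn Λ₀) {b : G.aux Λ₀}
    (hb : (b : H →L[ℂ] H) ∈ G.vonNeumann M.vertices) : ext ρ b = b := by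
  obtain ⟨x, hx⟩ := hM
  refine Subtype.ext ?_
  rw [(isExtension_ext hω hΛ₀ hρ).apply_eq (hloc.implements hMN) (Cone.vertices_mono hx) hb]
  simp

theorem ext_mem (hω : IsGroundState ω) (hΛ₀ : Λ₀.angle ≤ Real.pi / 2)
    {ρ : G.Endo Λ₀} (hρ : IsSector ρ) {N : Cone} (hN : N.FitsIn Λ₀)
    (hloc : G.LocalizedIn (Endo.toRep ρ) N) {b : G.aux Λ₀}
    (hb : (b : H →L[ℂ] H) ∈ G.vonNeumann N.vertices) :
    (ext ρ b : H →L[ℂ] H) ∈ G.vonNeumann N.vertices := by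
  have hN' := hN.angle_le hΛ₀
  obtain ⟨x, hx⟩ := hN
  obtain ⟨V, hV⟩ := hρ.transportable.exists_implements (N := N) hN'
  rw [(isExtension_ext hω hΛ₀ hρ).apply_eq hV (Cone.vertices_mono hx) hb]
  exact hV.conj_mem hω hN' hloc subset_rfl hb

theorem vonNeumann_le_of_fitsIn {N : Cone} (hN : N.FitsIn Λ₀) :
    G.vonNeumann N.vertices ≤ G.aux Λ₀ := by
  obtain ⟨x, hx⟩ := hN
  exact (vonNeumann_mono (Cone.vertices_mono hx)).trans (vonNeumann_le_aux x)

theorem exists_common_localized (hΛ₀ : Λ₀.angle ≤ Real.pi / 2) {ρ ρ' : G.Endo Λ₀}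
    (hρ : IsSector ρ) (hρ' : IsSector ρ') (y : ℤ × ℤ) : ∃ z : ℤ × ℤ,
    G.LocalizedIn (Endo.toRep ρ) (Λ₀.translate z) ∧
      G.LocalizedIn (Endo.toRep ρ') (Λ₀.translate z) ∧
        (Λ₀.translate y).region ⊆ (Λ₀.translate z).region := by
  obtain ⟨N, hN, h⟩ := hρ.localized
  obtain ⟨N', hN', h'⟩ := hρ'.localized
  obtain ⟨z, h1, h2, h3⟩ := exists_common_fitsIn hΛ₀ hN hN' y
  exact ⟨z, h.mono h1, h'.mono h2, h3⟩

theorem fitsIn_translate (Λ₀ : Cone) (z : ℤ × ℤ) : (Λ₀.translate z).FitsIn Λ₀ := ⟨z, subset_rfl⟩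

theorem IsIntertwiner.mem_aux (hω : IsGroundState ω) (hΛ₀ : Λ₀.angle ≤ Real.pi / 2)
    {ρ ρ' : G.Endo Λ₀} (hρ : IsSector ρ) (hρ' : IsSector ρ') {T : H →L[ℂ] H}
    (hT : IsIntertwiner ρ ρ' T) : T ∈ G.aux Λ₀ := by
  obtain ⟨z, h, h', -⟩ := exists_common_localized hΛ₀ hρ hρ' 0
  exact vonNeumann_le_aux z (h.intertwiner_mem hω (N := Λ₀.translate z) hΛ₀ h' hT)

/-- The extension of `ρ'` maps a cone algebra into that of a larger translate, where the extension
of `ρ` is again weakly continuous. -/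
theorem isExtension_tensor (hω : IsGroundState ω) (hΛ₀ : Λ₀.angle ≤ Real.pi / 2)
    {ρ ρ' : G.Endo Λ₀} (hρ : IsSector ρ) (hρ' : IsSector ρ') :
    IsExtension (tensor ρ ρ') ((ext ρ).comp (ext ρ')) := by
  refine ⟨fun a => ?_, fun x l b hc hb h => ?_⟩
  · rw [StarAlgHom.comp_apply, ext_incl hω hΛ₀ hρ']
    rfl
  · obtain ⟨z, -, hz, hxz⟩ := exists_common_localized hΛ₀ hρ hρ' x
    have hmem (c : G.aux Λ₀) (hc : (c : H →L[ℂ] H) ∈ G.vonNeumann (Λ₀.translate x).vertices) :=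
      ext_mem hω hΛ₀ hρ' (fitsIn_translate Λ₀ z) hz (vonNeumann_mono (Cone.vertices_mono hxz) hc)
    have h1 := (isExtension_ext hω hΛ₀ hρ').weakly_continuous x l b hc hb h
    exact (isExtension_ext hω hΛ₀ hρ).weakly_continuous z (l.map (ext ρ')) (ext ρ' b)
      (eventually_map.2 (hc.mono hmem)) (hmem b hb) h1

theorem ext_tensor (hω : IsGroundState ω) (hΛ₀ : Λ₀.angle ≤ Real.pi / 2)
    {ρ ρ' : G.Endo Λ₀} (hρ : IsSector ρ) (hρ' : IsSector ρ') (b : G.aux Λ₀) :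
    ext (tensor ρ ρ') b = ext ρ (ext ρ' b) := by
  rw [ext_eq hΛ₀ (isExtension_tensor hω hΛ₀ hρ hρ')]
  rfl

/-! ### Unitarily equivalent sectors -/

/-- The homomorphism `U ρ(·) U†`. -/
def Endo.conj (ρ : G.Endo Λ₀) (U : unitary (G.aux Λ₀)) : G.Endo Λ₀ :=
  (Unitary.conjStarAlgAut ℂ (G.aux Λ₀) U : G.aux Λ₀ →⋆ₐ[ℂ] G.aux Λ₀).comp ρ

theorem Endo.conj_apply (ρ : G.Endo Λ₀) (U : unitary (G.aux Λ₀)) (a : QuasiLocal) :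
    Endo.conj ρ U a = U * ρ a * star (U : G.aux Λ₀) := rfl

theorem Transportable.of_equiv {π π' : QuasiLocal →⋆ₐ[ℂ] (H →L[ℂ] H)} (h : G.Transportable π)
    {U : H →L[ℂ] H} (hU : U ∈ unitary (H →L[ℂ] H)) (h' : ∀ a, π' a = U * π a * star U) :
    G.Transportable π' := by
  intro N
  obtain ⟨σ, hσ, W, hW, hσ'⟩ := h N
  refine ⟨σ, hσ, U * W, mul_mem hU hW, fun a => ?_⟩
  rw [h', hσ', star_mul]
  simp only [mul_assoc, star_mul_of_unitary hU]

theorem coe_mem_unitary (U : unitary (G.aux Λ₀)) : ((U : G.aux Λ₀) : H →L[ℂ] H) ∈ unitary (H →L[ℂ] H) :=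
  Unitary.map_mem (G.aux Λ₀).subtype U.2

theorem Endo.transportable_conj {ρ : G.Endo Λ₀} (hρ : G.Transportable (Endo.toRep ρ))
    (U : unitary (G.aux Λ₀)) : G.Transportable (Endo.toRep (Endo.conj ρ U)) :=
  hρ.of_equiv (coe_mem_unitary U) fun _ => rfl

theorem Endo.isIntertwiner_conj (ρ : G.Endo Λ₀) (U : unitary (G.aux Λ₀)) :
    IsIntertwiner ρ (Endo.conj ρ U) ((U : G.aux Λ₀) : H →L[ℂ] H) := fun a => by
  have : U * ρ a = Endo.conj ρ U a * (U : G.aux Λ₀) := by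
    rw [Endo.conj_apply, mul_assoc, Unitary.coe_star_mul_self, mul_one]
  exact congrArg Subtype.val this

/-- Sectors can be moved to every cone in a translate of `Λ₀` by unitaries in `𝒜ᵃᵘ`. -/
theorem IsSector.exists_conj (hω : IsGroundState ω) (hΛ₀ : Λ₀.angle ≤ Real.pi / 2)
    {ρ : G.Endo Λ₀} (hρ : IsSector ρ) {M : Cone} (hM : M.FitsIn Λ₀) :
    ∃ U : unitary (G.aux Λ₀), G.LocalizedIn (Endo.toRep (Endo.conj ρ U)) M ∧
      IsSector (Endo.conj ρ U) := by
  obtain ⟨N, hN, hloc⟩ := hρ.localized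
  obtain ⟨π, hπ, W, hW, h⟩ := hρ.transportable M
  obtain ⟨z, h1, h2, -⟩ := exists_common_fitsIn hΛ₀ hN hM 0
  -- The transporter intertwines two homomorphisms localized in one translate of `Λ₀`, so Haag
  -- duality puts it into that cone algebra.
  have hmem : star W ∈ G.vonNeumann (Λ₀.translate z).vertices := by
    refine (hloc.mono h1).intertwiner_mem hω (N := Λ₀.translate z) hΛ₀ (hπ.mono h2) fun a => ?_
    rw [h, mul_assoc, (Unitary.mem_iff.1 hW).2, mul_one]
  have hW' := Unitary.mem_iff.1 hW
  let U : unitary (G.aux Λ₀) := ⟨⟨star W, vonNeumann_le_aux z hmem⟩, Unitary.mem_iff.2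
    ⟨Subtype.ext (by simpa using hW'.2), Subtype.ext (by simpa using hW'.1)⟩⟩
  have hloc' : G.LocalizedIn (Endo.toRep (Endo.conj ρ U)) M := fun a ha => by
    rw [← hπ a ha, h]
    change star W * Endo.toRep ρ a * star (star W) = _
    rw [star_star]
  exact ⟨U, hloc', ⟨M, hM, hloc'⟩, Endo.transportable_conj hρ.transportable U⟩

theorem LocalizedIn.tensor (hω : IsGroundState ω) (hΛ₀ : Λ₀.angle ≤ Real.pi / 2)
    {ρ ρ' : G.Endo Λ₀} (hρ : IsSector ρ) {N : Cone} (h : G.LocalizedIn (Endo.toRep ρ) N)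
    (h' : G.LocalizedIn (Endo.toRep ρ') N) :
    G.LocalizedIn (Endo.toRep (GNS.tensor ρ ρ')) N := fun a ha => by
  have : ρ' a = G.incl Λ₀ a := Subtype.ext (h' a ha)
  change ((GNS.ext ρ (ρ' a) : G.aux Λ₀) : H →L[ℂ] H) = _
  rw [this, ext_incl hω hΛ₀ hρ]
  exact h a ha

theorem ext_conj (hω : IsGroundState ω) (hΛ₀ : Λ₀.angle ≤ Real.pi / 2) {ρ : G.Endo Λ₀}
    (hρ : IsSector ρ) {U : unitary (G.aux Λ₀)} (hU : IsSector (Endo.conj ρ U)) (b : G.aux Λ₀) :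
    ext (Endo.conj ρ U) b = U * ext ρ b * star (U : G.aux Λ₀) := by
  have : (U : G.aux Λ₀) * ext ρ b = ext (Endo.conj ρ U) b * U :=
    Subtype.ext ((Endo.isIntertwiner_conj ρ U).ext hω hΛ₀ hρ hU b)
  rw [this, mul_assoc, (Unitary.mem_iff.1 U.2).2, mul_one]

/-- The unitary `ρ̄(U)`. -/
def extUnitary (ρ : G.Endo Λ₀) (U : unitary (G.aux Λ₀)) : unitary (G.aux Λ₀) :=
  ⟨ext ρ U, Unitary.map_mem (ext ρ) U.2⟩

/-- The extension of the conjugated sector is the conjugate of `ρ̄`, so tensoring transporters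
yields the single unitary `U ρ̄(U')`. -/
theorem tensor_conj (hω : IsGroundState ω) (hΛ₀ : Λ₀.angle ≤ Real.pi / 2) {ρ ρ' : G.Endo Λ₀}
    (hρ : IsSector ρ) {U U' : unitary (G.aux Λ₀)} (hU : IsSector (Endo.conj ρ U)) :
    tensor (Endo.conj ρ U) (Endo.conj ρ' U') =
      Endo.conj (tensor ρ ρ') (U * extUnitary ρ U') := by
  ext1 a
  change ext (Endo.conj ρ U) (Endo.conj ρ' U' a) = _
  rw [ext_conj hω hΛ₀ hρ hU, Endo.conj_apply, Endo.conj_apply, map_mul, map_mul, map_star]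
  change _ = U * ext ρ U' * ext ρ (ρ' a) * star (U * ext ρ U')
  rw [star_mul]
  simp only [mul_assoc]

end GNS

/-! ### Tensor products of sectors are transportable -/

namespace Cone

theorem conj_mul_self_of_norm {q : ℂ} (hq : ‖q‖ = 1) : conj q * q = 1 := by
  rw [← Complex.normSq_eq_conj_mul_self, Complex.normSq_eq_norm_sq, hq]
  simp

theorem exists_narrow {S : Set ℂ} (hS : IsOpen S) (hs : ∀ z ∈ S, ∀ r : ℝ, 0 < r → (r : ℂ) * z ∈ S)
    {q : ℂ} (hq : ‖q‖ = 1) (hqS : q ∈ S) (a : ℂ) :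
    ∃ L : Cone, L.apex = a ∧ L.angle ≤ Real.pi / 2 ∧ L.dirs ⊆ S := by
  obtain ⟨δ, hδ, hball⟩ := Metric.isOpen_iff.1 hS q hqS
  have hpi := Real.pi_pos
  refine ⟨⟨a, q, min δ (Real.pi / 2), hq, lt_min hδ (by linarith), by
    linarith [min_le_right δ (Real.pi / 2)]⟩, rfl, min_le_right _ _, fun z hz => ?_⟩
  set θ := min δ (Real.pi / 2) with hθ
  have hz' : ‖z‖ * Real.cos θ < (conj q * z).re := hz
  have hz0 : 0 < ‖z‖ := by
    rw [norm_pos_iff]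
    rintro rfl
    simp at hz'
  set w : ℂ := ((‖z‖⁻¹ : ℝ) : ℂ) * z with hw
  have hw1 : ‖w‖ = 1 := by
    rw [hw, norm_mul, Complex.norm_real, norm_inv, norm_norm, inv_mul_cancel₀ hz0.ne']
  have hre : Real.cos θ < (conj q * w).re := by
    have : conj q * w = ((‖z‖⁻¹ : ℝ) : ℂ) * (conj q * z) := by rw [hw]; ring
    rw [this, Complex.re_ofReal_mul, inv_mul_eq_div, lt_div_iff₀ hz0, mul_comm]
    exact hz'
  have hnorm : ‖w - q‖ ^ 2 = 2 - 2 * (conj q * w).re := by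
    have h := Complex.normSq_sub w q
    rw [Complex.normSq_eq_norm_sq, Complex.normSq_eq_norm_sq, Complex.normSq_eq_norm_sq, hw1, hq] at h
    rw [h, mul_comm w]
    ring
  have hlt : ‖w - q‖ < δ := by
    -- The chord is shorter than the angle: 2 − 2 cos θ ≤ θ². Opening angle `θ ≤ δ` thus keeps unit
    -- directions within `δ` of `q`.
    have h1 := Real.one_sub_sq_div_two_le_cos (x := θ)
    have h2 : 0 < θ := lt_min hδ (by linarith)
    have h3 : ‖w - q‖ ^ 2 < θ ^ 2 := by rw [hnorm]; linarith
    exact (lt_of_pow_lt_pow_left₀ 2 h2.le h3).trans_le (min_le_left _ _)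
  have := hs w (hball (by rwa [Metric.mem_ball, dist_eq_norm])) ‖z‖ hz0
  rwa [hw, ← mul_assoc, ← Complex.ofReal_mul, mul_inv_cancel₀ hz0.ne', Complex.ofReal_one,
    one_mul] at this

/-- There is a half-plane that contains a given direction and one of the directions of a given
cone. -/
theorem exists_half_plane (Λ₀ : Cone) {q : ℂ} (hq : ‖q‖ = 1) :
    ∃ Λ : Cone, Λ.angle ≤ Real.pi / 2 ∧ q ∈ Λ.dirs ∧ ∃ p, ‖p‖ = 1 ∧ p ∈ Λ₀.dirs ∧ p ∈ Λ.dirs := by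
  have hpi := Real.pi_pos
  obtain ⟨p, hp, hpΛ, hpq⟩ : ∃ p, ‖p‖ = 1 ∧ p ∈ Λ₀.dirs ∧ p + q ≠ 0 := by
    -- Only the direction opposite to `q` is unsuitable. If the axis is that direction, it is turned
    -- by half the opening angle, which stays inside the cone.
    by_cases h : Λ₀.axis + q = 0
    · set j := Complex.exp ((Λ₀.angle / 2 : ℝ) * Complex.I) with hj
      have hj1 : ‖j‖ = 1 := Complex.norm_exp_ofReal_mul_I _
      have hjre : j.re = Real.cos (Λ₀.angle / 2) := Complex.exp_ofReal_mul_I_re _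
      have hlt : Real.cos Λ₀.angle < Real.cos (Λ₀.angle / 2) :=
        Real.cos_lt_cos_of_nonneg_of_le_pi (by linarith [Λ₀.angle_pos]) Λ₀.angle_lt.le
          (by linarith [Λ₀.angle_pos])
      refine ⟨j * Λ₀.axis, by rw [norm_mul, hj1, Λ₀.norm_axis, one_mul], ?_, fun h' => ?_⟩
      · change ‖j * Λ₀.axis‖ * Real.cos Λ₀.angle < (conj Λ₀.axis * (j * Λ₀.axis)).re
        have : conj Λ₀.axis * (j * Λ₀.axis) = j := by
          linear_combination j * conj_mul_self_of_norm Λ₀.norm_axis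
        rw [this, norm_mul, hj1, Λ₀.norm_axis, one_mul, one_mul, hjre]
        exact hlt
      · have h1 : (j - 1) * Λ₀.axis = 0 := by linear_combination h' - h
        have hne : Λ₀.axis ≠ 0 := norm_pos_iff.1 (by rw [Λ₀.norm_axis]; exact one_pos)
        have h2 : j = 1 := by
          rcases mul_eq_zero.1 h1 with h2 | h2
          · linear_combination h2
          · exact absurd h2 hne
        have h3 : j.im = Real.sin (Λ₀.angle / 2) := Complex.exp_ofReal_mul_I_im _
        have h4 := Real.sin_pos_of_pos_of_lt_pi (x := Λ₀.angle / 2) (by linarith [Λ₀.angle_pos])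
          (by linarith [Λ₀.angle_lt, Λ₀.angle_pos])
        rw [← h3, h2] at h4
        simp at h4
    · exact ⟨Λ₀.axis, Λ₀.norm_axis, Λ₀.axis_mem_dirs, h⟩
  have hn : 0 < ‖p + q‖ := norm_pos_iff.2 hpq
  -- The bisector of `p` and `q` makes an acute angle with both and serves as the inner normal.
  set m : ℂ := ((‖p + q‖⁻¹ : ℝ) : ℂ) * (p + q) with hm
  have hsq : ‖p + q‖ ^ 2 = 2 + 2 * (conj p * q).re := by
    have h := Complex.normSq_add p q
    rw [Complex.normSq_eq_norm_sq, Complex.normSq_eq_norm_sq, Complex.normSq_eq_norm_sq, hp, hq] at h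
    have h2 : (p * conj q).re = (conj p * q).re := by simp
    rw [h, h2]
    ring
  have hpos : 0 < 1 + (conj p * q).re := by nlinarith
  have hmem : ∀ w : ℂ, (conj (p + q) * w).re = 1 + (conj p * q).re → 0 < (conj m * w).re := by
    intro w hw
    have : conj m * w = ((‖p + q‖⁻¹ : ℝ) : ℂ) * (conj (p + q) * w) := by
      rw [hm, map_mul, Complex.conj_ofReal]
      ring
    rw [this, Complex.re_ofReal_mul, hw]
    positivity
  refine ⟨⟨0, m, Real.pi / 2, ?_, by linarith, by linarith⟩, le_rfl, ?_, p, hp, hpΛ, ?_⟩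
  · rw [hm, norm_mul, Complex.norm_real, norm_inv, norm_norm, inv_mul_cancel₀ hn.ne']
  · change _ * Real.cos (Real.pi / 2) < (conj m * q).re
    rw [Real.cos_pi_div_two, mul_zero]
    refine hmem q ?_
    rw [map_add, add_mul, conj_mul_self_of_norm hq, Complex.add_re, Complex.one_re, add_comm]
  · change _ * Real.cos (Real.pi / 2) < (conj m * p).re
    rw [Real.cos_pi_div_two, mul_zero]
    refine hmem p ?_
    rw [map_add, add_mul, conj_mul_self_of_norm hp, Complex.add_re, Complex.one_re]
    congr 1
    simp
    ring

theorem FitsIn.of_dirs {N M : Cone} (hM : M.angle ≤ Real.pi / 2) (h : N.dirs ⊆ M.dirs) :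
    N.FitsIn M := by
  obtain ⟨p, hp⟩ := M.exists_toPlane_mem_dirs
  obtain ⟨n, hn⟩ := (eventually_subset_translate hM h hp).exists
  exact ⟨_, hn⟩

theorem FitsIn.translate {N M : Cone} (h : N.FitsIn M) (x : ℤ × ℤ) : (N.translate x).FitsIn M := by
  obtain ⟨y, hy⟩ := h
  exact ⟨y + x, translate_translate M y x ▸ translate_region_mono hy x⟩

end Cone

/-! ### Changing the auxiliary algebra -/

namespace GNS

variable {G : GNS ω H} {Λ₀ : Cone}

theorem LocalizedIn.map_mem_aux (hω : IsGroundState ω) (hΛ₀ : Λ₀.angle ≤ Real.pi / 2)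
    {π : QuasiLocal →⋆ₐ[ℂ] (H →L[ℂ] H)} {N : Cone} (hloc : G.LocalizedIn π N) (hN : N.FitsIn Λ₀)
    (a : QuasiLocal) : π a ∈ G.aux Λ₀ := by
  have hgen : ∀ v, ∀ a : QuasiLocal, (a : Config →L[ℂ] Config) ∈ localAlgebra {v} →
      π a ∈ G.aux Λ₀ := by
    intro v a ha
    obtain ⟨x, hx⟩ := Λ₀.exists_translate v
    obtain ⟨z, h1, -, h2⟩ := exists_common_fitsIn hΛ₀ hN hN x
    refine vonNeumann_le_aux z ((hloc.mono h1).map_mem hω (N := Λ₀.translate z) hΛ₀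
      (localAlgebra_mono ?_ ha))
    simpa using Cone.vertices_mono h2 hx
  refine localAlgebra_induction (P := fun a => π a ∈ G.aux Λ₀) (Λ := Set.univ) ?_ ?_ ?_ ?_ ?_ ?_ a a.2
  · exact (isClosed_aux G Λ₀).preimage (continuous_starAlgHom π)
  · exact fun v _ => hgen v _ (sigmaX_mem (Set.mem_singleton v))
  · exact fun v _ => hgen v _ (sigmaZ_mem (Set.mem_singleton v))
  · intro c
    rw [show π (algebraMap ℂ _ c) = algebraMap ℂ _ c from π.toAlgHom.commutes c]
    exact (G.aux Λ₀).algebraMap_mem c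
  · intro a b ha hb
    rw [map_add]
    exact add_mem ha hb
  · intro a b ha hb
    rw [map_mul]
    exact mul_mem ha hb

/-- The tensor product does not depend on the cone that defines the auxiliary algebra. -/
theorem tensor_eq_of_toRep_eq (hω : IsGroundState ω) (hΛ₀ : Λ₀.angle ≤ Real.pi / 2) {Λ₁ : Cone}
    (hΛ₁ : Λ₁.angle ≤ Real.pi / 2) {ρ ρ' : G.Endo Λ₀} {σ σ' : G.Endo Λ₁} (hρ : IsSector ρ)
    (hσ : IsSector σ) (h : ∀ a, (ρ a : H →L[ℂ] H) = σ a) (h' : ∀ a, (ρ' a : H →L[ℂ] H) = σ' a)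
    {L : Cone} (hL₀ : L.FitsIn Λ₀) (hL₁ : L.FitsIn Λ₁) (hloc : G.LocalizedIn (Endo.toRep ρ') L)
    (a : QuasiLocal) : (tensor ρ ρ' a : H →L[ℂ] H) = tensor σ σ' a := by
  refine eq_of_local (φ := Endo.toRep (tensor ρ ρ')) (ψ := Endo.toRep (tensor σ σ'))
    (fun v a ha => ?_) a
  have hL := hL₀.angle_le hΛ₀
  obtain ⟨p, hp⟩ := L.exists_toPlane_mem_dirs
  obtain ⟨n, h1, h2⟩ := ((Cone.eventually_subset_translate hL subset_rfl hp).and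
    (Cone.eventually_mem_translate hp (toPlane v))).exists
  set M := L.translate (-(n • p)) with hM
  have hmem : ((ρ' a : G.aux Λ₀) : H →L[ℂ] H) ∈ G.vonNeumann M.vertices :=
    (hloc.mono h1).map_mem hω (N := M) hL (localAlgebra_mono (Set.singleton_subset_iff.2 h2) ha)
  have hmem' : ((σ' a : G.aux Λ₁) : H →L[ℂ] H) ∈ G.vonNeumann M.vertices := h' a ▸ hmem
  obtain ⟨V, hV⟩ := hρ.transportable.exists_implements (N := M) hL
  have hV' : G.Implements (Endo.toRep σ) M.vertices V :=
    ⟨hV.1, fun a ha => (h a).symm.trans (hV.2 a ha)⟩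
  obtain ⟨x₀, hx₀⟩ := hL₀.translate (-(n • p))
  obtain ⟨x₁, hx₁⟩ := hL₁.translate (-(n • p))
  change (ext ρ (ρ' a) : H →L[ℂ] H) = ext σ (σ' a)
  rw [(isExtension_ext hω hΛ₀ hρ).apply_eq hV (Cone.vertices_mono hx₀) hmem,
    (isExtension_ext hω hΛ₁ hσ).apply_eq hV' (Cone.vertices_mono hx₁) hmem', h' a]

theorem Endo.toRep_apply (ρ : G.Endo Λ₀) (a : QuasiLocal) : Endo.toRep ρ a = ρ a := rfl

/-- A sector that is localized in a cone in a translate of `Λ₁` can be regarded as a sector for the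
auxiliary algebra of `Λ₁`. -/
theorem IsSector.exists_eq (hω : IsGroundState ω) {Λ₁ : Cone} (hΛ₁ : Λ₁.angle ≤ Real.pi / 2)
    {ρ : G.Endo Λ₀} (hρ : IsSector ρ) {L : Cone} (hL : L.FitsIn Λ₁)
    (hloc : G.LocalizedIn (Endo.toRep ρ) L) :
    ∃ σ : G.Endo Λ₁, IsSector σ ∧ ∀ a, (ρ a : H →L[ℂ] H) = σ a := by
  obtain ⟨σ, hσ⟩ : ∃ σ : G.Endo Λ₁, Endo.toRep σ = Endo.toRep ρ :=
    ⟨(Endo.toRep ρ).codRestrict _ (hloc.map_mem_aux hω hΛ₁ hL),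
      StarAlgHom.subtype_comp_codRestrict _ _ _⟩
  refine ⟨σ, ⟨⟨L, hL, by rwa [hσ]⟩, by rw [hσ]; exact hρ.transportable⟩, fun a => ?_⟩
  rw [← Endo.toRep_apply, ← Endo.toRep_apply, hσ]

/-- Both factors are moved by transporters in `𝒜ᵃᵘ`, which `tensor_conj` combines into one; this
only reaches cones in translates of `Λ₀`. -/
theorem exists_tensor_conj (hω : IsGroundState ω) (hΛ₀ : Λ₀.angle ≤ Real.pi / 2)
    {ρ ρ' : G.Endo Λ₀} (hρ : IsSector ρ) (hρ' : IsSector ρ') {M : Cone} (hM : M.FitsIn Λ₀) :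
    ∃ σ σ' : G.Endo Λ₀, IsSector σ ∧ IsSector σ' ∧ G.LocalizedIn (Endo.toRep σ) M ∧
      G.LocalizedIn (Endo.toRep σ') M ∧ ∃ X ∈ unitary (H →L[ℂ] H), ∀ a,
        (tensor σ σ' a : H →L[ℂ] H) = X * tensor ρ ρ' a * star X := by
  obtain ⟨U, hU, hUs⟩ := hρ.exists_conj hω hΛ₀ hM
  obtain ⟨U', hU', hUs'⟩ := hρ'.exists_conj hω hΛ₀ hM
  refine ⟨_, _, hUs, hUs', hU, hU', _, coe_mem_unitary (U * extUnitary ρ U'), fun a => ?_⟩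
  rw [tensor_conj hω hΛ₀ hρ hUs]
  rfl

/-- The target cone `N` need not fit into a translate of `Λ₀`. Choose a half-plane `Λ₁` that shares
directions with both `Λ₀` and `N`. Move the factors into a narrow cone `L` that fits into both `Λ₀`
and `Λ₁`, regard them there as sectors for `Λ₁`, which does not affect their tensor product, and
move them on into a subcone `M` of `N`. -/
theorem IsSector.tensor (hω : IsGroundState ω) (hΛ₀ : Λ₀.angle ≤ Real.pi / 2)
    {ρ ρ' : G.Endo Λ₀} (hρ : IsSector ρ) (hρ' : IsSector ρ') : IsSector (GNS.tensor ρ ρ') := by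
  obtain ⟨z, hz, hz', -⟩ := exists_common_localized hΛ₀ hρ hρ' 0
  refine ⟨⟨_, fitsIn_translate Λ₀ z, hz.tensor hω hΛ₀ hρ hz'⟩, fun N => ?_⟩
  obtain ⟨Λ₁, hΛ₁, hq, p, hp, hp₀, hp₁⟩ := Λ₀.exists_half_plane N.norm_axis
  obtain ⟨L, -, -, hL⟩ := Cone.exists_narrow (Λ₀.isOpen_dirs.inter Λ₁.isOpen_dirs)
    (fun z hz r hr => ⟨Cone.smul_mem_dirs hz.1 hr, Cone.smul_mem_dirs hz.2 hr⟩) hp ⟨hp₀, hp₁⟩ 0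
  obtain ⟨M, hMapex, -, hM⟩ := Cone.exists_narrow (N.isOpen_dirs.inter Λ₁.isOpen_dirs)
    (fun z hz r hr => ⟨Cone.smul_mem_dirs hz.1 hr, Cone.smul_mem_dirs hz.2 hr⟩) N.norm_axis
    ⟨N.axis_mem_dirs, hq⟩ N.apex
  have hL₀ : L.FitsIn Λ₀ := Cone.FitsIn.of_dirs hΛ₀ fun w hw => (hL hw).1
  have hL₁ : L.FitsIn Λ₁ := Cone.FitsIn.of_dirs hΛ₁ fun w hw => (hL hw).2
  have hM₁ : M.FitsIn Λ₁ := Cone.FitsIn.of_dirs hΛ₁ fun w hw => (hM hw).2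
  have hMN : M.region ⊆ N.region := Cone.region_subset_of_apex_eq (fun w hw => (hM hw).1) hMapex
  obtain ⟨τ, τ', hτ, hτ', hτL, hτL', X, hX, hXe⟩ := exists_tensor_conj hω hΛ₀ hρ hρ' hL₀
  obtain ⟨σ, hσ, hστ⟩ := hτ.exists_eq hω hΛ₁ hL₁ hτL
  obtain ⟨σ', hσ', hστ'⟩ := hτ'.exists_eq hω hΛ₁ hL₁ hτL'
  obtain ⟨φ, φ', hφ, -, hφM, hφM', Y, hY, hYe⟩ := exists_tensor_conj hω hΛ₁ hσ hσ' hM₁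
  have e := tensor_eq_of_toRep_eq hω hΛ₀ hΛ₁ hτ hσ hστ hστ' hL₀ hL₁ hτL'
  refine ⟨_, (hφM.tensor hω hΛ₁ hφ hφM').mono hMN, star X * star Y,
    mul_mem (Unitary.star_mem hX) (Unitary.star_mem hY), fun a => ?_⟩
  refine (hYe a).trans ?_
  rw [← e, hXe, star_mul, star_star, star_star]
  simp only [mul_assoc]
  rfl

end GNS

/-! ### Cones to the left -/

namespace Cone

/-- The directions at angles between `α` and `β`, measured counterclockwise from `u`. -/
def arc (u : ℂ) (α β : ℝ) : Set ℂ :=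
  {w | ∃ r : ℝ, 0 < r ∧ ∃ φ : ℝ, α < φ ∧ φ < β ∧ w = r * (u * Complex.exp (φ * Complex.I))}

theorem arc_mono {u : ℂ} {α β α' β' : ℝ} (h : α' ≤ α) (h' : β ≤ β') : arc u α β ⊆ arc u α' β' := by
  rintro _ ⟨r, hr, φ, h1, h2, rfl⟩
  exact ⟨r, hr, φ, h.trans_lt h1, h2.trans_le h', rfl⟩

theorem norm_mul_exp {u : ℂ} (hu : ‖u‖ = 1) (φ : ℝ) : ‖u * Complex.exp (φ * Complex.I)‖ = 1 := by
  rw [norm_mul, hu, Complex.norm_exp_ofReal_mul_I, one_mul]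

theorem conj_mul_exp {u : ℂ} (hu : ‖u‖ = 1) (μ φ : ℝ) :
    conj (u * Complex.exp (μ * Complex.I)) * (u * Complex.exp (φ * Complex.I)) =
      Complex.exp ((φ - μ : ℝ) * Complex.I) := by
  have h : conj (Complex.exp (μ * Complex.I)) = Complex.exp (-(μ * Complex.I)) := by
    rw [← Complex.exp_conj, map_mul, Complex.conj_ofReal, Complex.conj_I, mul_neg]
  have h2 : Complex.exp ((φ - μ : ℝ) * Complex.I) =
      Complex.exp (-(μ * Complex.I)) * Complex.exp (φ * Complex.I) := by
    rw [← Complex.exp_add]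
    congr 1
    push_cast
    ring
  rw [map_mul, h, h2]
  linear_combination Complex.exp (-(μ * Complex.I)) * Complex.exp (φ * Complex.I) *
    conj_mul_self_of_norm hu

theorem exists_eq_mul_exp {u v : ℂ} (hu : ‖u‖ = 1) (hv : ‖v‖ = 1) :
    ∃ μ : ℝ, |μ| ≤ Real.pi ∧ v = u * Complex.exp (μ * Complex.I) := by
  refine ⟨Complex.arg (conj u * v), Complex.abs_arg_le_pi _, ?_⟩
  have h := Complex.norm_mul_exp_arg_mul_I (conj u * v)
  rw [norm_mul, Complex.norm_conj, hu, hv, one_mul, Complex.ofReal_one, one_mul] at h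
  rw [h]
  linear_combination -v * conj_mul_self_of_norm hu

/-- The angle to the axis can be taken in [-π, π], where the cosine decreases in its absolute value.
Inclusions and rotations of cones thereby become statements about intervals of angles. -/
theorem dirs_eq_arc {Λ : Cone} {u : ℂ} (hu : ‖u‖ = 1) {μ : ℝ}
    (h : Λ.axis = u * Complex.exp (μ * Complex.I)) :
    Λ.dirs = arc u (μ - Λ.angle) (μ + Λ.angle) := by
  ext w
  constructor
  · intro hw
    have hw' : ‖w‖ * Real.cos Λ.angle < (conj Λ.axis * w).re := hw
    have hw0 : w ≠ 0 := fun h0 => Λ.zero_notMem_dirs (h0 ▸ hw)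
    have hn : 0 < ‖w‖ := norm_pos_iff.2 hw0
    have hnw : ‖((‖w‖⁻¹ : ℝ) : ℂ) * w‖ = 1 := by
      rw [norm_mul, Complex.norm_real, norm_inv, norm_norm, inv_mul_cancel₀ hn.ne']
    obtain ⟨ψ, hψ, e⟩ := exists_eq_mul_exp Λ.norm_axis hnw
    have e' : w = ‖w‖ * (Λ.axis * Complex.exp (ψ * Complex.I)) := by
      rw [← e, ← mul_assoc, ← Complex.ofReal_mul, mul_inv_cancel₀ hn.ne', Complex.ofReal_one, one_mul]
    have hre : (conj Λ.axis * w).re = ‖w‖ * Real.cos ψ := by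
      have : conj Λ.axis * w = ‖w‖ * Complex.exp (ψ * Complex.I) := by
        conv_lhs => rw [e']
        linear_combination (‖w‖ : ℂ) * Complex.exp (ψ * Complex.I) *
          conj_mul_self_of_norm Λ.norm_axis
      rw [this, Complex.re_ofReal_mul, Complex.exp_ofReal_mul_I_re]
    rw [hre] at hw'
    have hlt : |ψ| < Λ.angle := by
      by_contra! hle
      have := Real.cos_le_cos_of_nonneg_of_le_pi Λ.angle_pos.le hψ hle
      rw [Real.cos_abs] at this
      exact absurd (lt_of_mul_lt_mul_left hw' hn.le) (not_lt.2 this)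
    rw [abs_lt] at hlt
    refine ⟨‖w‖, hn, μ + ψ, by linarith, by linarith, ?_⟩
    conv_lhs => rw [e', h]
    rw [mul_assoc u, ← Complex.exp_add]
    push_cast
    ring_nf
  · rintro ⟨r, hr, φ, h1, h2, rfl⟩
    refine smul_mem_dirs ?_ hr
    change ‖_‖ * Real.cos Λ.angle < Complex.re _
    rw [norm_mul_exp hu, h, conj_mul_exp hu, Complex.exp_ofReal_mul_I_re, one_mul,
      ← Real.cos_abs (φ - μ)]
    exact Real.cos_lt_cos_of_nonneg_of_le_pi (abs_nonneg _) Λ.angle_lt.le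
      (abs_lt.2 ⟨by linarith, by linarith⟩)

theorem dirs_eq_arc_axis (Λ : Cone) : Λ.dirs = arc Λ.axis (-Λ.angle) Λ.angle := by
  have := dirs_eq_arc (Λ := Λ) Λ.norm_axis (μ := 0) (by simp)
  rwa [zero_sub, zero_add] at this

/-- A common direction would have two angles that differ by a multiple of 2π strictly between 0 and
2π. -/
theorem disjoint_arc {u : ℂ} (hu : ‖u‖ = 1) {α β α' β' : ℝ} (h : β ≤ α')
    (h' : β' ≤ α + 2 * Real.pi) : Disjoint (arc u α β) (arc u α' β') := by
  rw [Set.disjoint_left]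
  rintro w ⟨r, hr, φ, h1, h2, e⟩ ⟨r', hr', φ', h1', h2', e'⟩
  have hn : ‖w‖ = r := by
    rw [e, norm_mul, norm_mul_exp hu, Complex.norm_real, Real.norm_of_nonneg hr.le, mul_one]
  have hn' : ‖w‖ = r' := by
    rw [e', norm_mul, norm_mul_exp hu, Complex.norm_real, Real.norm_of_nonneg hr'.le, mul_one]
  obtain rfl : r = r' := hn.symm.trans hn'
  have hr0 : (r : ℂ) ≠ 0 := by exact_mod_cast hr.ne'
  have e2 := mul_left_cancel₀ hr0 (e.symm.trans e')
  have e3 := conj_mul_exp hu φ φ'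
  rw [← e2, conj_mul_exp hu, sub_self, Complex.ofReal_zero, zero_mul, Complex.exp_zero] at e3
  have e4 : Real.cos (φ' - φ) = 1 := by
    rw [← Complex.exp_ofReal_mul_I_re, ← e3, Complex.one_re]
  rw [Real.cos_eq_one_iff_of_lt_of_lt (by linarith) (by linarith)] at e4
  linarith

/-- The cone with apex `a` whose directions are at angles between `α` and `β` from `u`. -/
def ofArc (a u : ℂ) (hu : ‖u‖ = 1) (α β : ℝ) (h : α < β) (h' : β < α + 2 * Real.pi) : Cone where
  apex := a
  axis := u * Complex.exp (((α + β) / 2 : ℝ) * Complex.I)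
  angle := (β - α) / 2
  norm_axis := norm_mul_exp hu _
  angle_pos := by linarith
  angle_lt := by linarith

theorem dirs_ofArc {a u : ℂ} {hu : ‖u‖ = 1} {α β : ℝ} {h : α < β} {h' : β < α + 2 * Real.pi} :
    (ofArc a u hu α β h h').dirs = arc u α β := by
  rw [dirs_eq_arc (Λ := ofArc a u hu α β h h') hu rfl]
  change arc u ((α + β) / 2 - (β - α) / 2) ((α + β) / 2 + (β - α) / 2) = _
  congr 1 <;> ring

theorem rotate_axis {Λ : Cone} {u : ℂ} {μ : ℝ} (h : Λ.axis = u * Complex.exp (μ * Complex.I))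
    (s : ℝ) : (Λ.rotate s).axis = u * Complex.exp ((μ + s : ℝ) * Complex.I) := by
  change Complex.exp (s * Complex.I) * Λ.axis = _
  rw [h, mul_left_comm, ← Complex.exp_add]
  congr 2
  push_cast
  ring

/-- Every direction of `N` satisfies the closed cone condition of `M`, so the open angular interval
of `N` lies in the closed one of `M`. The supremum is approached by angles `d` on the side of the
sign of `μ`. -/
theorem abs_add_angle_le {N M : Cone} (hM : M.angle ≤ Real.pi / 2) (h : N.region ⊆ M.region)
    {μ : ℝ} (hμ : |μ| ≤ Real.pi) (e : N.axis = M.axis * Complex.exp (μ * Complex.I)) :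
    |μ| + N.angle ≤ M.angle := by
  have hpi := Real.pi_pos
  have hN := angle_le_of_region_subset hM h
  have key : ∀ φ : ℝ, μ - N.angle < φ → φ < μ + N.angle → |φ| ≤ Real.pi → |φ| ≤ M.angle := by
    intro φ h1 h2 h3
    have hmem : M.axis * Complex.exp (φ * Complex.I) ∈ N.dirs := by
      rw [dirs_eq_arc M.norm_axis e]
      exact ⟨1, one_pos, φ, h1, h2, by rw [Complex.ofReal_one, one_mul]⟩
    have h4 := norm_mul_cos_le_of_region_subset hM h hmem
    have h5 : conj M.axis * (M.axis * Complex.exp (φ * Complex.I)) =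
        Complex.exp (φ * Complex.I) := by
      linear_combination Complex.exp (φ * Complex.I) * conj_mul_self_of_norm M.norm_axis
    rw [norm_mul_exp M.norm_axis, one_mul, h5, Complex.exp_ofReal_mul_I_re, ← Real.cos_abs φ] at h4
    by_contra! h6
    exact absurd (Real.cos_lt_cos_of_nonneg_of_le_pi M.angle_pos.le h3 h6) (not_lt.2 h4)
  have hpos := N.angle_pos
  have h0 := key μ (by linarith) (by linarith) hμ
  refine le_of_forall_lt fun c hc => ?_
  rcases le_or_gt c |μ| with hc' | hc'
  · obtain ⟨d, hd1, hd2⟩ := exists_between (show |μ| < |μ| + N.angle by linarith)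
    rcases le_total 0 μ with h1 | h1
    · rw [abs_of_nonneg h1] at *
      have := key d (by linarith) hd2 (by rw [abs_of_nonneg (by linarith)]; linarith)
      rw [abs_of_nonneg (by linarith)] at this
      linarith
    · rw [abs_of_nonpos h1] at *
      have := key (-d) (by linarith) (by linarith) (by rw [abs_neg, abs_of_nonneg (by linarith)]; linarith)
      rw [abs_neg, abs_of_nonneg (by linarith)] at this
      linarith
  · obtain ⟨d, hd1, hd2⟩ := exists_between hc
    rcases le_total 0 μ with h1 | h1
    · rw [abs_of_nonneg h1] at *
      have := key d (by linarith) hd2 (by rw [abs_of_nonneg (by linarith)]; linarith)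
      rw [abs_of_nonneg (by linarith)] at this
      linarith
    · rw [abs_of_nonpos h1] at *
      have := key (-d) (by linarith) (by linarith) (by rw [abs_neg, abs_of_nonneg (by linarith)]; linarith)
      rw [abs_neg, abs_of_nonneg (by linarith)] at this
      linarith

/-- The apex of `N` is only a limit of points of `M`. Openness of the directions of `M` allows
replacing it by the point `N.apex + s * N.axis` with small `s > 0`. -/
theorem region_subset_of_apex {N N' M : Cone} (hM : M.angle ≤ Real.pi / 2)
    (h : N.region ⊆ M.region) (ha : N'.apex = N.apex) (hd : N'.dirs ⊆ M.dirs) :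
    N'.region ⊆ M.region := by
  intro z hz
  have hz' : z - N.apex ∈ M.dirs := hd (ha ▸ hz)
  have hlim : Tendsto (fun s : ℝ => z - N.apex - s * N.axis) (𝓝[>] 0) (𝓝 (z - N.apex)) := by
    refine Tendsto.mono_left ?_ nhdsWithin_le_nhds
    have : Continuous fun s : ℝ => z - N.apex - s * N.axis := by fun_prop
    simpa using this.tendsto 0
  obtain ⟨s, hs, hs0⟩ :=
    ((hlim.eventually (M.isOpen_dirs.mem_nhds hz')).and self_mem_nhdsWithin).exists
  have h1 : N.apex + s * N.axis ∈ M.region := h (by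
    rw [mem_region_iff, add_sub_cancel_left]
    exact smul_mem_dirs N.axis_mem_dirs hs0)
  have := add_mem_dirs hM hs h1
  rw [mem_region_iff]
  convert this using 1
  ring

/-- `M` is a cone that is disjoint from `Λ` and contains the directions at the left boundary of
`Λ₀`. -/
structure IsLeftSector (Λ₀ M Λ : Cone) : Prop where
  fitsIn : M.FitsIn Λ₀
  fitsIn_right : Λ.FitsIn Λ₀
  disjoint : Disjoint M.region Λ.region
  arc_subset : ∃ α, -Λ₀.angle ≤ α ∧ α < Λ₀.angle ∧ arc Λ₀.axis α Λ₀.angle ⊆ M.dirs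

/-- The rotating cone `Λ'` sweeps out every angle from its own right edge to the left edge of `Λ₀`.
The swept sector `M` is disjoint from `Λ`, and therefore all directions of `Λ` lie to the right of
those of `Λ'`. -/
theorem IsLeftOf.exists_isLeftSector {Λ₀ Λ' Λ : Cone} (hΛ₀ : Λ₀.angle ≤ Real.pi / 2)
    (h : IsLeftOf Λ₀ Λ' Λ) : (∃ M, IsLeftSector Λ₀ M Λ ∧ Λ'.region ⊆ M.region) ∧
      ∃ β, -Λ₀.angle < β ∧ β < Λ₀.angle ∧ Λ.dirs ⊆ arc Λ₀.axis (-Λ₀.angle) β := by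
  have hpi := Real.pi_pos
  obtain ⟨x, h', h, t, ht, ⟨z, hz1, hz2⟩, hdisj⟩ := h
  have hM₀ : (Λ₀.translate x).angle ≤ Real.pi / 2 := hΛ₀
  have hu := Λ₀.norm_axis
  obtain ⟨μ, hμ, eμ⟩ := exists_eq_mul_exp hu Λ'.norm_axis
  obtain ⟨ν, hν, eν⟩ := exists_eq_mul_exp hu Λ.norm_axis
  have hμ' : |μ| + Λ'.angle ≤ Λ₀.angle := abs_add_angle_le hM₀ h' hμ eμ
  have hν' : |ν| + Λ.angle ≤ Λ₀.angle := abs_add_angle_le hM₀ h hν eν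
  have hp' := Λ'.angle_pos
  have hp := Λ.angle_pos
  have hμ1 := neg_abs_le μ
  have hμ2 := le_abs_self μ
  have hν1 := neg_abs_le ν
  have hν2 := le_abs_self ν
  set M := ofArc Λ'.apex Λ₀.axis hu (μ - Λ'.angle) Λ₀.angle (by linarith) (by linarith) with hM
  have hMd : M.dirs = arc Λ₀.axis (μ - Λ'.angle) Λ₀.angle := dirs_ofArc
  have hMsub : M.region ⊆ (Λ₀.translate x).region := by
    refine region_subset_of_apex hM₀ h' rfl ?_
    rw [hMd, dirs_translate, dirs_eq_arc_axis]
    exact arc_mono (by linarith) le_rfl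
  -- The rotated cone leaves `Λ₀ + x` with its apex unchanged, so its left edge must have passed
  -- that of `Λ₀`.
  have htt : Λ₀.angle < μ + Λ'.angle + t := by
    by_contra! hle
    refine hz2 (region_subset_of_apex hM₀ h' (N' := Λ'.rotate t) rfl ?_ hz1)
    rw [dirs_eq_arc hu (rotate_axis eμ t), dirs_translate, dirs_eq_arc_axis]
    change arc _ (μ + t - Λ'.angle) (μ + t + Λ'.angle) ⊆ _
    exact arc_mono (by linarith) (by linarith)
  have hMΛ : Disjoint M.region Λ.region := by
    rw [Set.disjoint_left]
    intro w hw hwΛ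
    have hw' : w - Λ'.apex ∈ arc Λ₀.axis (μ - Λ'.angle) Λ₀.angle := hMd ▸ hw
    obtain ⟨r, hr, φ, h1, h2, e⟩ := hw'
    have hs : ∃ s, 0 ≤ s ∧ s ≤ t ∧ μ + s - Λ'.angle < φ ∧ φ < μ + s + Λ'.angle := by
      rcases lt_or_ge φ (μ + Λ'.angle) with h3 | h3
      · exact ⟨0, le_rfl, ht, by linarith, by linarith⟩
      · obtain ⟨s, hs1, hs2⟩ := exists_between
          (show φ - μ - Λ'.angle < min t (φ - μ + Λ'.angle) from
            lt_min (by linarith) (by linarith))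
        have h4 := min_le_left t (φ - μ + Λ'.angle)
        have h5 := min_le_right t (φ - μ + Λ'.angle)
        exact ⟨s, by linarith, by linarith, by linarith, by linarith⟩
    obtain ⟨s, hs0, hst, hs1, hs2⟩ := hs
    refine Set.disjoint_left.1 (hdisj s ⟨hs0, hst⟩) ?_ hwΛ
    change w - Λ'.apex ∈ (Λ'.rotate s).dirs
    rw [dirs_eq_arc hu (rotate_axis eμ s)]
    exact ⟨r, hr, φ, hs1, hs2, e⟩
  -- A direction common to both cones would lead a ray from the apex of `Λ` into `M`, contradicting
  -- disjointness.
  have hβ : ν + Λ.angle ≤ μ - Λ'.angle := by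
    by_contra! hlt
    obtain ⟨φ, hφ1, hφ2⟩ := exists_between
      (show max (ν - Λ.angle) (μ - Λ'.angle) < ν + Λ.angle from max_lt (by linarith) hlt)
    obtain ⟨hφ3, hφ4⟩ := max_lt_iff.1 hφ1
    set w := Λ₀.axis * Complex.exp (φ * Complex.I) with hw
    have hwM : w ∈ M.dirs := by
      rw [hMd]
      exact ⟨1, one_pos, φ, hφ4, by linarith, by rw [Complex.ofReal_one, one_mul]⟩
    have hwΛ : w ∈ Λ.dirs := by
      rw [dirs_eq_arc hu eν]
      exact ⟨1, one_pos, φ, hφ3, hφ2, by rw [Complex.ofReal_one, one_mul]⟩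
    obtain ⟨n, hn, hn0⟩ := ((eventually_add_mem_dirs hwM (Λ.apex - M.apex)).and
      (eventually_gt_atTop 0)).exists
    refine Set.disjoint_left.1 hMΛ (show Λ.apex + (n : ℂ) * w ∈ M.region from ?_) ?_
    · rw [mem_region_iff]
      convert hn using 1
      ring
    · rw [mem_region_iff, add_sub_cancel_left]
      have := smul_mem_dirs hwΛ (r := n) (by exact_mod_cast hn0)
      rwa [Complex.ofReal_natCast] at this
  refine ⟨⟨M, ⟨⟨x, hMsub⟩, ⟨x, h⟩, hMΛ, μ - Λ'.angle, by linarith, by linarith, hMd.ge⟩, ?_⟩,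
    μ - Λ'.angle, by linarith, by linarith, ?_⟩
  · refine region_subset_of_apex_eq ?_ rfl
    rw [hMd, dirs_eq_arc hu eμ]
    exact arc_mono le_rfl (by linarith)
  · rw [dirs_eq_arc hu eν]
    exact arc_mono (by linarith) hβ

/-- Both cones contain all directions just to the right of the left edge of `Λ₀`. A cone with such
directions, translated far enough, lies in both. -/
theorem IsLeftSector.exists_common {Λ₀ M₁ M₂ Λ₁ Λ₂ : Cone} (hΛ₀ : Λ₀.angle ≤ Real.pi / 2)
    (h₁ : IsLeftSector Λ₀ M₁ Λ₁) (h₂ : IsLeftSector Λ₀ M₂ Λ₂) :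
    ∃ M : Cone, M.FitsIn Λ₀ ∧ M.region ⊆ M₁.region ∧ M.region ⊆ M₂.region := by
  have hpi := Real.pi_pos
  obtain ⟨α₁, h1, h2, h3⟩ := h₁.arc_subset
  obtain ⟨α₂, h1', h2', h3'⟩ := h₂.arc_subset
  have hle := le_max_left α₁ α₂
  have hle' := le_max_right α₁ α₂
  set N := ofArc 0 Λ₀.axis Λ₀.norm_axis (max α₁ α₂) Λ₀.angle (max_lt h2 h2') (by linarith) with hN
  have hNd : N.dirs = arc Λ₀.axis (max α₁ α₂) Λ₀.angle := dirs_ofArc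
  have hN₁ : N.dirs ⊆ M₁.dirs := by rw [hNd]; exact (arc_mono hle le_rfl).trans h3
  have hN₂ : N.dirs ⊆ M₂.dirs := by rw [hNd]; exact (arc_mono hle' le_rfl).trans h3'
  obtain ⟨p, hp⟩ := N.exists_toPlane_mem_dirs
  obtain ⟨n, hn₁, hn₂⟩ :=
    ((eventually_translate_subset (h₁.fitsIn.angle_le hΛ₀) hN₁ (hN₁ hp)).and
      (eventually_translate_subset (h₂.fitsIn.angle_le hΛ₀) hN₂ (hN₂ hp))).exists
  obtain ⟨x, hx⟩ := h₁.fitsIn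
  exact ⟨_, ⟨x, hn₁.trans hx⟩, hn₁, hn₂⟩

/-- Let `Λ` open from the right edge of `Λ₀` up to `β`, with its apex moved back until it contains
both cones. The rest of the angular interval of `Λ₀`, at the same apex, is a cone to the left of
`Λ`. -/
theorem exists_common_isLeftOf {Λ₀ Λ₁ Λ₂ : Cone} (hΛ₀ : Λ₀.angle ≤ Real.pi / 2) {β₁ β₂ : ℝ}
    (h₁ : -Λ₀.angle < β₁) (h₁' : β₁ < Λ₀.angle) (h₂' : β₂ < Λ₀.angle)
    (hd₁ : Λ₁.dirs ⊆ arc Λ₀.axis (-Λ₀.angle) β₁) (hd₂ : Λ₂.dirs ⊆ arc Λ₀.axis (-Λ₀.angle) β₂) :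
    ∃ Λ M : Cone, Λ₁.region ⊆ Λ.region ∧ Λ₂.region ⊆ Λ.region ∧ IsLeftSector Λ₀ M Λ ∧
      IsLeftOf Λ₀ M Λ := by
  have hpi := Real.pi_pos
  have hpos := Λ₀.angle_pos
  set β := max β₁ β₂ with hβ
  have hle : β₁ ≤ β := le_max_left β₁ β₂
  have hle' : β₂ ≤ β := le_max_right β₁ β₂
  have hlt : β < Λ₀.angle := max_lt h₁' h₂'
  have hu := Λ₀.norm_axis
  set B := ofArc 0 Λ₀.axis hu (-Λ₀.angle) β (by linarith) (by linarith) with hB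
  have hBd : B.dirs = arc Λ₀.axis (-Λ₀.angle) β := dirs_ofArc
  have hBc : B.angle ≤ Real.pi / 2 := by
    change (β - -Λ₀.angle) / 2 ≤ _
    linarith
  obtain ⟨p, hp⟩ := B.exists_toPlane_mem_dirs
  have hd₁' : Λ₁.dirs ⊆ B.dirs := by rw [hBd]; exact hd₁.trans (arc_mono le_rfl hle)
  have hd₂' : Λ₂.dirs ⊆ B.dirs := by rw [hBd]; exact hd₂.trans (arc_mono le_rfl hle')
  obtain ⟨n, hn₁, hn₂⟩ := ((eventually_subset_translate hBc hd₁' hp).and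
    (eventually_subset_translate hBc hd₂' hp)).exists
  set Λ := B.translate (-(n • p)) with hΛ
  set M := ofArc Λ.apex Λ₀.axis hu β Λ₀.angle hlt (by linarith) with hM
  have hMd : M.dirs = arc Λ₀.axis β Λ₀.angle := dirs_ofArc
  have hΛfit : Λ.FitsIn Λ₀ := FitsIn.of_dirs hΛ₀ (by
    rw [hΛ, dirs_translate, hBd, dirs_eq_arc_axis]
    exact arc_mono le_rfl hlt.le)
  have hMfit : M.FitsIn Λ₀ := FitsIn.of_dirs hΛ₀ (by
    rw [hMd, dirs_eq_arc_axis]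
    exact arc_mono (by linarith) le_rfl)
  have hrot : ∀ s, 0 ≤ s → s ≤ Real.pi → Disjoint (M.rotate s).region Λ.region := by
    intro s hs hs'
    have hdir : (M.rotate s).dirs = arc Λ₀.axis (β + s) (Λ₀.angle + s) := by
      rw [dirs_eq_arc hu (rotate_axis (Λ := M) rfl s)]
      change arc _ ((β + Λ₀.angle) / 2 + s - (Λ₀.angle - β) / 2)
        ((β + Λ₀.angle) / 2 + s + (Λ₀.angle - β) / 2) = _
      congr 1 <;> ring
    rw [Set.disjoint_left]
    intro w hw hw'
    have h1 : w - Λ.apex ∈ (M.rotate s).dirs := hw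
    have h2 : w - Λ.apex ∈ B.dirs := hw'
    rw [hdir] at h1
    rw [hBd] at h2
    exact Set.disjoint_left.1 (disjoint_arc hu (by linarith) (by linarith)) h2 h1
  have hdisj : Disjoint M.region Λ.region := by
    have := hrot 0 le_rfl hpi.le
    have e : M.rotate 0 = M := by simp [rotate]
    rwa [e] at this
  obtain ⟨z, hz1, hz2, -⟩ := GNS.exists_common_fitsIn hΛ₀ hMfit hΛfit 0
  refine ⟨Λ, M, hn₁, hn₂, ⟨hMfit, hΛfit, hdisj, β, by linarith, hlt, hMd.ge⟩, z, hz1, hz2,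
    Real.pi / 2, by linarith, ?_, fun s hs => hrot s hs.1 (by linarith [hs.2])⟩
  -- A quarter turn suffices: it carries the left edge beyond that of `Λ₀`, and up to a half turn
  -- the rotated cone does not reach `Λ` from the other side.
  by_contra hempty
  have hsub : (M.rotate (Real.pi / 2)).region ⊆ (Λ₀.translate z).region := by
    intro w hw
    by_contra hw'
    exact hempty ⟨w, hw, hw'⟩
  have := abs_add_angle_le (M := Λ₀.translate z) hΛ₀ hsub
    (μ := (β + Λ₀.angle) / 2 + Real.pi / 2)
    (by rw [abs_of_nonneg (by linarith)]; linarith) (rotate_axis (Λ := M) rfl _)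
  rw [abs_of_nonneg (by linarith)] at this
  change (β + Λ₀.angle) / 2 + Real.pi / 2 + (Λ₀.angle - β) / 2 ≤ Λ₀.angle at this
  linarith

end Cone

/-! ### The braiding -/

namespace GNS

variable {G : GNS ω H} {Λ₀ : Cone}

theorem disjoint_vertices {M N : Cone} (h : Disjoint M.region N.region) :
    Disjoint M.vertices N.vertices :=
  Set.disjoint_left.2 fun _ h1 h2 => Set.disjoint_left.1 h h1 h2

theorem IsBraidable.isSector {ρ : G.Endo Λ₀} (h : IsBraidable ρ) : IsSector ρ := by
  obtain ⟨Λ, Λ', ⟨x, -, hx, -⟩, hloc⟩ := h.localized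
  exact ⟨⟨Λ, ⟨x, hx⟩, hloc⟩, h.transportable⟩

/-- Two braidable sectors are localized in a common cone that has a cone to the left. -/
theorem IsBraidable.exists_common (hΛ₀ : Λ₀.angle ≤ Real.pi / 2) {ρ ρ' : G.Endo Λ₀}
    (h : IsBraidable ρ) (h' : IsBraidable ρ') : ∃ Λ M : Cone,
    G.LocalizedIn (Endo.toRep ρ) Λ ∧ G.LocalizedIn (Endo.toRep ρ') Λ ∧
      Cone.IsLeftSector Λ₀ M Λ ∧ Cone.IsLeftOf Λ₀ M Λ := by
  obtain ⟨Λ₁, Λ₁', hl₁, hloc₁⟩ := h.localized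
  obtain ⟨Λ₂, Λ₂', hl₂, hloc₂⟩ := h'.localized
  obtain ⟨-, β₁, h1, h2, h3⟩ := hl₁.exists_isLeftSector hΛ₀
  obtain ⟨-, β₂, h1', h2', h3'⟩ := hl₂.exists_isLeftSector hΛ₀
  obtain ⟨Λ, M, h4, h5, h6, h7⟩ := Cone.exists_common_isLeftOf hΛ₀ h1 h2 h2' h3 h3'
  exact ⟨Λ, M, hloc₁.mono h4, hloc₂.mono h5, h6, h7⟩

theorem IsBraidable.tensor (hω : IsGroundState ω) (hΛ₀ : Λ₀.angle ≤ Real.pi / 2)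
    {ρ ρ' : G.Endo Λ₀} (h : IsBraidable ρ) (h' : IsBraidable ρ') :
    IsBraidable (GNS.tensor ρ ρ') := by
  obtain ⟨Λ, M, h1, h2, -, h3⟩ := h.exists_common hΛ₀ h'
  exact ⟨⟨Λ, M, h3, h1.tensor hω hΛ₀ h.isSector h2⟩,
    (h.isSector.tensor hω hΛ₀ h'.isSector).transportable⟩

/-- Sectors that are localized in disjoint cones commute. -/
theorem tensor_comm_of_disjoint (hω : IsGroundState ω) (hΛ₀ : Λ₀.angle ≤ Real.pi / 2)
    {ρ σ : G.Endo Λ₀} (hρ : IsSector ρ) (hσ : IsSector σ) {N M : Cone} (hN : N.FitsIn Λ₀)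
    (hM : M.FitsIn Λ₀) (hρN : G.LocalizedIn (Endo.toRep ρ) N)
    (hσM : G.LocalizedIn (Endo.toRep σ) M) (hd : Disjoint M.vertices N.vertices) :
    tensor ρ σ = tensor σ ρ := by
  refine StarAlgHom.ext fun a => Subtype.ext
    (eq_of_local (φ := Endo.toRep (tensor ρ σ)) (ψ := Endo.toRep (tensor σ ρ)) (fun v a ha => ?_) a)
  refine congrArg Subtype.val (show ext ρ (σ a) = ext σ (ρ a) from ?_)
  have hout {τ : G.Endo Λ₀} {K : Cone} (hτ : G.LocalizedIn (Endo.toRep τ) K)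
      (hv : v ∉ K.vertices) : τ a = G.incl Λ₀ a :=
    Subtype.ext (hτ a (localAlgebra_mono (Set.singleton_subset_iff.2 hv) ha))
  have hin {τ : G.Endo Λ₀} {K : Cone} (hK : K.FitsIn Λ₀) (hτ : G.LocalizedIn (Endo.toRep τ) K)
      (hv : v ∈ K.vertices) : (τ a : H →L[ℂ] H) ∈ G.vonNeumann K.vertices :=
    hτ.map_mem hω (hK.angle_le hΛ₀) (localAlgebra_mono (Set.singleton_subset_iff.2 hv) ha)
  -- At a single site at most one of the sectors acts nontrivially, and its value lies in a cone
  -- algebra that the extension of the other one fixes.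
  by_cases hvM : v ∈ M.vertices
  · rw [ext_apply_of_disjoint hω hΛ₀ hρ hρN hd hM (hin hM hσM hvM),
      hout hρN (Set.disjoint_left.1 hd hvM), ext_incl hω hΛ₀ hσ]
  · rw [hout hσM hvM, ext_incl hω hΛ₀ hρ]
    by_cases hvN : v ∈ N.vertices
    · rw [ext_apply_of_disjoint hω hΛ₀ hσ hσM hd.symm hN (hin hN hρN hvN)]
    · rw [hout hρN hvN, ext_incl hω hΛ₀ hσ, hout hσM hvM]

theorem Endo.isIntertwiner_conj_conj {ρ₁ ρ₂ : G.Endo Λ₀} {T : G.aux Λ₀}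
    (hT : IsIntertwiner ρ₁ ρ₂ (T : H →L[ℂ] H)) (U₁ U₂ : unitary (G.aux Λ₀)) :
    IsIntertwiner (Endo.conj ρ₁ U₁) (Endo.conj ρ₂ U₂)
      ((U₂ * T * star (U₁ : G.aux Λ₀) : G.aux Λ₀) : H →L[ℂ] H) := fun a => by
  have h : T * ρ₁ a = ρ₂ a * T := Subtype.ext (hT a)
  have h1 : star (U₁ : G.aux Λ₀) * U₁ = 1 := (Unitary.mem_iff.1 U₁.2).1
  have h2 : star (U₂ : G.aux Λ₀) * U₂ = 1 := (Unitary.mem_iff.1 U₂.2).1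
  refine congrArg Subtype.val (show (U₂ * T * star (U₁ : G.aux Λ₀) : G.aux Λ₀) *
    Endo.conj ρ₁ U₁ a = Endo.conj ρ₂ U₂ a * (U₂ * T * star (U₁ : G.aux Λ₀)) from ?_)
  rw [Endo.conj_apply, Endo.conj_apply]
  calc _ = U₂ * T * (star (U₁ : G.aux Λ₀) * U₁) * ρ₁ a * star (U₁ : G.aux Λ₀) := by
        simp only [mul_assoc]
    _ = U₂ * (T * ρ₁ a) * star (U₁ : G.aux Λ₀) := by rw [h1, mul_one]; simp only [mul_assoc]
    _ = U₂ * ρ₂ a * (star (U₂ : G.aux Λ₀) * U₂) * T * star (U₁ : G.aux Λ₀) := by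
        rw [h, h2, mul_one]
        simp only [mul_assoc]
    _ = _ := by simp only [mul_assoc]

/-- If `U₁` and `U₂` move two sectors into a cone that is disjoint from the localization cone of
`ρ`, then `U† ρ̄(U)` is natural. -/
theorem star_mul_ext_natural (hω : IsGroundState ω) (hΛ₀ : Λ₀.angle ≤ Real.pi / 2)
    {ρ ρ₁ ρ₂ : G.Endo Λ₀} (hρ : IsSector ρ) {M Λ : Cone} (hM : M.FitsIn Λ₀)
    (hd : Disjoint M.region Λ.region) (hΛ : G.LocalizedIn (Endo.toRep ρ) Λ)
    {U₁ U₂ : unitary (G.aux Λ₀)} (h₁ : G.LocalizedIn (Endo.toRep (Endo.conj ρ₁ U₁)) M)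
    (h₂ : G.LocalizedIn (Endo.toRep (Endo.conj ρ₂ U₂)) M) {T : G.aux Λ₀}
    (hT : IsIntertwiner ρ₁ ρ₂ (T : H →L[ℂ] H)) :
    star (U₂ : G.aux Λ₀) * ext ρ U₂ * ext ρ T = T * (star (U₁ : G.aux Λ₀) * ext ρ U₁) := by
  have h1 : star (U₁ : G.aux Λ₀) * U₁ = 1 := (Unitary.mem_iff.1 U₁.2).1
  have h2 : star (U₂ : G.aux Λ₀) * U₂ = 1 := (Unitary.mem_iff.1 U₂.2).1
  -- `U₂ T U₁†` intertwines two sectors localized in `M`, so it lies in the algebra of `M` and is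
  -- fixed by `ρ̄`.
  have hmem := h₁.intertwiner_mem hω (hM.angle_le hΛ₀) h₂
    (Endo.isIntertwiner_conj_conj hT U₁ U₂)
  have hfix := ext_apply_of_disjoint hω hΛ₀ hρ hΛ (disjoint_vertices hd) hM hmem
  have e : (U₂ : G.aux Λ₀) * T = U₂ * T * star (U₁ : G.aux Λ₀) * U₁ := by
    rw [mul_assoc _ (star (U₁ : G.aux Λ₀)), h1, mul_one]
  rw [mul_assoc, ← map_mul, e, map_mul, hfix]
  calc _ = (star (U₂ : G.aux Λ₀) * U₂) * T * star (U₁ : G.aux Λ₀) * ext ρ U₁ := by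
        simp only [mul_assoc]
    _ = _ := by rw [h2, one_mul, mul_assoc]

/-- The element `U† ρ̄(U)` does not depend on the choices. -/
theorem star_mul_ext_eq (hω : IsGroundState ω) (hΛ₀ : Λ₀.angle ≤ Real.pi / 2)
    {ρ ρ' : G.Endo Λ₀} (hρ : IsSector ρ) (hρ' : IsSector ρ') {M₁ Λ₁ M₂ Λ₂ : Cone}
    (h₁ : Cone.IsLeftSector Λ₀ M₁ Λ₁) (h₂ : Cone.IsLeftSector Λ₀ M₂ Λ₂)
    (hΛ₁ : G.LocalizedIn (Endo.toRep ρ) Λ₁) (hΛ₂ : G.LocalizedIn (Endo.toRep ρ) Λ₂)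
    {U₁ U₂ : unitary (G.aux Λ₀)} (hU₁ : G.LocalizedIn (Endo.toRep (Endo.conj ρ' U₁)) M₁)
    (hU₂ : G.LocalizedIn (Endo.toRep (Endo.conj ρ' U₂)) M₂) :
    star (U₁ : G.aux Λ₀) * ext ρ U₁ = star (U₂ : G.aux Λ₀) * ext ρ U₂ := by
  -- Both choices are compared with a transporter into a common subcone, by naturality for the
  -- identity intertwiner.
  obtain ⟨M, hM, hM₁, hM₂⟩ := h₁.exists_common hΛ₀ h₂
  obtain ⟨U, hU, -⟩ := hρ'.exists_conj hω hΛ₀ hM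
  have hone : IsIntertwiner ρ' ρ' ((1 : G.aux Λ₀) : H →L[ℂ] H) := fun a => by simp
  have e₁ := star_mul_ext_natural hω hΛ₀ hρ h₁.fitsIn h₁.disjoint hΛ₁ hU₁ (hU.mono hM₁) hone
  have e₂ := star_mul_ext_natural hω hΛ₀ hρ h₂.fitsIn h₂.disjoint hΛ₂ hU₂ (hU.mono hM₂) hone
  rw [map_one, mul_one, one_mul] at e₁ e₂
  rw [← e₁, ← e₂]

/-- The unitary of a choice lies in `𝒜ᵃᵘ`, and moves the sector into a cone at the left boundary. -/
theorem IsChoice.exists_unitary (hω : IsGroundState ω) (hΛ₀ : Λ₀.angle ≤ Real.pi / 2)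
    {ρ ρ' : G.Endo Λ₀} (hρ' : IsSector ρ') {Λ Λ' : Cone} {U : H →L[ℂ] H}
    (h : IsChoice ρ ρ' Λ Λ' U) : ∃ W : unitary (G.aux Λ₀), ((W : G.aux Λ₀) : H →L[ℂ] H) = U ∧
      ∃ M, Cone.IsLeftSector Λ₀ M Λ ∧ G.LocalizedIn (Endo.toRep (Endo.conj ρ' W)) M := by
  obtain ⟨⟨M, hM, hΛM⟩, -⟩ := h.left.exists_isLeftSector hΛ₀
  obtain ⟨V, hV, hVs⟩ := hρ'.exists_conj hω hΛ₀ hM.fitsIn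
  have hU := Unitary.mem_iff.1 h.mem_unitary
  have hVu := Unitary.mem_iff.1 (coe_mem_unitary V)
  -- `V` is a transporter into the same sector that is already known to lie in `𝒜ᵃᵘ`. By Haag
  -- duality `U` differs from it by an element of a cone algebra.
  have hmem : U * star ((V : G.aux Λ₀) : H →L[ℂ] H) ∈ G.vonNeumann M.vertices := by
    refine haag_duality hω (hM.fitsIn.angle_le hΛ₀) (commutesWith_iff.2 fun a ha => ?_)
    have e1 : ((V : G.aux Λ₀) : H →L[ℂ] H) * ρ' a * star ((V : G.aux Λ₀) : H →L[ℂ] H) = G.rep a :=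
      hV a ha
    have e2 := h.transport a
      (localAlgebra_mono (Set.compl_subset_compl.2 (Cone.vertices_mono hΛM)) ha)
    rw [commute_iff_eq]
    calc _ = U * star ((V : G.aux Λ₀) : H →L[ℂ] H) *
          (((V : G.aux Λ₀) : H →L[ℂ] H) * ρ' a * star ((V : G.aux Λ₀) : H →L[ℂ] H)) := by rw [e1]
      _ = U * ρ' a * star ((V : G.aux Λ₀) : H →L[ℂ] H) := by
          simp only [mul_assoc, star_mul_of_unitary (coe_mem_unitary V)]
      _ = U * ρ' a * star U * (U * star ((V : G.aux Λ₀) : H →L[ℂ] H)) := by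
          simp only [mul_assoc, star_mul_of_unitary h.mem_unitary]
      _ = _ := by rw [e2]
  have hUaux : U ∈ G.aux Λ₀ := by
    have := mul_mem (vonNeumann_le_of_fitsIn hM.fitsIn hmem) (V : G.aux Λ₀).2
    rwa [mul_assoc, hVu.1, mul_one] at this
  refine ⟨⟨⟨U, hUaux⟩, Unitary.mem_iff.2 ⟨Subtype.ext hU.1, Subtype.ext hU.2⟩⟩, rfl, M, hM,
    LocalizedIn.mono (N := Λ') (fun a ha => h.transport a ha) hΛM⟩

theorem exists_isChoice (hω : IsGroundState ω) (hΛ₀ : Λ₀.angle ≤ Real.pi / 2) {ρ ρ' : G.Endo Λ₀}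
    (hρ' : IsSector ρ') {Λ Λ' : Cone} (hΛ : G.LocalizedIn (Endo.toRep ρ) Λ)
    (h : Cone.IsLeftOf Λ₀ Λ' Λ) : ∃ U : unitary (G.aux Λ₀),
      IsChoice ρ ρ' Λ Λ' ((U : G.aux Λ₀) : H →L[ℂ] H) := by
  have hfit : Λ'.FitsIn Λ₀ := by
    obtain ⟨x, hx, -⟩ := h
    exact ⟨x, hx⟩
  obtain ⟨U, hU, -⟩ := hρ'.exists_conj hω hΛ₀ hfit
  exact ⟨U, hΛ, h, coe_mem_unitary U, hU⟩

/-- The braiding may be computed with any transporter into a left sector, even if that sector does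
not come from a rotating cone. This lets one pair of cones serve several sectors at once. -/
theorem braiding_eq (hω : IsGroundState ω) (hΛ₀ : Λ₀.angle ≤ Real.pi / 2) {ρ ρ' : G.Endo Λ₀}
    (hρ : IsBraidable ρ) (hρ' : IsSector ρ') {M Λ : Cone} (h : Cone.IsLeftSector Λ₀ M Λ)
    (hΛ : G.LocalizedIn (Endo.toRep ρ) Λ) {U : unitary (G.aux Λ₀)}
    (hU : G.LocalizedIn (Endo.toRep (Endo.conj ρ' U)) M) :
    braiding ρ ρ' = star (U : G.aux Λ₀) * ext ρ U := by
  have hex : ∃ ε, IsBraiding ρ ρ' ε := by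
    obtain ⟨Λ₁, Λ₁', hl, hloc⟩ := hρ.localized
    obtain ⟨V, hV⟩ := exists_isChoice hω hΛ₀ hρ' hloc hl
    exact ⟨_, Λ₁, Λ₁', V, hV, rfl⟩
  rw [braiding, dif_pos hex]
  obtain ⟨Λ₁, Λ₁', V, hV, e⟩ := hex.choose_spec
  obtain ⟨W, hW, M₁, hM₁, hWM⟩ := hV.exists_unitary hω hΛ₀ hρ'
  obtain rfl : (W : G.aux Λ₀) = V := Subtype.ext hW
  rw [e]
  exact star_mul_ext_eq hω hΛ₀ hρ.isSector hρ' hM₁ h hV.localized hΛ hWM hU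

theorem IsChoice.braiding_eq (hω : IsGroundState ω) (hΛ₀ : Λ₀.angle ≤ Real.pi / 2)
    {ρ ρ' : G.Endo Λ₀} (hρ : IsBraidable ρ) (hρ' : IsSector ρ') {Λ Λ' : Cone} {U : H →L[ℂ] H}
    (h : IsChoice ρ ρ' Λ Λ' U) : ∃ hU : U ∈ G.aux Λ₀, braiding ρ ρ' =
      star (⟨U, hU⟩ : G.aux Λ₀) * ext ρ ⟨U, hU⟩ := by
  obtain ⟨W, rfl, M, hM, hWM⟩ := h.exists_unitary hω hΛ₀ hρ'
  exact ⟨(W : G.aux Λ₀).2, GNS.braiding_eq hω hΛ₀ hρ hρ' hM h.localized hWM⟩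

/-- With `σ = U ρ'(·) U†` localized in `M`, disjoint from `Λ`, one has `ρ ⊗ σ = σ ⊗ ρ`. Expressed
through `ρ'`, this equality is the intertwining relation for `U† ρ̄(U)`. -/
theorem isIntertwiner_braiding (hω : IsGroundState ω) (hΛ₀ : Λ₀.angle ≤ Real.pi / 2)
    {ρ ρ' : G.Endo Λ₀} (hρ : IsBraidable ρ) (hρ' : IsSector ρ') :
    IsIntertwiner (tensor ρ ρ') (tensor ρ' ρ) (braiding ρ ρ' : H →L[ℂ] H) := fun a => by
  obtain ⟨Λ, M, hΛ, -, hM, -⟩ := hρ.exists_common hΛ₀ hρ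
  obtain ⟨U, hU, hUs⟩ := hρ'.exists_conj hω hΛ₀ hM.fitsIn
  have hU1 : star (U : G.aux Λ₀) * U = 1 := (Unitary.mem_iff.1 U.2).1
  rw [braiding_eq hω hΛ₀ hρ hρ' hM hΛ hU]
  have hc := DFunLike.congr_fun (tensor_comm_of_disjoint hω hΛ₀ hρ.isSector hUs hM.fitsIn_right
    hM.fitsIn hΛ hU (disjoint_vertices hM.disjoint)) a
  change ext ρ (Endo.conj ρ' U a) = ext (Endo.conj ρ' U) (ρ a) at hc
  rw [ext_conj hω hΛ₀ hρ' hUs, Endo.conj_apply, map_mul, map_mul, map_star] at hc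
  refine congrArg Subtype.val (show star (U : G.aux Λ₀) * ext ρ U * ext ρ (ρ' a) =
    ext ρ' (ρ a) * (star (U : G.aux Λ₀) * ext ρ U) from ?_)
  have hU2 : star (ext ρ (U : G.aux Λ₀)) * ext ρ U = 1 := by
    rw [← map_star, ← map_mul, hU1, map_one]
  calc _ = star (U : G.aux Λ₀) * (ext ρ U * ext ρ (ρ' a) * star (ext ρ (U : G.aux Λ₀))) *
        ext ρ U := by
        simp only [mul_assoc, hU2, mul_one]
    _ = (star (U : G.aux Λ₀) * U) * ext ρ' (ρ a) * star (U : G.aux Λ₀) * ext ρ U := by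
        rw [hc]
        simp only [mul_assoc]
    _ = _ := by rw [hU1, one_mul, mul_assoc]

/-! ### Naturality and the braiding identities -/

theorem tensorHom_one (ρ : G.Endo Λ₀) (S : G.aux Λ₀) : tensorHom ρ S 1 = S := by
  rw [tensorHom, map_one, mul_one]

theorem one_tensorHom (ρ : G.Endo Λ₀) (T : G.aux Λ₀) : tensorHom ρ 1 T = ext ρ T :=
  one_mul _

/-- `S` lies in the algebra of the common cone `Λ`, so it is fixed by the extension of the
transported `ρ'`: `U ρ̄'(S) U† = S`. It also intertwines the extensions of `ρ₁` and `ρ₂` at `U`. -/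
theorem braiding_natural_left (hω : IsGroundState ω) (hΛ₀ : Λ₀.angle ≤ Real.pi / 2)
    {ρ₁ ρ₂ ρ' : G.Endo Λ₀} (hρ₁ : IsBraidable ρ₁) (hρ₂ : IsBraidable ρ₂) (hρ' : IsSector ρ')
    {S : G.aux Λ₀} (hS : IsIntertwiner ρ₁ ρ₂ (S : H →L[ℂ] H)) :
    braiding ρ₂ ρ' * S = ext ρ' S * braiding ρ₁ ρ' := by
  obtain ⟨Λ, M, hΛ₁, hΛ₂, hM, -⟩ := hρ₁.exists_common hΛ₀ hρ₂
  obtain ⟨U, hU, hUs⟩ := hρ'.exists_conj hω hΛ₀ hM.fitsIn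
  have hU1 : star (U : G.aux Λ₀) * U = 1 := (Unitary.mem_iff.1 U.2).1
  rw [braiding_eq hω hΛ₀ hρ₁ hρ' hM hΛ₁ hU, braiding_eq hω hΛ₀ hρ₂ hρ' hM hΛ₂ hU]
  have hmem := hΛ₁.intertwiner_mem hω (hM.fitsIn_right.angle_le hΛ₀) hΛ₂ hS
  have hfix := ext_apply_of_disjoint hω hΛ₀ hUs hU (disjoint_vertices hM.disjoint.symm)
    hM.fitsIn_right hmem
  rw [ext_conj hω hΛ₀ hρ' hUs] at hfix
  have e : S * ext ρ₁ U = ext ρ₂ U * S :=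
    Subtype.ext (hS.ext hω hΛ₀ hρ₁.isSector hρ₂.isSector U)
  calc _ = star (U : G.aux Λ₀) * S * ext ρ₁ U := by rw [mul_assoc, mul_assoc, e]
    _ = star (U : G.aux Λ₀) * (U * ext ρ' S * star (U : G.aux Λ₀)) * ext ρ₁ U := by rw [hfix]
    _ = (star (U : G.aux Λ₀) * U) * ext ρ' S * (star (U : G.aux Λ₀) * ext ρ₁ U) := by
        simp only [mul_assoc]
    _ = _ := by rw [hU1, one_mul]

theorem braiding_natural_right (hω : IsGroundState ω) (hΛ₀ : Λ₀.angle ≤ Real.pi / 2)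
    {ρ ρ'₁ ρ'₂ : G.Endo Λ₀} (hρ : IsBraidable ρ) (hρ'₁ : IsSector ρ'₁) (hρ'₂ : IsSector ρ'₂)
    {T : G.aux Λ₀} (hT : IsIntertwiner ρ'₁ ρ'₂ (T : H →L[ℂ] H)) :
    braiding ρ ρ'₂ * ext ρ T = T * braiding ρ ρ'₁ := by
  obtain ⟨Λ, M, hΛ, -, hM, -⟩ := hρ.exists_common hΛ₀ hρ
  obtain ⟨U₁, hU₁, -⟩ := hρ'₁.exists_conj hω hΛ₀ hM.fitsIn
  obtain ⟨U₂, hU₂, -⟩ := hρ'₂.exists_conj hω hΛ₀ hM.fitsIn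
  rw [braiding_eq hω hΛ₀ hρ hρ'₁ hM hΛ hU₁, braiding_eq hω hΛ₀ hρ hρ'₂ hM hΛ hU₂]
  exact star_mul_ext_natural hω hΛ₀ hρ.isSector hM.fitsIn hM.disjoint hΛ hU₁ hU₂ hT

/-- If `U` and `V` move `ρ'` and `ρ''` into `M`, then `U ρ̄'(V)` moves their tensor product there.
Reordering the factors uses that `ε_{ρ,ρ'}` intertwines the extended tensor products at `V`. -/
theorem braiding_tensor_right (hω : IsGroundState ω) (hΛ₀ : Λ₀.angle ≤ Real.pi / 2)
    {ρ ρ' ρ'' : G.Endo Λ₀} (hρ : IsBraidable ρ) (hρ' : IsSector ρ') (hρ'' : IsSector ρ'') :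
    braiding ρ (tensor ρ' ρ'') = ext ρ' (braiding ρ ρ'') * braiding ρ ρ' := by
  obtain ⟨Λ, M, hΛ, -, hM, -⟩ := hρ.exists_common hΛ₀ hρ
  obtain ⟨U, hU, hUs⟩ := hρ'.exists_conj hω hΛ₀ hM.fitsIn
  obtain ⟨V, hV, hVs⟩ := hρ''.exists_conj hω hΛ₀ hM.fitsIn
  have hW := hU.tensor hω hΛ₀ hUs hV
  rw [tensor_conj hω hΛ₀ hρ' hUs] at hW
  have hs := hρ.isSector
  have hτ := hρ'.tensor hω hΛ₀ hρ''
  have key : braiding ρ ρ' * ext ρ (ext ρ' V) = ext ρ' (ext ρ V) * braiding ρ ρ' := by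
    have := (isIntertwiner_braiding hω hΛ₀ hρ hρ').ext hω hΛ₀ (hs.tensor hω hΛ₀ hρ')
      (hρ'.tensor hω hΛ₀ hs) V
    rw [ext_tensor hω hΛ₀ hs hρ', ext_tensor hω hΛ₀ hρ' hs] at this
    exact Subtype.ext this
  rw [braiding_eq hω hΛ₀ hρ hτ hM hΛ hW, braiding_eq hω hΛ₀ hρ hρ'' hM hΛ hV, map_mul, mul_assoc,
    ← key, braiding_eq hω hΛ₀ hρ hρ' hM hΛ hU]
  change star ((U : G.aux Λ₀) * ext ρ' V) * ext ρ ((U : G.aux Λ₀) * ext ρ' V) = _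
  rw [star_mul, map_mul, map_star]
  simp only [mul_assoc]

/-- One transporter `U` of `ρ''` serves `ρ`, `ρ'` and `ρ ⊗ ρ'`, and the product telescopes through
`U U† = 1`. -/
theorem braiding_tensor_left (hω : IsGroundState ω) (hΛ₀ : Λ₀.angle ≤ Real.pi / 2)
    {ρ ρ' ρ'' : G.Endo Λ₀} (hρ : IsBraidable ρ) (hρ' : IsBraidable ρ') (hρ'' : IsSector ρ'') :
    braiding (tensor ρ ρ') ρ'' = braiding ρ ρ'' * ext ρ (braiding ρ' ρ'') := by
  obtain ⟨Λ, M, hΛ, hΛ', hM, -⟩ := hρ.exists_common hΛ₀ hρ'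
  obtain ⟨U, hU, -⟩ := hρ''.exists_conj hω hΛ₀ hM.fitsIn
  have hU1 : (U : G.aux Λ₀) * star (U : G.aux Λ₀) = 1 := (Unitary.mem_iff.1 U.2).2
  rw [braiding_eq hω hΛ₀ (hρ.tensor hω hΛ₀ hρ') hρ'' hM (hΛ.tensor hω hΛ₀ hρ.isSector hΛ') hU,
    braiding_eq hω hΛ₀ hρ hρ'' hM hΛ hU, braiding_eq hω hΛ₀ hρ' hρ'' hM hΛ' hU,
    ext_tensor hω hΛ₀ hρ.isSector hρ'.isSector, mul_assoc, ← map_mul, ← mul_assoc, hU1, one_mul]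

end GNS

end ColorCode

end

theorem mainTheorem9 {H : Type*} [NormedAddCommGroup H] [InnerProductSpace ℂ H] [CompleteSpace H]
    (ω : ColorCode.QuasiLocal →ₗ[ℂ] ℂ) (hω : ColorCode.IsGroundState ω)
    (G : ColorCode.GNS ω H) (Λ₀ : ColorCode.Cone) (hΛ₀ : Λ₀.angle ≤ Real.pi / 2) :
    -- the objects used in the definition make sense:
    -- extensions exist uniquely, intertwiners lie in the auxiliary algebra,
    -- and tensor products are again localized and transportable
    (∀ ρ : G.Endo Λ₀, ColorCode.GNS.IsSector ρ → ∃! e, ColorCode.GNS.IsExtension ρ e) ∧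
    (∀ ρ ρ' : G.Endo Λ₀, ColorCode.GNS.IsSector ρ → ColorCode.GNS.IsSector ρ' →
      ∀ T : H →L[ℂ] H, ColorCode.GNS.IsIntertwiner ρ ρ' T → T ∈ G.aux Λ₀) ∧
    (∀ ρ ρ' : G.Endo Λ₀, ColorCode.GNS.IsSector ρ → ColorCode.GNS.IsSector ρ' →
      ColorCode.GNS.IsSector (ColorCode.GNS.tensor ρ ρ')) ∧
    (∀ ρ ρ' : G.Endo Λ₀, ColorCode.GNS.IsBraidable ρ → ColorCode.GNS.IsBraidable ρ' →
      ColorCode.GNS.IsBraidable (ColorCode.GNS.tensor ρ ρ')) ∧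
    -- the braiding is well-defined: the required unitaries exist, and all choices agree
    (∀ ρ ρ' : G.Endo Λ₀, ColorCode.GNS.IsBraidable ρ → ColorCode.GNS.IsSector ρ' →
      (∀ Λ Λ' : ColorCode.Cone, G.LocalizedIn (ColorCode.GNS.Endo.toRep ρ) Λ →
        ColorCode.Cone.IsLeftOf Λ₀ Λ' Λ → ∃ U, ColorCode.GNS.IsChoice ρ ρ' Λ Λ' U) ∧
      (∀ (Λ Λ' : ColorCode.Cone) (U : H →L[ℂ] H), ColorCode.GNS.IsChoice ρ ρ' Λ Λ' U →
        ∃ hU : U ∈ G.aux Λ₀, ColorCode.GNS.braiding ρ ρ' =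
          star (⟨U, hU⟩ : G.aux Λ₀) * ColorCode.GNS.ext ρ ⟨U, hU⟩)) ∧
    -- i) it is an intertwiner from `ρ ⊗ ρ'` to `ρ' ⊗ ρ`
    (∀ ρ ρ' : G.Endo Λ₀, ColorCode.GNS.IsBraidable ρ → ColorCode.GNS.IsSector ρ' →
      ColorCode.GNS.IsIntertwiner (ColorCode.GNS.tensor ρ ρ') (ColorCode.GNS.tensor ρ' ρ)
        (ColorCode.GNS.braiding ρ ρ' : H →L[ℂ] H)) ∧
    -- ii) it is natural in both arguments
    (∀ ρ₁ ρ₂ ρ' : G.Endo Λ₀, ColorCode.GNS.IsBraidable ρ₁ → ColorCode.GNS.IsBraidable ρ₂ →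
      ColorCode.GNS.IsSector ρ' →
      ∀ S : G.aux Λ₀, ColorCode.GNS.IsIntertwiner ρ₁ ρ₂ (S : H →L[ℂ] H) →
        ColorCode.GNS.braiding ρ₂ ρ' * ColorCode.GNS.tensorHom ρ₁ S 1 =
          ColorCode.GNS.tensorHom ρ' 1 S * ColorCode.GNS.braiding ρ₁ ρ') ∧
    (∀ ρ ρ'₁ ρ'₂ : G.Endo Λ₀, ColorCode.GNS.IsBraidable ρ → ColorCode.GNS.IsSector ρ'₁ →
      ColorCode.GNS.IsSector ρ'₂ →
      ∀ T : G.aux Λ₀, ColorCode.GNS.IsIntertwiner ρ'₁ ρ'₂ (T : H →L[ℂ] H) →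
        ColorCode.GNS.braiding ρ ρ'₂ * ColorCode.GNS.tensorHom ρ 1 T =
          ColorCode.GNS.tensorHom ρ'₁ T 1 * ColorCode.GNS.braiding ρ ρ'₁) ∧
    -- iii) it satisfies the two braiding (hexagon) identities
    (∀ ρ ρ' ρ'' : G.Endo Λ₀, ColorCode.GNS.IsBraidable ρ → ColorCode.GNS.IsSector ρ' →
      ColorCode.GNS.IsSector ρ'' →
      ColorCode.GNS.braiding ρ (ColorCode.GNS.tensor ρ' ρ'') =
        ColorCode.GNS.tensorHom ρ' 1 (ColorCode.GNS.braiding ρ ρ'') *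
          ColorCode.GNS.tensorHom (ColorCode.GNS.tensor ρ ρ')
            (ColorCode.GNS.braiding ρ ρ') 1) ∧
    (∀ ρ ρ' ρ'' : G.Endo Λ₀, ColorCode.GNS.IsBraidable ρ → ColorCode.GNS.IsBraidable ρ' →
      ColorCode.GNS.IsSector ρ'' →
      ColorCode.GNS.braiding (ColorCode.GNS.tensor ρ ρ') ρ'' =
        ColorCode.GNS.tensorHom (ColorCode.GNS.tensor ρ ρ'')
            (ColorCode.GNS.braiding ρ ρ'') 1 *
          ColorCode.GNS.tensorHom ρ 1 (ColorCode.GNS.braiding ρ' ρ'')) := by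
  refine ⟨fun ρ hρ => ?_, fun ρ ρ' hρ hρ' T hT => hT.mem_aux hω hΛ₀ hρ hρ',
    fun ρ ρ' hρ hρ' => hρ.tensor hω hΛ₀ hρ', fun ρ ρ' hρ hρ' => hρ.tensor hω hΛ₀ hρ',
    fun ρ ρ' hρ hρ' => ⟨fun Λ Λ' hΛ hl => ?_, fun Λ Λ' U hU => hU.braiding_eq hω hΛ₀ hρ hρ'⟩,
    fun ρ ρ' hρ hρ' => ColorCode.GNS.isIntertwiner_braiding hω hΛ₀ hρ hρ',
    fun ρ₁ ρ₂ ρ' hρ₁ hρ₂ hρ' S hS => ?_, fun ρ ρ'₁ ρ'₂ hρ hρ'₁ hρ'₂ T hT => ?_,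
    fun ρ ρ' ρ'' hρ hρ' hρ'' => ?_, fun ρ ρ' ρ'' hρ hρ' hρ'' => ?_⟩
  · obtain ⟨e, he⟩ := ColorCode.GNS.exists_isExtension hω hΛ₀ hρ
    exact ⟨e, he, fun e' he' => he'.eq hΛ₀ he⟩
  · obtain ⟨U, hU⟩ := ColorCode.GNS.exists_isChoice hω hΛ₀ hρ' hΛ hl
    exact ⟨_, hU⟩
  · rw [ColorCode.GNS.tensorHom_one, ColorCode.GNS.one_tensorHom]
    exact ColorCode.GNS.braiding_natural_left hω hΛ₀ hρ₁ hρ₂ hρ' hS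
  · rw [ColorCode.GNS.tensorHom_one, ColorCode.GNS.one_tensorHom]
    exact ColorCode.GNS.braiding_natural_right hω hΛ₀ hρ hρ'₁ hρ'₂ hT
  · rw [ColorCode.GNS.tensorHom_one, ColorCode.GNS.one_tensorHom]
    exact ColorCode.GNS.braiding_tensor_right hω hΛ₀ hρ hρ' hρ''
  · rw [ColorCode.GNS.tensorHom_one, ColorCode.GNS.one_tensorHom]
    exact ColorCode.GNS.braiding_tensor_left hω hΛ₀ hρ hρ' hρ''
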